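/- Let $m\ge 1$, let $\vec h\in\mathbb R^m$, and let $(\vec\beta_p)_{p\ge 2}$ be vectors in $\mathbb R^m$ with $\vec\beta_p=0$ for odd $p$ and $\sum_{p\ge2}2^p\vec\beta_p(j)^2<\infty$ for every $j$. For a symmetric matrix $A$ with entries in $[-1,1]$ put $\xi'(A)=\sum_{p\ge 2}p\,(\vec\beta_p\otimes\vec\beta_p)\odot A^{\circ(p-1)}$ (entrywise products and powers), and let $\langle A,B\rangle=\sum_{i,j}A_{ij}B_{ij}$. Let $Q$ be a symmetric positive semidefinite $m\times m$ matrix with entries in $[-1,1]$ and unit diagonal. Consider pairs $(\mu,\Phi)$ in which $\mu$ is a Borel probability measure on $[0,m]$, with distribution function $x(t)=\mu([0,t])$ and $t_x=\inf\{t\in[0,m]:x(t)=1\}$, and $\Phi$ is a continuously differentiable path on $[0,m]$ of positive semidefinite $m\times m$ matrices, monotone in the positive semidefinite order, Lipschitz with Lipschitz derivative, with $\Phi(0)=0$, $\Phi(m)=Q$ and $\operatorname{Trace}\Phi(t)=t$ for all $t\in\operatorname{supp}\mu$. Call the pair admissible if moreover $t_x<m$ and $|Q-\Phi(t_x)|>0$,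 where $|\cdot|$ denotes the determinant. The Crisanti–Sommers functional of an admissible pair is $$\mathscr C(\mu,\Phi)=\frac12\Big[\int_0^m x(t)\big\langle\xi'(\Phi(t))+\vec h\vec h^T,\Phi'(t)\big\rangle\,dt+\log|\Phi(m)-\Phi(\hat T)|+\int_0^{\hat T}\big\langle\hat\Phi(t)^{-1},\Phi'(t)\big\rangle\,dt\Big],\qquad \hat\Phi(t)=\int_t^m x(s)\Phi'(s)\,ds,$$ where $\hat T\in(t_x,m)$ is any point with $|Q-\Phi(\hat T)|>0$ (the value does not depend on the choice). Let $(\mu_P,\Phi)$ minimize $\mathscr C$ over all admissible pairs. Suppose that there are a strictly increasing sequence $(u_l^-)_l$ and a strictly decreasing sequence $(u_l^+)_l$ of points of $\operatorname{supp}\mu_P$ with $\lim_l u_l^-=u_0=\lim_l u_l^+$. Then $\mu_P$ is continuous at $u_0$: the distribution function $t\mapsto\mu_P([0,t])$ is continuous at $u_0$, and $\mu_P(\{u_0\})=0$. -/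

import Mathlib

open MeasureTheory Set Filter Topology

namespace VectorSpin

noncomputable section

/-- Frobenius inner product `⟨A, B⟩ = ∑ᵢⱼ Aᵢⱼ Bᵢⱼ`. -/
def frob {m : ℕ} (A B : Matrix (Fin m) (Fin m) ℝ) : ℝ :=
  ∑ i, ∑ j, A i j * B i j

/-- Self-overlap constraints: symmetric positive semidefinite matrices with entries in `[-1, 1]`
and unit diagonal. -/
structure IsConstraint {m : ℕ} (Q : Matrix (Fin m) (Fin m) ℝ) : Prop where
  posSemidef : Q.PosSemidef
  entries : ∀ i j, Q i j ∈ Icc (-1 : ℝ) 1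
  diag : ∀ i, Q i i = 1

/-- Inverse temperatures `(β_p)_{p ≥ 2}` of a mixed even `p`-spin model with `m` copies; only the
values at `p ≥ 2` are used. -/
structure IsEvenMixture {m : ℕ} (β : ℕ → Fin m → ℝ) : Prop where
  even : ∀ p, 3 ≤ p → Odd p → ∀ j, β p j = 0
  summable : ∀ j, Summable fun p : ℕ => (2 : ℝ) ^ p * β p j ^ 2

/-- The matrix `ξ'(A) = ∑_{p ≥ 2} p (β_p ⊗ β_p) ⊙ A^{∘(p-1)}`; the summation index is `p - 2`. -/
def xiDeriv {m : ℕ} (β : ℕ → Fin m → ℝ) (A : Matrix (Fin m) (Fin m) ℝ) :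
    Matrix (Fin m) (Fin m) ℝ :=
  Matrix.of fun i j => ∑' p : ℕ, ((p : ℝ) + 2) * (β (p + 2) i * β (p + 2) j) * A i j ^ (p + 1)

/-- The distribution function `x(t) = μ([0, t])`. -/
def distFun (μ : Measure ℝ) (t : ℝ) : ℝ := μ.real (Icc 0 t)

/-- `t_x = inf {t ∈ [0, m] | x(t) = 1}`. -/
def topPoint (m : ℕ) (μ : Measure ℝ) : ℝ := sInf {t | t ∈ Icc (0 : ℝ) m ∧ distFun μ t = 1}

/-- The entrywise derivative `Φ'(t)` of a matrix path on `[0, m]` (one-sided at the end points). -/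
def pathDeriv {m : ℕ} (Φ : ℝ → Matrix (Fin m) (Fin m) ℝ) (t : ℝ) :
    Matrix (Fin m) (Fin m) ℝ :=
  Matrix.of fun i j => derivWithin (fun s => Φ s i j) (Icc (0 : ℝ) m) t

/-- `Φ̂(t) = ∫_t^m x(s) Φ'(s) ds`. -/
def hatPath {m : ℕ} (μ : Measure ℝ) (Φ : ℝ → Matrix (Fin m) (Fin m) ℝ) (t : ℝ) :
    Matrix (Fin m) (Fin m) ℝ :=
  Matrix.of fun i j => ∫ s in t..(m : ℝ), distFun μ s * pathDeriv Φ s i j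

/-- The Crisanti–Sommers functional with cut-off `T`. -/
def crisantiSommers {m : ℕ} (β : ℕ → Fin m → ℝ) (h : Fin m → ℝ) (μ : Measure ℝ)
    (Φ : ℝ → Matrix (Fin m) (Fin m) ℝ) (T : ℝ) : ℝ :=
  (1 / 2) *
    ((∫ t in (0 : ℝ)..(m : ℝ),
        distFun μ t * frob (xiDeriv β (Φ t) + Matrix.vecMulVec h h) (pathDeriv Φ t))
      + Real.log (Φ m - Φ T).det
      + ∫ t in (0 : ℝ)..T, frob (hatPath μ Φ t)⁻¹ (pathDeriv Φ t))

/-- Continuously differentiable monotone paths of positive semidefinite matrices from `0` to `Q`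
on `[0, m]`, Lipschitz with Lipschitz derivative, whose trace is `t` at every point `t` of the
support of `μ`. -/
structure IsRegularPath {m : ℕ} (Q : Matrix (Fin m) (Fin m) ℝ) (μ : Measure ℝ)
    (Φ : ℝ → Matrix (Fin m) (Fin m) ℝ) : Prop where
  posSemidef : ∀ t ∈ Icc (0 : ℝ) m, (Φ t).PosSemidef
  monotone : ∀ s ∈ Icc (0 : ℝ) m, ∀ t ∈ Icc (0 : ℝ) m, s ≤ t → (Φ t - Φ s).PosSemidef
  start : Φ 0 = 0
  finish : Φ m = Q
  differentiable : ∀ i j, DifferentiableOn ℝ (fun t => Φ t i j) (Icc (0 : ℝ) m)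
  lipschitz : ∃ K : NNReal, ∀ i j, LipschitzOnWith K (fun t => Φ t i j) (Icc (0 : ℝ) m)
  lipschitz_deriv :
    ∃ K : NNReal, ∀ i j, LipschitzOnWith K (fun t => pathDeriv Φ t i j) (Icc (0 : ℝ) m)
  trace_eq : ∀ t ∈ μ.support, (Φ t).trace = t

/-- Pairs on which the functional is defined: `μ` is a probability measure on `[0, m]`, `Φ` is a
regular path for `μ`, `t_x < m` and `|Q - Φ(t_x)| > 0`. -/
structure IsAdmissible {m : ℕ} (Q : Matrix (Fin m) (Fin m) ℝ) (μ : Measure ℝ)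
    (Φ : ℝ → Matrix (Fin m) (Fin m) ℝ) : Prop where
  prob : IsProbabilityMeasure μ
  concentrated : μ (Icc (0 : ℝ) m)ᶜ = 0
  path : IsRegularPath Q μ Φ
  top_lt : topPoint m μ < m
  det_pos : 0 < (Q - Φ (topPoint m μ)).det

/-- Cut-offs `t_x < T < m` with `|Q - Φ(T)| > 0`. The value of the functional is the same for all
of them. -/
def IsCutoff {m : ℕ} (Q : Matrix (Fin m) (Fin m) ℝ) (μ : Measure ℝ)
    (Φ : ℝ → Matrix (Fin m) (Fin m) ℝ) (T : ℝ) : Prop :=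
  topPoint m μ < T ∧ T < m ∧ 0 < (Q - Φ T).det

/-- `(μ, Φ)` minimizes the Crisanti–Sommers functional over all admissible pairs. -/
def IsCSMinimizer {m : ℕ} (β : ℕ → Fin m → ℝ) (h : Fin m → ℝ) (Q : Matrix (Fin m) (Fin m) ℝ)
    (μ : Measure ℝ) (Φ : ℝ → Matrix (Fin m) (Fin m) ℝ) : Prop :=
  IsAdmissible Q μ Φ ∧
    ∀ (ν : Measure ℝ) (Ψ : ℝ → Matrix (Fin m) (Fin m) ℝ), IsAdmissible Q ν Ψ →
      ∀ T S : ℝ, IsCutoff Q μ Φ T → IsCutoff Q ν Ψ S →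
        crisantiSommers β h μ Φ T ≤ crisantiSommers β h ν Ψ S

end

end VectorSpin

/-!
Perturb the path of a minimizer, absorbing the change of trace into a time change: the first
variation gives `∫ ⟨F, R - Φ⟩ dμ ≤ 0` for every competing path `R`, where the force is
`F(t) = ξ'(Φ(t)) + h hᵀ - ∫₀ᵗ Φ̂⁻¹ Φ' Φ̂⁻¹`. Since `R` is only constrained to be increasing, the
multiplier `Λ(t) = -∫_{r > t} F dμ` is positive semidefinite and `⟨Λ(t), Φ'(t)⟩ = 0`.

Suppose that `μ` has an atom of mass `a > 0` at a two-sided accumulation point `u` of its support.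
Expanding these two relations to second order at `u` on either side gives, with
`Z = Φ̂(u)⁻¹` and `D = Φ'(u)`,
`⟨ξ'''(Φ(u)) ⊙ D ⊙ D, D⟩ - 2 x(u) ⟨Z D Z D Z, D⟩ ≥ 0` on the right and the opposite inequality with
`x(u-)` in place of `x(u)` on the left, because the derivative of `Φ̂⁻¹` is `x Φ̂⁻¹ Φ' Φ̂⁻¹`. Hence
`a ⟨Z D Z D Z, D⟩ ≤ 0`, whereas `Z` is positive definite and `D` is positive semidefinite with
trace `1`, so that this pairing is positive.
-/

namespace VectorSpin

open scoped Matrix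

section LinearAlgebra

variable {n : Type*} [Fintype n]

lemma posSemidef_iff_isHermitian_and_nonneg {A : Matrix n n ℝ} :
    A.PosSemidef ↔ A.IsHermitian ∧ ∀ v : n → ℝ, 0 ≤ v ⬝ᵥ A *ᵥ v := by
  simp [Matrix.posSemidef_iff_dotProduct_mulVec]

lemma exists_eq_transpose_mul_self {A : Matrix n n ℝ} (hA : A.PosSemidef) :
    ∃ C : Matrix n n ℝ, A = Cᵀ * C := by
  classical
  open scoped MatrixOrder in
  obtain ⟨C, hC⟩ := CStarAlgebra.nonneg_iff_eq_star_mul_self.mp hA.nonneg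
  exact ⟨C, by simpa [Matrix.star_eq_conjTranspose] using hC⟩

lemma transpose_eq_of_isHermitian {ι : Type*} {A : Matrix ι ι ℝ} (hA : A.IsHermitian) :
    Aᵀ = A := by
  rw [← Matrix.conjTranspose_eq_transpose_of_trivial]
  exact hA

lemma apply_comm_of_isHermitian {ι : Type*} {A : Matrix ι ι ℝ} (hA : A.IsHermitian) (i j : ι) :
    A j i = A i j := by
  simpa using hA.apply i j

lemma isHermitian_smul {ι : Type*} {A : Matrix ι ι ℝ} (c : ℝ) (hA : A.IsHermitian) :
    (c • A).IsHermitian := by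
  rw [Matrix.IsHermitian, Matrix.conjTranspose_smul, hA.eq, star_trivial]

lemma dotProduct_mulVec_comm {A : Matrix n n ℝ} (hA : A.IsHermitian) (v w : n → ℝ) :
    v ⬝ᵥ A *ᵥ w = w ⬝ᵥ A *ᵥ v := by
  rw [Matrix.dotProduct_mulVec, dotProduct_comm, ← Matrix.mulVec_transpose,
    transpose_eq_of_isHermitian hA]

lemma mulVec_eq_zero_of_dotProduct_mulVec_eq_zero {A : Matrix n n ℝ} (hA : A.PosSemidef)
    {v : n → ℝ} (h : v ⬝ᵥ A *ᵥ v = 0) : A *ᵥ v = 0 :=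
  (hA.dotProduct_mulVec_zero_iff v).mp (by simpa using h)

lemma smul_dotProduct_mulVec_smul (A : Matrix n n ℝ) (r : ℝ) (v : n → ℝ) :
    (r • v) ⬝ᵥ A *ᵥ (r • v) = r ^ 2 * (v ⬝ᵥ A *ᵥ v) := by
  simp only [Matrix.mulVec_smul, dotProduct_smul, smul_dotProduct, smul_eq_mul]
  ring

lemma add_dotProduct_mulVec_add_of_mulVec_eq_zero {A : Matrix n n ℝ} (hA : A.IsHermitian)
    {k : n → ℝ} (hk : A *ᵥ k = 0) (w : n → ℝ) :
    (k + w) ⬝ᵥ A *ᵥ (k + w) = w ⬝ᵥ A *ᵥ w := by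
  rw [Matrix.mulVec_add, hk, zero_add, add_dotProduct, dotProduct_mulVec_comm hA, hk,
    dotProduct_zero, zero_add]

lemma exists_eq_smul_mem_sphere {E : Type*} [NormedAddCommGroup E] [NormedSpace ℝ E]
    {W : Submodule ℝ E} {w : E} (hw : w ∈ W) (h0 : w ≠ 0) :
    ∃ r : ℝ, r ≠ 0 ∧ ∃ u ∈ Metric.sphere (0 : E) 1 ∩ W, w = r • u := by
  have hr : ‖w‖ ≠ 0 := norm_ne_zero_iff.mpr h0
  refine ⟨‖w‖, hr, ‖w‖⁻¹ • w, ⟨by simp [norm_smul, hr], W.smul_mem _ hw⟩, ?_⟩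
  rw [smul_inv_smul₀ hr]

lemma posDef_of_det_pos [DecidableEq n] {A : Matrix n n ℝ} (hA : A.PosSemidef) (h : 0 < A.det) :
    A.PosDef :=
  hA.posDef_iff_det_ne_zero.mpr h.ne'

lemma eventually_posDef {ι α : Type*} [Finite ι] {l : Filter α} {A : α → Matrix ι ι ℝ}
    {A₀ : Matrix ι ι ℝ} (hA : Tendsto A l (𝓝 A₀)) (hherm : ∀ᶠ x in l, (A x).IsHermitian)
    (h₀ : A₀.PosDef) : ∀ᶠ x in l, (A x).PosDef := by
  have := Fintype.ofFinite ι
  have hsphere : ∀ᶠ B in 𝓝 A₀, ∀ v ∈ Metric.sphere (0 : ι → ℝ) 1, 0 < v ⬝ᵥ B *ᵥ v := by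
    refine (isCompact_sphere _ _).eventually_forall_of_forall_eventually fun v hv => ?_
    have hv0 : v ≠ 0 := Metric.ne_of_mem_sphere hv one_ne_zero
    have hcont : Continuous fun p : Matrix ι ι ℝ × (ι → ℝ) => p.2 ⬝ᵥ p.1 *ᵥ p.2 := by fun_prop
    exact hcont.continuousAt.eventually_const_lt (by simpa using h₀.dotProduct_mulVec_pos hv0)
  filter_upwards [hherm, hA.eventually hsphere] with x hx hpos
  refine Matrix.PosDef.of_dotProduct_mulVec_pos hx fun v hv => ?_
  obtain ⟨r, hr, u, hu, rfl⟩ := exists_eq_smul_mem_sphere (Submodule.mem_top (x := v)) hv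
  rw [star_trivial, smul_dotProduct_mulVec_smul]
  exact mul_pos (by positivity) (hpos u hu.1)

/- On a complement of `ker A` the form of `A` is definite, so compactness of the unit sphere there
bounds the form of `B` by that of `A`. -/
lemma exists_abs_dotProduct_mulVec_le {A B : Matrix n n ℝ} (hA : A.PosSemidef)
    (hB : B.IsHermitian) (hker : ∀ v, A *ᵥ v = 0 → B *ᵥ v = 0) :
    ∃ c : ℝ, ∀ v : n → ℝ, |v ⬝ᵥ B *ᵥ v| ≤ c * (v ⬝ᵥ A *ᵥ v) := by
  obtain ⟨W, hW⟩ := Submodule.exists_isCompl (LinearMap.ker A.mulVecLin)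
  have hApos : ∀ w ∈ Metric.sphere (0 : n → ℝ) 1 ∩ W, 0 < w ⬝ᵥ A *ᵥ w := fun w hw =>
    lt_of_le_of_ne ((posSemidef_iff_isHermitian_and_nonneg.mp hA).2 w) fun h =>
      Metric.ne_of_mem_sphere hw.1 one_ne_zero <| Submodule.disjoint_def.mp hW.disjoint w
        (by simpa using mulVec_eq_zero_of_dotProduct_mulVec_eq_zero hA h.symm) hw.2
  have hquot : ContinuousOn (fun w : n → ℝ => (w ⬝ᵥ B *ᵥ w) / (w ⬝ᵥ A *ᵥ w))
      (Metric.sphere (0 : n → ℝ) 1 ∩ W) :=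
    ContinuousOn.div (by fun_prop) (by fun_prop) fun w hw => (hApos w hw).ne'
  obtain ⟨c, hc⟩ := ((isCompact_sphere _ _).inter_right
    W.closed_of_finiteDimensional).exists_bound_of_continuousOn hquot
  have hW_le : ∀ w ∈ W, |w ⬝ᵥ B *ᵥ w| ≤ c * (w ⬝ᵥ A *ᵥ w) := fun w hw => by
    obtain rfl | h0 := eq_or_ne w 0
    · simp
    obtain ⟨r, -, u, hu, rfl⟩ := exists_eq_smul_mem_sphere hw h0
    have hu_le := hc u hu
    rw [Real.norm_eq_abs, abs_div, abs_of_pos (hApos u hu), div_le_iff₀ (hApos u hu)] at hu_le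
    rw [smul_dotProduct_mulVec_smul, smul_dotProduct_mulVec_smul, abs_mul, abs_sq,
      mul_left_comm]
    gcongr
  refine ⟨c, fun v => ?_⟩
  obtain ⟨k, hk, w, hw, rfl⟩ :=
    Submodule.mem_sup.mp (hW.sup_eq_top ▸ Submodule.mem_top : v ∈ LinearMap.ker A.mulVecLin ⊔ W)
  have hAk : A *ᵥ k = 0 := by simpa using hk
  rw [add_dotProduct_mulVec_add_of_mulVec_eq_zero hA.1 hAk,
    add_dotProduct_mulVec_add_of_mulVec_eq_zero hB (hker k hAk)]
  exact hW_le w hw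

lemma exists_posSemidef_add_smul {A B : Matrix n n ℝ} (hA : A.PosSemidef) (hB : B.IsHermitian)
    (hker : ∀ v, A *ᵥ v = 0 → B *ᵥ v = 0) :
    ∃ δ > (0 : ℝ), ∀ ε : ℝ, 0 ≤ ε → ε ≤ δ → (A + ε • B).PosSemidef := by
  obtain ⟨c, hc⟩ := exists_abs_dotProduct_mulVec_le hA hB hker
  refine ⟨1 / (|c| + 1), by positivity, fun ε hε hεδ => posSemidef_iff_isHermitian_and_nonneg.mpr
    ⟨hA.1.add (isHermitian_smul ε hB), fun v => ?_⟩⟩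
  have hAv := (posSemidef_iff_isHermitian_and_nonneg.mp hA).2 v
  have hle : ε * |v ⬝ᵥ B *ᵥ v| ≤ v ⬝ᵥ A *ᵥ v := calc
    ε * |v ⬝ᵥ B *ᵥ v| ≤ 1 / (|c| + 1) * ((|c| + 1) * (v ⬝ᵥ A *ᵥ v)) := by
      gcongr
      exact (hc v).trans (mul_le_mul_of_nonneg_right (by linarith [le_abs_self c]) hAv)
    _ = v ⬝ᵥ A *ᵥ v := by field_simp
  rw [Matrix.add_mulVec, dotProduct_add, Matrix.smul_mulVec, dotProduct_smul, smul_eq_mul]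
  nlinarith [neg_abs_le (v ⬝ᵥ B *ᵥ v)]

lemma trace_mul_mul_transpose_pos {k : Type*} [Fintype k] {Z : Matrix n n ℝ} (hZ : Z.PosDef)
    {Y : Matrix k n ℝ} (hY : Y ≠ 0) : 0 < (Y * Z * Yᵀ).trace := by
  have hdiag : (Y * Z * Yᵀ).trace = ∑ i, Y i ⬝ᵥ Z *ᵥ Y i :=
    Finset.sum_congr rfl fun i _ => by
      rw [Matrix.dotProduct_mulVec, ← Matrix.mul_apply_eq_vecMul]
      rfl
  obtain ⟨i, hi⟩ := Function.ne_iff.mp hY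
  rw [hdiag]
  exact Finset.sum_pos' (fun j _ => (posSemidef_iff_isHermitian_and_nonneg.mp hZ.posSemidef).2 _)
    ⟨i, Finset.mem_univ i, by simpa using hZ.dotProduct_mulVec_pos hi⟩

lemma abs_apply_le_one {ι : Type*} [Finite ι] {A Q : Matrix ι ι ℝ} (hA : A.PosSemidef)
    (hQA : (Q - A).PosSemidef) (hQ : ∀ i, Q i i = 1) (i j : ι) : |A i j| ≤ 1 := by
  classical
  have := Fintype.ofFinite ι
  have hdiag : ∀ i, A i i ≤ 1 := fun i => by
    have := hQA.diag_nonneg (i := i)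
    rw [Matrix.sub_apply, hQ] at this
    linarith
  have hform : ∀ c : ℝ, 0 ≤ A i i + c * A i j + c * A j i + c * c * A j j := fun c => by
    have := (posSemidef_iff_isHermitian_and_nonneg.mp hA).2 (Pi.single i 1 + c • Pi.single j 1)
    simp only [Matrix.mulVec_add, Matrix.mulVec_smul, add_dotProduct, dotProduct_add,
      dotProduct_smul, smul_dotProduct, Matrix.mulVec_single_one, single_one_dotProduct,
      Matrix.col_apply, smul_eq_mul] at this
    linarith
  have hsymm := apply_comm_of_isHermitian hA.1 i j
  rw [abs_le]
  constructor <;> nlinarith [hdiag i, hdiag j, hform 1, hform (-1)]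

end LinearAlgebra

section Frobenius

variable {m : ℕ}

lemma frob_eq_trace (A B : Matrix (Fin m) (Fin m) ℝ) : frob A B = (Aᵀ * B).trace := by
  simp only [frob, Matrix.trace, Matrix.diag, Matrix.mul_apply, Matrix.transpose_apply]
  rw [Finset.sum_comm]

lemma frob_comm (A B : Matrix (Fin m) (Fin m) ℝ) : frob A B = frob B A := by
  simp only [frob, mul_comm]

lemma frob_add_left (A A' B : Matrix (Fin m) (Fin m) ℝ) :
    frob (A + A') B = frob A B + frob A' B := by
  simp [frob, add_mul, Finset.sum_add_distrib]

lemma frob_smul_left (c : ℝ) (A B : Matrix (Fin m) (Fin m) ℝ) :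
    frob (c • A) B = c * frob A B := by
  simp [frob, Finset.mul_sum, mul_assoc]

lemma frob_neg_left (A B : Matrix (Fin m) (Fin m) ℝ) : frob (-A) B = -frob A B := by
  simp [frob]

lemma frob_sub_left (A A' B : Matrix (Fin m) (Fin m) ℝ) :
    frob (A - A') B = frob A B - frob A' B := by
  simp [frob, sub_mul, Finset.sum_sub_distrib]

lemma frob_smul_right (c : ℝ) (A B : Matrix (Fin m) (Fin m) ℝ) :
    frob A (c • B) = c * frob A B := by
  simp only [frob_comm A, frob_smul_left]

lemma frob_neg_right (A B : Matrix (Fin m) (Fin m) ℝ) : frob A (-B) = -frob A B := by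
  simp only [frob_comm A, frob_neg_left]

lemma frob_sub_right (A B B' : Matrix (Fin m) (Fin m) ℝ) :
    frob A (B - B') = frob A B - frob A B' := by
  simp only [frob_comm A, frob_sub_left]

lemma frob_vecMulVec (A : Matrix (Fin m) (Fin m) ℝ) (v : Fin m → ℝ) :
    frob A (Matrix.vecMulVec v v) = v ⬝ᵥ A *ᵥ v := by
  simp only [frob, Matrix.vecMulVec_apply, dotProduct, Matrix.mulVec, Finset.mul_sum]
  exact Finset.sum_congr rfl fun i _ => Finset.sum_congr rfl fun j _ => by ring

lemma frob_nonneg {A B : Matrix (Fin m) (Fin m) ℝ} (hA : A.PosSemidef) (hB : B.PosSemidef) :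
    0 ≤ frob A B := by
  obtain ⟨C, rfl⟩ := exists_eq_transpose_mul_self hA
  have htrace := (hB.mul_mul_conjTranspose_same C).trace_nonneg
  rw [frob_eq_trace, Matrix.transpose_mul, Matrix.transpose_transpose, Matrix.mul_assoc,
    Matrix.trace_mul_comm]
  simpa using htrace

/- With `D = CᵀC` and `Y = CZD`, the left-hand side is `tr (Y Z Yᵀ)`; and `Y = 0` would give
`tr (D Z D) = 0`. -/
lemma frob_mul_mul_mul_mul_pos {Z D : Matrix (Fin m) (Fin m) ℝ} (hZ : Z.PosDef)
    (hD : D.PosSemidef) (hD0 : D ≠ 0) : 0 < frob (Z * D * Z * D * Z) D := by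
  have hZt : Zᵀ = Z := transpose_eq_of_isHermitian hZ.1
  have hDt : Dᵀ = D := transpose_eq_of_isHermitian hD.1
  obtain ⟨C, hC⟩ := exists_eq_transpose_mul_self hD
  have hY : C * Z * D ≠ 0 := fun h => by
    have hpos := trace_mul_mul_transpose_pos hZ hD0
    rw [hDt, Matrix.mul_assoc] at hpos
    nth_rewrite 1 [hC] at hpos
    rw [Matrix.mul_assoc, ← Matrix.mul_assoc C, h, Matrix.mul_zero, Matrix.trace_zero] at hpos
    exact hpos.false
  have hpos := trace_mul_mul_transpose_pos hZ hY
  have hfrob : frob (Z * D * Z * D * Z) D = (C * Z * D * Z * (C * Z * D)ᵀ).trace := calc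
    frob (Z * D * Z * D * Z) D = (Z * D * Z * D * Z * Cᵀ * C).trace := by
      rw [frob_eq_trace, Matrix.mul_assoc _ Cᵀ, ← hC]
      simp only [Matrix.transpose_mul, hZt, hDt, Matrix.mul_assoc]
    _ = (C * Z * D * Z * (C * Z * D)ᵀ).trace := by
      rw [Matrix.trace_mul_comm]
      simp only [Matrix.transpose_mul, hZt, hDt, Matrix.mul_assoc]
  rwa [hfrob]

end Frobenius

section MatrixCalculus

variable {n : Type*} [Fintype n]

lemma tendsto_matrix_iff {ι κ α : Type*} {l : Filter α} {A : α → Matrix ι κ ℝ}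
    {A₀ : Matrix ι κ ℝ} :
    Tendsto A l (𝓝 A₀) ↔ ∀ i j, Tendsto (fun x => A x i j) l (𝓝 (A₀ i j)) :=
  tendsto_pi_nhds.trans (forall_congr' fun _ => tendsto_pi_nhds)

lemma hasDerivWithinAt_apply_iff {ι κ : Type*} {A : ℝ → Matrix ι κ ℝ} {A' : Matrix ι κ ℝ}
    {S : Set ℝ} {t : ℝ} :
    (∀ i j, HasDerivWithinAt (fun s => A s i j) (A' i j) S t) ↔
      Tendsto (fun s => (s - t)⁻¹ • (A s - A t)) (𝓝[S \ {t}] t) (𝓝 A') := by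
  simp only [hasDerivWithinAt_iff_tendsto_slope, tendsto_matrix_iff]
  rfl

lemma hasDerivWithinAt_dotProduct_mulVec {A : ℝ → Matrix n n ℝ} {A' : Matrix n n ℝ} {S : Set ℝ}
    {t : ℝ} (h : ∀ i j, HasDerivWithinAt (fun s => A s i j) (A' i j) S t) (v : n → ℝ) :
    HasDerivWithinAt (fun s => v ⬝ᵥ A s *ᵥ v) (v ⬝ᵥ A' *ᵥ v) S t :=
  HasDerivWithinAt.fun_sum fun i _ => HasDerivWithinAt.const_mul _ <|
    HasDerivWithinAt.fun_sum fun j _ => (h i j).mul_const _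

variable [DecidableEq n]

lemma continuousAt_matrix_inv {A : Matrix n n ℝ} (h : A.det ≠ 0) :
    ContinuousAt (fun B : Matrix n n ℝ => B⁻¹) A := by
  simp only [Matrix.inv_def, Ring.inverse_eq_inv']
  exact (continuous_id.matrix_det.continuousAt.inv₀ h).smul
    continuous_id.matrix_adjugate.continuousAt

lemma inv_sub_inv_eq_neg {A B : Matrix n n ℝ} (hA : A.det ≠ 0) (hB : B.det ≠ 0) :
    B⁻¹ - A⁻¹ = -(B⁻¹ * (B - A) * A⁻¹) := by
  rw [Matrix.mul_sub, Matrix.nonsing_inv_mul _ hB.isUnit, Matrix.sub_mul, Matrix.one_mul,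
    Matrix.mul_assoc, Matrix.mul_nonsing_inv _ hA.isUnit, Matrix.mul_one, neg_sub]

lemma hasDerivWithinAt_matrix_inv_apply {A : ℝ → Matrix n n ℝ} {A' : Matrix n n ℝ} {S : Set ℝ}
    {t : ℝ} (hdet : (A t).det ≠ 0)
    (h : ∀ i j, HasDerivWithinAt (fun s => A s i j) (A' i j) S t) (i j : n) :
    HasDerivWithinAt (fun s => (A s)⁻¹ i j) ((-((A t)⁻¹ * A' * (A t)⁻¹)) i j) S t := by
  have hA : Tendsto A (𝓝[S \ {t}] t) (𝓝 (A t)) := tendsto_matrix_iff.mpr fun i j =>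
    (h i j).continuousWithinAt.tendsto.mono_left (nhdsWithin_mono _ sdiff_subset)
  have hdet_near : ∀ᶠ s in 𝓝[S \ {t}] t, (A s).det ≠ 0 :=
    ((continuous_id.matrix_det.tendsto (A t)).comp hA).eventually_ne hdet
  refine (hasDerivWithinAt_apply_iff (A := fun s => (A s)⁻¹)).mpr ?_ i j
  refine ((((continuousAt_matrix_inv hdet).tendsto.comp hA).mul
    (hasDerivWithinAt_apply_iff.mp h)).mul_const (A t)⁻¹).neg.congr' ?_
  filter_upwards [hdet_near] with s hs
  simp [inv_sub_inv_eq_neg hdet hs]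

lemma hasDerivAt_log_det_add_smul {A E : Matrix n n ℝ} (hA : 0 < A.det) :
    HasDerivAt (fun ε : ℝ => Real.log (A + ε • E).det) (A⁻¹ * E).trace 0 := by
  have hdet : ∀ ε : ℝ, (A + ε • E).det = A.det * (1 + ε • (A⁻¹ * E)).det := fun ε => by
    rw [← Matrix.det_mul, Matrix.mul_add, Matrix.mul_one, Matrix.mul_smul, ← Matrix.mul_assoc,
      Matrix.mul_nonsing_inv _ hA.ne'.isUnit, Matrix.one_mul]
  obtain ⟨p, hp⟩ : ∃ p : Polynomial ℝ, ∀ ε : ℝ,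
      (1 + ε • (A⁻¹ * E)).det = 1 + (A⁻¹ * E).trace * ε + p.eval ε * ε ^ 2 :=
    ⟨_, fun ε => Matrix.det_one_add_smul ε _⟩
  have hexpansion : HasDerivAt
      (fun ε : ℝ => A.det * (1 + (A⁻¹ * E).trace * ε + p.eval ε * ε ^ 2))
      (A.det * (A⁻¹ * E).trace) 0 := by
    simpa using ((((hasDerivAt_id (0 : ℝ)).const_mul (A⁻¹ * E).trace).const_add 1).add
      ((p.hasDerivAt 0).mul ((hasDerivAt_id (0 : ℝ)).pow 2))).const_mul A.det
  simp only [hdet, hp]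
  simpa [hA.ne'] using hexpansion.log (by simpa using hA.ne')

end MatrixCalculus

section Mixture

variable {m : ℕ} {β : ℕ → Fin m → ℝ}

/-- The power series in the `(i, j)` entry of `ξ'`, as a function of that entry. -/
noncomputable def xiEntry (β : ℕ → Fin m → ℝ) (i j : Fin m) (a : ℝ) : ℝ :=
  ∑' p : ℕ, ((p : ℝ) + 2) * (β (p + 2) i * β (p + 2) j) * a ^ (p + 1)

/-- The antiderivative of `xiEntry` vanishing at `0`. -/
noncomputable def xiInt (β : ℕ → Fin m → ℝ) (i j : Fin m) (a : ℝ) : ℝ :=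
  ∫ s in (0 : ℝ)..a, xiEntry β i j s

/-- The potential whose gradient is `ξ'(A) + h hᵀ`. -/
noncomputable def potential (β : ℕ → Fin m → ℝ) (h : Fin m → ℝ)
    (A : Matrix (Fin m) (Fin m) ℝ) : ℝ :=
  ∑ i, ∑ j, (xiInt β i j (A i j) + h i * h j * A i j)

lemma xiDeriv_apply (β : ℕ → Fin m → ℝ) (A : Matrix (Fin m) (Fin m) ℝ) (i j : Fin m) :
    xiDeriv β A i j = xiEntry β i j (A i j) := rfl

lemma xiEntry_comm (β : ℕ → Fin m → ℝ) (i j : Fin m) (a : ℝ) :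
    xiEntry β i j a = xiEntry β j i a := by
  simp only [xiEntry, mul_comm (β _ i)]

/-- The power series whose product with the variable is `xiEntry β i j`. -/
noncomputable def xiSeries (β : ℕ → Fin m → ℝ) (i j : Fin m) : FormalMultilinearSeries ℝ ℝ ℝ :=
  FormalMultilinearSeries.ofScalars ℝ fun p => ((p : ℝ) + 2) * (β (p + 2) i * β (p + 2) j)

lemma xiEntry_eq_mul_sum (β : ℕ → Fin m → ℝ) (i j : Fin m) :
    xiEntry β i j = fun a => a * (xiSeries β i j).sum a := by
  funext a
  have hsum : (xiSeries β i j).sum a =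
      ∑' p : ℕ, (((p : ℝ) + 2) * (β (p + 2) i * β (p + 2) j)) • a ^ p :=
    FormalMultilinearSeries.ofScalars_sum_eq _ a
  rw [hsum, ← tsum_mul_left, xiEntry]
  exact tsum_congr fun p => by rw [smul_eq_mul]; ring

lemma exists_two_pow_mul_abs_mul_le (hβ : ∀ j, Summable fun p : ℕ => (2 : ℝ) ^ p * β p j ^ 2)
    (i j : Fin m) : ∃ C : ℝ, ∀ p, 2 ^ p * |β p i * β p j| ≤ C := by
  refine ⟨∑' p, 2 ^ p * β p i ^ 2 + ∑' p, 2 ^ p * β p j ^ 2, fun p => ?_⟩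
  have hle : ∀ k, 2 ^ p * β p k ^ 2 ≤ ∑' p, 2 ^ p * β p k ^ 2 := fun k =>
    (hβ k).le_tsum p fun q _ => by positivity
  have hamgm : |β p i * β p j| ≤ β p i ^ 2 + β p j ^ 2 := by
    rw [abs_le]
    constructor <;> nlinarith [sq_nonneg (β p i + β p j), sq_nonneg (β p i - β p j)]
  calc 2 ^ p * |β p i * β p j| ≤ 2 ^ p * β p i ^ 2 + 2 ^ p * β p j ^ 2 := by
        rw [← mul_add]
        gcongr
    _ ≤ _ := add_le_add (hle i) (hle j)

/- The coefficients are `O(p 2 ^ (-p))`, so every radius below `2` works; `3 / 2` leaves room around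
the interval `[-1, 1]` containing the entries of a path. -/
lemma le_radius_xiSeries (hβ : ∀ j, Summable fun p : ℕ => (2 : ℝ) ^ p * β p j ^ 2)
    (i j : Fin m) : ((3 / 2 : NNReal) : ENNReal) ≤ (xiSeries β i j).radius := by
  obtain ⟨C, hC⟩ := exists_two_pow_mul_abs_mul_le hβ i j
  refine (xiSeries β i j).le_radius_of_bound C fun p => ?_
  have hbernoulli : (p : ℝ) + 2 ≤ 4 * (4 / 3) ^ p := by
    linarith [one_add_mul_le_pow (a := (1 / 3 : ℝ)) (by norm_num) p,
      show (1 + 1 / 3 : ℝ) ^ p = (4 / 3) ^ p by norm_num]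
  rw [xiSeries, FormalMultilinearSeries.ofScalars_norm, Real.norm_eq_abs, abs_mul,
    abs_of_nonneg (by positivity)]
  push_cast
  calc ((p : ℝ) + 2) * |β (p + 2) i * β (p + 2) j| * (3 / 2) ^ p
      ≤ 4 * (4 / 3) ^ p * |β (p + 2) i * β (p + 2) j| * (3 / 2) ^ p := by gcongr
    _ = 2 ^ (p + 2) * |β (p + 2) i * β (p + 2) j| := by
        rw [show (2 : ℝ) ^ (p + 2) = 4 * ((4 / 3) ^ p * (3 / 2) ^ p) by
          rw [← mul_pow, pow_add]; norm_num; ring]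
        ring
    _ ≤ C := hC (p + 2)

lemma analyticOnNhd_xiEntry (hβ : ∀ j, Summable fun p : ℕ => (2 : ℝ) ^ p * β p j ^ 2)
    (i j : Fin m) : AnalyticOnNhd ℝ (xiEntry β i j) (Ioo (-3 / 2) (3 / 2)) := by
  have hradius := le_radius_xiSeries hβ i j
  rw [xiEntry_eq_mul_sum]
  refine analyticOnNhd_id.mul fun a ha => ((xiSeries β i j).hasFPowerSeriesOnBall
    (lt_of_lt_of_le (by norm_num) hradius)).analyticAt_of_mem ?_
  refine Metric.eball_subset_eball hradius ?_
  rw [Metric.eball_coe, mem_ball_zero_iff, Real.norm_eq_abs, abs_lt]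
  push_cast
  constructor <;> linarith [ha.1, ha.2]

lemma hasDerivAt_xiInt (hβ : ∀ j, Summable fun p : ℕ => (2 : ℝ) ^ p * β p j ^ 2) (i j : Fin m)
    {a : ℝ} (ha : a ∈ Ioo (-3 / 2 : ℝ) (3 / 2)) :
    HasDerivAt (xiInt β i j) (xiEntry β i j a) a := by
  have hcont := (analyticOnNhd_xiEntry hβ i j).continuousOn
  have hsub : uIcc 0 a ⊆ Ioo (-3 / 2 : ℝ) (3 / 2) :=
    ordConnected_Ioo.uIcc_subset (by norm_num) ha
  exact intervalIntegral.integral_hasDerivAt_right (hcont.mono hsub).intervalIntegrable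
    (hcont.stronglyMeasurableAtFilter isOpen_Ioo a ha)
    (hcont.continuousAt (isOpen_Ioo.mem_nhds ha))

end Mixture

section LayerCake

variable {μ : Measure ℝ} {f g : ℝ → ℝ} {a b : ℝ}

lemma integrable_of_continuousOn_Icc [IsFiniteMeasure μ] (hf : ContinuousOn f (Icc a b))
    (ha : ∀ᵐ r ∂μ, a ≤ r) (hb : ∀ᵐ r ∂μ, r ≤ b) : Integrable f μ := by
  have hμ : μ.restrict (Icc a b) = μ :=
    Measure.restrict_eq_self_of_ae_mem (by filter_upwards [ha, hb] with r h h' using ⟨h, h'⟩)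
  rw [← hμ]
  exact hf.integrableOn_compact isCompact_Icc

lemma intervalIntegral_indicator_Ici {r : ℝ} (hab : a ≤ b) (hr : r ≤ b) :
    ∫ t in a..b, (Ici r).indicator g t = ∫ t in (max a r)..b, g t := by
  rw [intervalIntegral.integral_of_le hab, intervalIntegral.integral_of_le (max_le hab hr),
    setIntegral_indicator measurableSet_Ici, ← Ioc_inter_Ioi]
  exact setIntegral_congr_set ((ae_eq_refl _).inter Ioi_ae_eq_Ici.symm)

lemma setIntegral_Iic_mul_eq_integral_indicator (t : ℝ) :
    (∫ r in Iic t, f r ∂μ) * g t = ∫ r, (Ici r).indicator g t * f r ∂μ := by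
  rw [← integral_indicator measurableSet_Iic, ← integral_mul_const]
  refine integral_congr_ae (Eventually.of_forall fun r => ?_)
  by_cases hr : r ≤ t <;> simp [indicator, hr, mul_comm]

lemma integrable_uncurry_indicator_Ici_mul [SFinite μ] (hf : Integrable f μ)
    (hg : IntervalIntegrable g volume a b) :
    Integrable (Function.uncurry fun r t => (Ici r).indicator g t * f r)
      (μ.prod (volume.restrict (Ioc a b))) := by
  refine ((hf.mul_prod hg.1).indicator
    (measurableSet_le measurable_fst measurable_snd)).congr (Eventually.of_forall fun p => ?_)
  by_cases hp : p.1 ≤ p.2 <;> simp [Function.uncurry, indicator, hp, mul_comm]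

lemma intervalIntegrable_setIntegral_Iic_mul [SFinite μ] (hab : a ≤ b) (hf : Integrable f μ)
    (hg : IntervalIntegrable g volume a b) :
    IntervalIntegrable (fun t => (∫ r in Iic t, f r ∂μ) * g t) volume a b := by
  simp only [setIntegral_Iic_mul_eq_integral_indicator]
  rw [intervalIntegrable_iff_integrableOn_Ioc_of_le hab]
  exact (integrable_uncurry_indicator_Ici_mul hf hg).integral_prod_right

lemma setIntegral_indicator_Ici_mul {r c : ℝ} (hab : a ≤ b) (hr : r ≤ b) :
    ∫ t in Ioc a b, (Ici r).indicator g t * c = c * ∫ t in (max a r)..b, g t := by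
  rw [integral_mul_const, ← intervalIntegral.integral_of_le hab,
    intervalIntegral_indicator_Ici hab hr, mul_comm]

lemma integrable_mul_intervalIntegral [SFinite μ] (hab : a ≤ b) (ha : ∀ᵐ r ∂μ, a ≤ r)
    (hb : ∀ᵐ r ∂μ, r ≤ b) (hf : Integrable f μ) (hg : IntervalIntegrable g volume a b) :
    Integrable (fun r => f r * ∫ t in r..b, g t) μ := by
  refine (integrable_uncurry_indicator_Ici_mul hf hg).integral_prod_left.congr ?_
  filter_upwards [ha, hb] with r hr hr'
  simp only [Function.uncurry_apply_pair, setIntegral_indicator_Ici_mul hab hr', max_eq_right hr]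

lemma integral_setIntegral_Iic_mul [SFinite μ] (hab : a ≤ b) (hb : ∀ᵐ r ∂μ, r ≤ b)
    (hf : Integrable f μ) (hg : IntervalIntegrable g volume a b) :
    ∫ t in a..b, (∫ r in Iic t, f r ∂μ) * g t = ∫ r, f r * (∫ t in (max a r)..b, g t) ∂μ := by
  simp only [setIntegral_Iic_mul_eq_integral_indicator]
  rw [intervalIntegral.integral_of_le hab]
  refine (integral_integral_swap (integrable_uncurry_indicator_Ici_mul hf hg)).symm.trans ?_
  exact integral_congr_ae (hb.mono fun r hr => setIntegral_indicator_Ici_mul hab hr)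

lemma setIntegral_Ioi_eq_sub (hf : Integrable f μ) (t : ℝ) :
    ∫ r in Ioi t, f r ∂μ = ∫ r, f r ∂μ - ∫ r in Iic t, f r ∂μ := by
  rw [← compl_Iic, ← integral_add_compl (measurableSet_Iic (a := t)) hf, add_sub_cancel_left]

lemma intervalIntegrable_setIntegral_Ioi_mul [SFinite μ] (hab : a ≤ b) (hf : Integrable f μ)
    (hg : IntervalIntegrable g volume a b) :
    IntervalIntegrable (fun t => (∫ r in Ioi t, f r ∂μ) * g t) volume a b := by
  simp only [setIntegral_Ioi_eq_sub hf, sub_mul]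
  exact (hg.const_mul _).sub (intervalIntegrable_setIntegral_Iic_mul hab hf hg)

lemma integral_setIntegral_Ioi_mul [SFinite μ] (hab : a ≤ b) (ha : ∀ᵐ r ∂μ, a ≤ r)
    (hb : ∀ᵐ r ∂μ, r ≤ b) (hf : Integrable f μ) (hg : IntervalIntegrable g volume a b) :
    ∫ t in a..b, (∫ r in Ioi t, f r ∂μ) * g t = ∫ r, f r * (∫ t in a..r, g t) ∂μ := by
  have hIic : ∫ t in a..b, (∫ r in Iic t, f r ∂μ) * g t = ∫ r, f r * (∫ t in r..b, g t) ∂μ := by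
    rw [integral_setIntegral_Iic_mul hab hb hf hg]
    refine integral_congr_ae (ha.mono fun r hr => ?_)
    simp only [max_eq_right hr]
  simp only [setIntegral_Ioi_eq_sub hf, sub_mul]
  rw [intervalIntegral.integral_sub (hg.const_mul _)
      (intervalIntegrable_setIntegral_Iic_mul hab hf hg), hIic,
    intervalIntegral.integral_const_mul, ← integral_mul_const,
    ← integral_sub (hf.mul_const (∫ t in a..b, g t))
      (integrable_mul_intervalIntegral hab ha hb hf hg)]
  refine integral_congr_ae ((ha.and hb).mono fun r hr => ?_)
  have hr' : r ∈ uIcc a b := Icc_subset_uIcc hr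
  simp only [← intervalIntegral.integral_add_adjacent_intervals
    (hg.mono_set (uIcc_subset_uIcc_left hr')) (hg.mono_set (uIcc_subset_uIcc_right hr'))]
  ring

lemma tendsto_setIntegral_Ioi_right (hf : Integrable f μ) (t : ℝ) :
    Tendsto (fun t => ∫ r in Ioi t, f r ∂μ) (𝓝[>] t) (𝓝 (∫ r in Ioi t, f r ∂μ)) := by
  simp only [← integral_indicator measurableSet_Ioi]
  refine tendsto_integral_filter_of_dominated_convergence (fun r => ‖f r‖)
    (Eventually.of_forall fun t' => (hf.indicator measurableSet_Ioi).aestronglyMeasurable)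
    (Eventually.of_forall fun t' => Eventually.of_forall fun r => norm_indicator_le_norm_self _ _)
    hf.norm (Eventually.of_forall fun r => tendsto_const_nhds.congr' ?_)
  rcases lt_or_ge t r with hr | hr
  · filter_upwards [Ioo_mem_nhdsGT hr] with t' ht'
    rw [indicator_of_mem (mem_Ioi.mpr hr), indicator_of_mem (mem_Ioi.mpr ht'.2)]
  · filter_upwards [self_mem_nhdsWithin] with t' ht'
    rw [indicator_of_notMem (notMem_Ioi.mpr hr),
      indicator_of_notMem (notMem_Ioi.mpr (hr.trans (le_of_lt ht')))]

lemma tendsto_setIntegral_Ioi_left (hf : Integrable f μ) (t : ℝ) :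
    Tendsto (fun t => ∫ r in Ioi t, f r ∂μ) (𝓝[<] t) (𝓝 (∫ r in Ici t, f r ∂μ)) := by
  simp only [← integral_indicator measurableSet_Ioi, ← integral_indicator measurableSet_Ici]
  refine tendsto_integral_filter_of_dominated_convergence (fun r => ‖f r‖)
    (Eventually.of_forall fun t' => (hf.indicator measurableSet_Ioi).aestronglyMeasurable)
    (Eventually.of_forall fun t' => Eventually.of_forall fun r => norm_indicator_le_norm_self _ _)
    hf.norm (Eventually.of_forall fun r => tendsto_const_nhds.congr' ?_)
  rcases le_or_gt t r with hr | hr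
  · filter_upwards [self_mem_nhdsWithin] with t' ht'
    rw [indicator_of_mem (mem_Ici.mpr hr), indicator_of_mem (mem_Ioi.mpr (lt_of_lt_of_le ht' hr))]
  · filter_upwards [Ioo_mem_nhdsLT hr] with t' ht'
    rw [indicator_of_notMem (notMem_Ici.mpr hr), indicator_of_notMem (notMem_Ioi.mpr ht'.1.le)]

end LayerCake

section DistFun

variable {μ : Measure ℝ} {a b : ℝ}

lemma monotone_distFun [IsFiniteMeasure μ] : Monotone (distFun μ) := fun _ _ hab =>
  measureReal_mono (Icc_subset_Icc_right hab)

lemma distFun_eq_measureReal_Iic (h0 : ∀ᵐ r ∂μ, 0 ≤ r) (t : ℝ) :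
    distFun μ t = μ.real (Iic t) := by
  refine measureReal_congr ?_
  filter_upwards [h0] with r hr
  exact propext ⟨fun h => h.2, fun h => ⟨hr, h⟩⟩

lemma distFun_eq_cdf [IsProbabilityMeasure μ] (h0 : ∀ᵐ r ∂μ, 0 ≤ r) :
    distFun μ = ProbabilityTheory.cdf μ := funext fun t => by
  rw [distFun_eq_measureReal_Iic h0, ProbabilityTheory.cdf_eq_real]

lemma continuousWithinAt_distFun [IsProbabilityMeasure μ] (h0 : ∀ᵐ r ∂μ, 0 ≤ r) (t : ℝ) :
    ContinuousWithinAt (distFun μ) (Ici t) t := by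
  rw [distFun_eq_cdf h0]
  exact (ProbabilityTheory.cdf μ).right_continuous t

lemma intervalIntegrable_distFun_mul [IsFiniteMeasure μ] {g : ℝ → ℝ}
    (hg : ContinuousOn g (uIcc a b)) :
    IntervalIntegrable (fun t => distFun μ t * g t) volume a b :=
  monotone_distFun.intervalIntegrable.mul_continuousOn hg

lemma continuous_integral_distFun_mul [IsFiniteMeasure μ] {g : ℝ → ℝ} (hg : Continuous g)
    (b : ℝ) : Continuous fun t => ∫ u in t..b, distFun μ u * g u := by
  simp only [intervalIntegral.integral_symm b]
  exact (intervalIntegral.continuous_primitive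
    (fun _ _ => intervalIntegrable_distFun_mul hg.continuousOn) b).neg

lemma integral_distFun_mul_deriv [IsProbabilityMeasure μ] {f f' : ℝ → ℝ} (ha : 0 ≤ a)
    (hab : a ≤ b) (h0 : ∀ᵐ r ∂μ, 0 ≤ r) (hb : ∀ᵐ r ∂μ, r ≤ b)
    (hf : ∀ t ∈ Icc 0 b, HasDerivWithinAt f (f' t) (Icc 0 b) t)
    (hf' : ContinuousOn f' (Icc 0 b)) :
    ∫ t in a..b, distFun μ t * f' t = f b - ∫ r, f (max r a) ∂μ := by
  have hsub : ∀ r, Icc (max a r) b ⊆ Icc 0 b := fun r =>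
    Icc_subset_Icc_left (ha.trans (le_max_left _ _))
  have hprimitive : ∀ r ≤ b, ∫ t in (max a r)..b, f' t = f b - f (max r a) := fun r hr => by
    have hle : max a r ≤ b := max_le hab hr
    rw [max_comm r a]
    exact intervalIntegral.integral_eq_sub_of_hasDerivAt_of_le hle
      (fun t ht => ((hf t (hsub r ht)).mono (hsub r)).continuousWithinAt)
      (fun t ht => (hf t (hsub r (Ioo_subset_Icc_self ht))).hasDerivAt
        (Icc_mem_nhds ((ha.trans (le_max_left _ _)).trans_lt ht.1) ht.2))
      ((hf'.mono (hsub r)).intervalIntegrable_of_Icc hle)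
  have hone : ∀ t, distFun μ t = ∫ _ in Iic t, (1 : ℝ) ∂μ := fun t => by
    simp [distFun_eq_measureReal_Iic h0]
  have hfmax : Integrable (fun r => f (max r a)) μ := by
    refine integrable_of_continuousOn_Icc (b := b) (ContinuousOn.comp (t := Icc 0 b)
      (fun t ht => (hf t ht).continuousWithinAt) (by fun_prop) fun r hr => ?_) h0 hb
    exact ⟨hr.1.trans (le_max_left _ _), max_le hr.2 hab⟩
  have hint : IntervalIntegrable f' volume a b :=
    (hf'.mono (Icc_subset_Icc_left ha)).intervalIntegrable_of_Icc hab
  simp only [hone, integral_setIntegral_Iic_mul hab hb (integrable_const 1) hint, one_mul]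
  refine (integral_congr_ae (hb.mono hprimitive)).trans ?_
  rw [integral_sub (integrable_const _) hfmax]
  simp

lemma integral_zero_distFun_mul_deriv [IsProbabilityMeasure μ] {f f' : ℝ → ℝ} (hb0 : 0 ≤ b)
    (h0 : ∀ᵐ r ∂μ, 0 ≤ r) (hb : ∀ᵐ r ∂μ, r ≤ b)
    (hf : ∀ t ∈ Icc 0 b, HasDerivWithinAt f (f' t) (Icc 0 b) t)
    (hf' : ContinuousOn f' (Icc 0 b)) :
    ∫ t in (0 : ℝ)..b, distFun μ t * f' t = f b - ∫ r, f r ∂μ := by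
  rw [integral_distFun_mul_deriv le_rfl hb0 h0 hb hf hf']
  congr 1
  refine integral_congr_ae (h0.mono fun r hr => ?_)
  simp only [max_eq_left hr]

end DistFun

section MatrixPaths

variable {m : ℕ}

lemma hasDerivWithinAt_frob {A B : ℝ → Matrix (Fin m) (Fin m) ℝ}
    {A' B' : Matrix (Fin m) (Fin m) ℝ} {S : Set ℝ} {t : ℝ}
    (hA : ∀ i j, HasDerivWithinAt (fun s => A s i j) (A' i j) S t)
    (hB : ∀ i j, HasDerivWithinAt (fun s => B s i j) (B' i j) S t) :
    HasDerivWithinAt (fun s => frob (A s) (B s)) (frob A' (B t) + frob (A t) B') S t := by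
  simp only [frob, ← Finset.sum_add_distrib]
  exact HasDerivWithinAt.fun_sum fun i _ => HasDerivWithinAt.fun_sum fun j _ =>
    (hA i j).mul (hB i j)

lemma tendsto_frob {X : Type*} {A B : X → Matrix (Fin m) (Fin m) ℝ} {l : Filter X}
    {M N : Matrix (Fin m) (Fin m) ℝ} (hA : Tendsto A l (𝓝 M)) (hB : Tendsto B l (𝓝 N)) :
    Tendsto (fun x => frob (A x) (B x)) l (𝓝 (frob M N)) :=
  tendsto_finsetSum _ fun i _ => tendsto_finsetSum _ fun j _ =>
    (tendsto_matrix_iff.mp hA i j).mul (tendsto_matrix_iff.mp hB i j)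

lemma hasDerivWithinAt_potential {β : ℕ → Fin m → ℝ}
    (hβ : ∀ j, Summable fun p : ℕ => (2 : ℝ) ^ p * β p j ^ 2) (h : Fin m → ℝ)
    {A : ℝ → Matrix (Fin m) (Fin m) ℝ} {A' : Matrix (Fin m) (Fin m) ℝ} {S : Set ℝ} {t : ℝ}
    (hA : ∀ i j, HasDerivWithinAt (fun s => A s i j) (A' i j) S t)
    (hmem : ∀ i j, A t i j ∈ Ioo (-3 / 2 : ℝ) (3 / 2)) :
    HasDerivWithinAt (fun s => potential β h (A s))
      (frob (xiDeriv β (A t) + Matrix.vecMulVec h h) A') S t := by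
  refine HasDerivWithinAt.fun_sum fun i _ => HasDerivWithinAt.fun_sum fun j _ => ?_
  refine (((hasDerivAt_xiInt hβ i j (hmem i j)).comp_hasDerivWithinAt t (hA i j)).add
    ((hA i j).const_mul (h i * h j))).congr_deriv ?_
  simp only [Matrix.add_apply, xiDeriv_apply, Matrix.vecMulVec_apply]
  ring

lemma continuousAt_xiDeriv {β : ℕ → Fin m → ℝ}
    (hβ : ∀ j, Summable fun p : ℕ => (2 : ℝ) ^ p * β p j ^ 2) {A : Matrix (Fin m) (Fin m) ℝ}
    (hA : ∀ i j, A i j ∈ Ioo (-3 / 2 : ℝ) (3 / 2)) : ContinuousAt (xiDeriv β) A :=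
  tendsto_matrix_iff.mpr fun i j =>
    (analyticOnNhd_xiEntry hβ i j (A i j) (hA i j)).continuousAt.tendsto.comp
      ((continuous_id.matrix_elem i j).tendsto A)

end MatrixPaths

section RegularPath

variable {m : ℕ} {Q : Matrix (Fin m) (Fin m) ℝ} {μ : Measure ℝ}
  {Φ : ℝ → Matrix (Fin m) (Fin m) ℝ}

lemma IsRegularPath.hasDerivWithinAt (hp : IsRegularPath Q μ Φ) {t : ℝ} (ht : t ∈ Icc (0 : ℝ) m)
    (i j : Fin m) :
    HasDerivWithinAt (fun s => Φ s i j) (pathDeriv Φ t i j) (Icc (0 : ℝ) m) t :=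
  (hp.differentiable i j t ht).hasDerivWithinAt

lemma IsRegularPath.continuousOn (hp : IsRegularPath Q μ Φ) : ContinuousOn Φ (Icc (0 : ℝ) m) :=
  continuousOn_pi.mpr fun i => continuousOn_pi.mpr fun j => (hp.differentiable i j).continuousOn

lemma IsRegularPath.continuousOn_pathDeriv (hp : IsRegularPath Q μ Φ) :
    ContinuousOn (pathDeriv Φ) (Icc (0 : ℝ) m) := by
  obtain ⟨K, hK⟩ := hp.lipschitz_deriv
  exact continuousOn_pi.mpr fun i => continuousOn_pi.mpr fun j => (hK i j).continuousOn

lemma IsRegularPath.abs_apply_le (hp : IsRegularPath Q μ Φ) (hQ : IsConstraint Q) {t : ℝ}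
    (ht : t ∈ Icc (0 : ℝ) m) (i j : Fin m) : |Φ t i j| ≤ 1 := by
  refine abs_apply_le_one (hp.posSemidef t ht) (Q := Q) ?_ hQ.diag i j
  rw [← hp.finish]
  exact hp.monotone t ht m ⟨Nat.cast_nonneg m, le_rfl⟩ ht.2

lemma mem_Ioo_of_abs_le_one {a : ℝ} (ha : |a| ≤ 1) : a ∈ Ioo (-3 / 2 : ℝ) (3 / 2) := by
  obtain ⟨hl, hr⟩ := abs_le.mp ha
  exact ⟨by linarith, by linarith⟩

lemma IsRegularPath.posSemidef_pathDeriv (hm : 1 ≤ m) (hp : IsRegularPath Q μ Φ) {t : ℝ}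
    (ht : t ∈ Icc (0 : ℝ) m) : (pathDeriv Φ t).PosSemidef := by
  have hm_pos : (0 : ℝ) < m := by exact_mod_cast hm
  refine posSemidef_iff_isHermitian_and_nonneg.mpr
    ⟨Matrix.IsHermitian.ext fun i j => ?_, fun v => ?_⟩
  · rw [star_trivial]
    exact derivWithin_congr (fun s hs => apply_comm_of_isHermitian (hp.posSemidef s hs).1 i j)
      (apply_comm_of_isHermitian (hp.posSemidef t ht).1 i j)
  · rw [← (hasDerivWithinAt_dotProduct_mulVec (hp.hasDerivWithinAt ht) v).derivWithin
      (uniqueDiffOn_Icc hm_pos t ht)]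
    refine MonotoneOn.derivWithin_nonneg fun a ha b hb hab => ?_
    have hincr := (posSemidef_iff_isHermitian_and_nonneg.mp (hp.monotone a ha b hb hab)).2 v
    rw [Matrix.sub_mulVec, dotProduct_sub] at hincr
    exact sub_nonneg.mp hincr

/-- The matrix `Q - ∫ Φ(r ∨ t) dμ(r)`. An integration by parts identifies it with `Φ̂(t)` on
`[0, m]`, and it makes sense without any differentiability of `Φ`. -/
noncomputable def hatMean (Q : Matrix (Fin m) (Fin m) ℝ) (μ : Measure ℝ)
    (Φ : ℝ → Matrix (Fin m) (Fin m) ℝ) (t : ℝ) : Matrix (Fin m) (Fin m) ℝ :=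
  Matrix.of fun i j => Q i j - ∫ r, Φ (max r t) i j ∂μ

lemma ae_mem_of_concentrated {b : ℝ} (h : μ (Icc (0 : ℝ) b)ᶜ = 0) :
    (∀ᵐ r ∂μ, 0 ≤ r) ∧ ∀ᵐ r ∂μ, r ≤ b :=
  eventually_and.mp (mem_ae_iff.mpr h)

lemma hatPath_eq_hatMean [IsProbabilityMeasure μ] (hc : μ (Icc (0 : ℝ) m)ᶜ = 0)
    (hp : IsRegularPath Q μ Φ) {t : ℝ} (ht : t ∈ Icc (0 : ℝ) m) :
    hatPath μ Φ t = hatMean Q μ Φ t := by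
  obtain ⟨h0, hle⟩ := ae_mem_of_concentrated hc
  ext i j
  simp only [hatPath, hatMean, Matrix.of_apply]
  rw [integral_distFun_mul_deriv ht.1 ht.2 h0 hle (fun s hs => hp.hasDerivWithinAt hs i j)
    (continuousOn_pi.mp (continuousOn_pi.mp hp.continuousOn_pathDeriv i) j), hp.finish]

lemma integral_distFun_mul_potential [IsProbabilityMeasure μ] {β : ℕ → Fin m → ℝ}
    (hβ : ∀ j, Summable fun p : ℕ => (2 : ℝ) ^ p * β p j ^ 2) (h : Fin m → ℝ)
    (hQ : IsConstraint Q) (hc : μ (Icc (0 : ℝ) m)ᶜ = 0) (hp : IsRegularPath Q μ Φ) :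
    (∫ t in (0 : ℝ)..(m : ℝ),
        distFun μ t * frob (xiDeriv β (Φ t) + Matrix.vecMulVec h h) (pathDeriv Φ t)) =
      potential β h Q - ∫ r, potential β h (Φ r) ∂μ := by
  obtain ⟨h0, hle⟩ := ae_mem_of_concentrated hc
  have hmem : ∀ t ∈ Icc (0 : ℝ) m, ∀ i j, Φ t i j ∈ Ioo (-3 / 2 : ℝ) (3 / 2) := fun t ht i j =>
    mem_Ioo_of_abs_le_one (hp.abs_apply_le hQ ht i j)
  have hforce : ContinuousOn (fun t => xiDeriv β (Φ t) + Matrix.vecMulVec h h) (Icc (0 : ℝ) m) :=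
    fun t ht => ((continuousAt_xiDeriv hβ (hmem t ht)).comp_continuousWithinAt
      (hp.continuousOn t ht)).add continuousWithinAt_const
  rw [integral_zero_distFun_mul_deriv (f := fun t => potential β h (Φ t)) (Nat.cast_nonneg m) h0
    hle (fun t ht => hasDerivWithinAt_potential hβ h (hp.hasDerivWithinAt ht) (hmem t ht))
    (fun t ht => tendsto_frob (hforce t ht) (hp.continuousOn_pathDeriv t ht)), hp.finish]

/-- Twice the Crisanti–Sommers functional of a path with derivative `Φ'`, without the term depending
on `Q` only and with all distribution functions integrated by parts against the measure. -/
noncomputable def reduced (β : ℕ → Fin m → ℝ) (h : Fin m → ℝ) (Q : Matrix (Fin m) (Fin m) ℝ)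
    (μ : Measure ℝ) (Φ Φ' : ℝ → Matrix (Fin m) (Fin m) ℝ) (T : ℝ) : ℝ :=
  -(∫ r, potential β h (Φ r) ∂μ) + Real.log (Q - Φ T).det
    + ∫ t in (0 : ℝ)..T, frob (hatMean Q μ Φ t)⁻¹ (Φ' t)

lemma crisantiSommers_eq_reduced [IsProbabilityMeasure μ] {β : ℕ → Fin m → ℝ}
    (hβ : ∀ j, Summable fun p : ℕ => (2 : ℝ) ^ p * β p j ^ 2) (h : Fin m → ℝ)
    (hQ : IsConstraint Q) (hc : μ (Icc (0 : ℝ) m)ᶜ = 0) (hp : IsRegularPath Q μ Φ) {T : ℝ}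
    (hT : T ∈ Icc (0 : ℝ) m) :
    crisantiSommers β h μ Φ T =
      (1 / 2) * (potential β h Q + reduced β h Q μ Φ (pathDeriv Φ) T) := by
  have hhat : ∫ t in (0 : ℝ)..T, frob (hatPath μ Φ t)⁻¹ (pathDeriv Φ t) =
      ∫ t in (0 : ℝ)..T, frob (hatMean Q μ Φ t)⁻¹ (pathDeriv Φ t) := by
    refine intervalIntegral.integral_congr fun t ht => ?_
    rw [uIcc_of_le hT.1] at ht
    simp only [hatPath_eq_hatMean hc hp ⟨ht.1, ht.2.trans hT.2⟩]
  rw [crisantiSommers, integral_distFun_mul_potential hβ h hQ hc hp, hhat, hp.finish, reduced]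
  ring

end RegularPath

section C11

/-- `f` is differentiable with locally Lipschitz derivative `f'`. -/
structure IsC11 (f f' : ℝ → ℝ) : Prop where
  hasDerivAt : ∀ t, HasDerivAt f (f' t) t
  locallyLipschitz : LocallyLipschitz f'

lemma locallyLipschitz_contDiffAt_comp {X E F : Type*} [PseudoEMetricSpace X]
    [NormedAddCommGroup E] [NormedSpace ℝ E] [NormedAddCommGroup F] [NormedSpace ℝ F]
    {f : X → E} {φ : E → F} (hf : LocallyLipschitz f) (hφ : ∀ x, ContDiffAt ℝ 1 φ (f x)) :
    LocallyLipschitz fun x => φ (f x) := fun x => by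
  obtain ⟨K, S, hS, hK⟩ := hf x
  obtain ⟨L, T, hT, hL⟩ := (hφ x).exists_lipschitzOnWith
  exact ⟨L * K, S ∩ f ⁻¹' T, inter_mem hS (hf.continuous.continuousAt hT),
    hL.comp (hK.mono inter_subset_left) fun _ hy => hy.2⟩

lemma locallyLipschitz_mul {f g : ℝ → ℝ} (hf : LocallyLipschitz f) (hg : LocallyLipschitz g) :
    LocallyLipschitz fun t => f t * g t :=
  locallyLipschitz_contDiffAt_comp (φ := fun p : ℝ × ℝ => p.1 * p.2) (hf.prodMk hg) fun _ =>
    contDiffAt_fst.mul contDiffAt_snd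

variable {f f' g g' : ℝ → ℝ}

lemma IsC11.continuous (hf : IsC11 f f') : Continuous f :=
  continuous_iff_continuousAt.mpr fun t => (hf.hasDerivAt t).continuousAt

lemma locallyLipschitz_of_hasDerivAt (hf : ∀ t, HasDerivAt f (f' t) t) (hf' : Continuous f') :
    LocallyLipschitz f := by
  refine ContDiff.locallyLipschitz (𝕂 := ℝ) (contDiff_one_iff_deriv.mpr
    ⟨fun t => (hf t).differentiableAt, ?_⟩)
  rwa [funext fun t => (hf t).deriv]

lemma IsC11.locallyLipschitz_self (hf : IsC11 f f') : LocallyLipschitz f :=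
  locallyLipschitz_of_hasDerivAt hf.hasDerivAt hf.locallyLipschitz.continuous

lemma isC11_of_contDiff (hf : ContDiff ℝ 2 f) : IsC11 f (deriv f) where
  hasDerivAt t := (hf.differentiable (by norm_num) t).hasDerivAt
  locallyLipschitz := ((contDiff_succ_iff_deriv (n := 1)).mp hf).2.2.locallyLipschitz

lemma isC11_const (c : ℝ) : IsC11 (fun _ => c) (fun _ => 0) where
  hasDerivAt t := hasDerivAt_const t c
  locallyLipschitz := LocallyLipschitz.const 0

lemma isC11_id : IsC11 (fun t => t) (fun _ => 1) where
  hasDerivAt t := hasDerivAt_id t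
  locallyLipschitz := LocallyLipschitz.const 1

lemma IsC11.add (hf : IsC11 f f') (hg : IsC11 g g') :
    IsC11 (fun t => f t + g t) (fun t => f' t + g' t) where
  hasDerivAt t := (hf.hasDerivAt t).add (hg.hasDerivAt t)
  locallyLipschitz := hf.locallyLipschitz.add hg.locallyLipschitz

lemma IsC11.sub (hf : IsC11 f f') (hg : IsC11 g g') :
    IsC11 (fun t => f t - g t) (fun t => f' t - g' t) where
  hasDerivAt t := (hf.hasDerivAt t).sub (hg.hasDerivAt t)
  locallyLipschitz := hf.locallyLipschitz.sub hg.locallyLipschitz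

lemma IsC11.mul (hf : IsC11 f f') (hg : IsC11 g g') :
    IsC11 (fun t => f t * g t) (fun t => f' t * g t + f t * g' t) where
  hasDerivAt t := (hf.hasDerivAt t).mul (hg.hasDerivAt t)
  locallyLipschitz :=
    (locallyLipschitz_mul hf.locallyLipschitz hg.locallyLipschitz_self).add
      (locallyLipschitz_mul hf.locallyLipschitz_self hg.locallyLipschitz)

lemma IsC11.const_mul (hf : IsC11 f f') (c : ℝ) :
    IsC11 (fun t => c * f t) (fun t => c * f' t) where
  hasDerivAt t := (hf.hasDerivAt t).const_mul c
  locallyLipschitz := locallyLipschitz_mul (LocallyLipschitz.const c) hf.locallyLipschitz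

lemma IsC11.comp (hf : IsC11 f f') (hg : IsC11 g g') :
    IsC11 (fun t => f (g t)) (fun t => f' (g t) * g' t) where
  hasDerivAt t := (hf.hasDerivAt (g t)).comp t (hg.hasDerivAt t)
  locallyLipschitz := locallyLipschitz_mul
    (hf.locallyLipschitz.comp hg.locallyLipschitz_self) hg.locallyLipschitz

lemma isC11_orderIso_symm {e : ℝ ≃o ℝ} {e' : ℝ → ℝ} (he : IsC11 e e') (h0 : ∀ t, e' t ≠ 0) :
    IsC11 e.symm (fun t => (e' (e.symm t))⁻¹) := by
  have hderiv : ∀ t, HasDerivAt e.symm (e' (e.symm t))⁻¹ t := fun t =>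
    HasDerivAt.of_local_left_inverse e.symm.continuous.continuousAt (he.hasDerivAt _) (h0 _)
      (Eventually.of_forall e.apply_symm_apply)
  have hlip : LocallyLipschitz e.symm := locallyLipschitz_of_hasDerivAt hderiv
    ((he.locallyLipschitz.continuous.comp e.symm.continuous).inv₀ fun t => h0 _)
  exact ⟨hderiv, locallyLipschitz_contDiffAt_comp (φ := fun x => x⁻¹)
    (he.locallyLipschitz.comp hlip) fun t => contDiffAt_inv ℝ (h0 _)⟩

lemma exists_orderIso_of_le_deriv {c : ℝ} (hc : 0 < c) (hf : ∀ t, HasDerivAt f (f' t) t)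
    (hcf : ∀ t, c ≤ f' t) : ∃ e : ℝ ≃o ℝ, ⇑e = f := by
  have hmono : Monotone fun t => f t - c * t :=
    monotone_of_hasDerivAt_nonneg (f' := fun t => f' t - c)
      (fun t => ((hf t).sub ((hasDerivAt_id t).const_mul c)).congr_deriv (by rw [mul_one]))
      fun t => sub_nonneg.mpr (hcf t)
  have hgrowth : ∀ ⦃a b⦄, a ≤ b → f a - c * a ≤ f b - c * b := hmono
  have hlin_top : Tendsto (fun t => c * t + f 0) atTop atTop :=
    tendsto_atTop_add_const_right _ _ (tendsto_id.const_mul_atTop hc)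
  have hlin_bot : Tendsto (fun t => c * t + f 0) atBot atBot :=
    tendsto_atBot_add_const_right _ _ (tendsto_id.const_mul_atBot hc)
  have hstrict : StrictMono f := fun a b hab => by
    linarith [hgrowth hab.le, mul_lt_mul_of_pos_left hab hc]
  have hsurj : Function.Surjective f := by
    refine (continuous_iff_continuousAt.mpr fun t => (hf t).continuousAt).surjective ?_ ?_
    · refine tendsto_atTop_mono' _ ?_ hlin_top
      filter_upwards [eventually_ge_atTop 0] with t ht
      linarith [hgrowth ht]
    · refine tendsto_atBot_mono' _ ?_ hlin_bot
      filter_upwards [eventually_le_atBot 0] with t ht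
      linarith [hgrowth ht]
  exact ⟨hstrict.orderIsoOfSurjective f hsurj, rfl⟩

lemma exists_isC11_transition {a b : ℝ} (hab : a < b) :
    ∃ w w' : ℝ → ℝ, IsC11 w w' ∧ (∀ t, w t ∈ Icc 0 1) ∧ (∀ t, 0 ≤ w' t) ∧
      (∀ t ≤ a, w t = 0 ∧ w' t = 0) ∧ ∀ t, b ≤ t → w t = 1 ∧ w' t = 0 := by
  have hc : 0 < (b - a)⁻¹ := inv_pos.mpr (sub_pos.mpr hab)
  have hscale : IsC11 (fun t => (b - a)⁻¹ * (t - a)) (fun _ => (b - a)⁻¹ * (1 - 0)) :=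
    (isC11_id.sub (isC11_const a)).const_mul _
  refine ⟨fun t => Real.smoothTransition ((b - a)⁻¹ * (t - a)), _,
    (isC11_of_contDiff Real.smoothTransition.contDiff).comp hscale, fun t =>
    ⟨Real.smoothTransition.nonneg _, Real.smoothTransition.le_one _⟩, fun t =>
    mul_nonneg Real.smoothTransition.monotone.deriv_nonneg (by simpa using hc.le),
    fun t ht => ?_, fun t ht => ?_⟩
  · have hw := Real.smoothTransition.zero_of_nonpos
      (mul_nonpos_of_nonneg_of_nonpos hc.le (sub_nonpos.mpr ht))
    refine ⟨hw, ?_⟩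
    rw [IsLocalMin.deriv_eq_zero (Eventually.of_forall fun y =>
      hw.trans_le (Real.smoothTransition.nonneg y)), zero_mul]
  · have hw := Real.smoothTransition.one_of_one_le (x := (b - a)⁻¹ * (t - a)) (by
      rw [inv_mul_eq_div, one_le_div (sub_pos.mpr hab)]
      exact sub_le_sub_right ht a)
    refine ⟨hw, ?_⟩
    rw [IsLocalMax.deriv_eq_zero (Eventually.of_forall fun y =>
      (Real.smoothTransition.le_one y).trans_eq hw.symm), zero_mul]

end C11

section MonotonePath

variable {m : ℕ} {P P' R R' : ℝ → Matrix (Fin m) (Fin m) ℝ}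

/-- Paths of symmetric matrices on the whole line with locally Lipschitz derivative `P'` that
increase in the positive semidefinite order. -/
structure IsMonotonePath (P P' : ℝ → Matrix (Fin m) (Fin m) ℝ) : Prop where
  isC11 : ∀ i j, IsC11 (fun t => P t i j) (fun t => P' t i j)
  posSemidef_deriv : ∀ t, (P' t).PosSemidef
  isHermitian : ∀ t, (P t).IsHermitian

lemma isMonotonePath_zero :
    IsMonotonePath (fun _ => (0 : Matrix (Fin m) (Fin m) ℝ)) fun _ => 0 where
  isC11 _ _ := isC11_const 0
  posSemidef_deriv _ := Matrix.PosSemidef.zero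
  isHermitian _ := Matrix.isHermitian_zero

lemma IsMonotonePath.continuous (hP : IsMonotonePath P P') : Continuous P :=
  continuous_pi fun i => continuous_pi fun j => (hP.isC11 i j).continuous

lemma IsMonotonePath.continuous_deriv (hP : IsMonotonePath P P') : Continuous P' :=
  continuous_pi fun i => continuous_pi fun j => (hP.isC11 i j).locallyLipschitz.continuous

lemma IsMonotonePath.posSemidef_sub (hP : IsMonotonePath P P') {s t : ℝ} (hst : s ≤ t) :
    (P t - P s).PosSemidef := by
  refine posSemidef_iff_isHermitian_and_nonneg.mpr
    ⟨(hP.isHermitian t).sub (hP.isHermitian s), fun v => ?_⟩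
  have hform : Monotone fun t => v ⬝ᵥ P t *ᵥ v := monotone_of_hasDerivAt_nonneg
    (fun t => (hasDerivWithinAt_dotProduct_mulVec (S := univ)
      (fun i j => ((hP.isC11 i j).hasDerivAt t).hasDerivWithinAt) v).hasDerivAt univ_mem)
    fun t => (posSemidef_iff_isHermitian_and_nonneg.mp (hP.posSemidef_deriv t)).2 v
  rw [Matrix.sub_mulVec, dotProduct_sub]
  exact sub_nonneg.mpr (hform hst)

lemma IsMonotonePath.add (hP : IsMonotonePath P P') (hR : IsMonotonePath R R') :
    IsMonotonePath (fun t => P t + R t) (fun t => P' t + R' t) where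
  isC11 i j := (hP.isC11 i j).add (hR.isC11 i j)
  posSemidef_deriv t := (hP.posSemidef_deriv t).add (hR.posSemidef_deriv t)
  isHermitian t := (hP.isHermitian t).add (hR.isHermitian t)

lemma IsMonotonePath.convexCombination (hP : IsMonotonePath P P') (hR : IsMonotonePath R R')
    {ε : ℝ} (hε : ε ∈ Icc 0 1) :
    IsMonotonePath (fun t => P t + ε • (R t - P t)) (fun t => P' t + ε • (R' t - P' t)) where
  isC11 i j := (hP.isC11 i j).add (((hR.isC11 i j).sub (hP.isC11 i j)).const_mul ε)
  posSemidef_deriv t := by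
    convert ((hP.posSemidef_deriv t).smul (sub_nonneg.mpr hε.2)).add
      ((hR.posSemidef_deriv t).smul hε.1) using 1
    module
  isHermitian t := (hP.isHermitian t).add
    (isHermitian_smul ε ((hR.isHermitian t).sub (hP.isHermitian t)))

lemma IsMonotonePath.comp (hP : IsMonotonePath P P') {σ σ' : ℝ → ℝ} (hσ : IsC11 σ σ')
    (hσ' : ∀ t, 0 ≤ σ' t) : IsMonotonePath (fun t => P (σ t)) (fun t => σ' t • P' (σ t)) where
  isC11 i j := by
    simpa only [Matrix.smul_apply, smul_eq_mul, mul_comm] using (hP.isC11 i j).comp hσ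
  posSemidef_deriv t := (hP.posSemidef_deriv _).smul (hσ' t)
  isHermitian t := hP.isHermitian _

lemma isMonotonePath_smul_const {w w' : ℝ → ℝ} (hw : IsC11 w w') (hw' : ∀ t, 0 ≤ w' t)
    {B : Matrix (Fin m) (Fin m) ℝ} (hB : B.PosSemidef) :
    IsMonotonePath (fun t => w t • B) (fun t => w' t • B) where
  isC11 i j := by
    simpa only [Matrix.smul_apply, smul_eq_mul, mul_comm _ (B i j)] using hw.const_mul (B i j)
  posSemidef_deriv t := hB.smul (hw' t)
  isHermitian t := isHermitian_smul _ hB.1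

lemma IsMonotonePath.exists_extension_to (hP : IsMonotonePath P P')
    {Q : Matrix (Fin m) (Fin m) ℝ} {a b : ℝ} (hab : a < b) (hQ : (Q - P a).PosDef) :
    ∃ Ψ Ψ', IsMonotonePath Ψ Ψ' ∧ (∀ t ≤ a, Ψ t = P t ∧ Ψ' t = P' t) ∧ Ψ b = Q := by
  have hQ_herm : Q.IsHermitian := by simpa using hQ.1.add (hP.isHermitian a)
  have hnear : ∀ᶠ t in 𝓝[≥] a, (Q - P t).PosDef := eventually_posDef
    ((continuous_const.sub hP.continuous).continuousWithinAt)
    (Eventually.of_forall fun t => hQ_herm.sub (hP.isHermitian t)) hQ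
  obtain ⟨c, hac, hc⟩ := (mem_nhdsGE_iff_exists_Icc_subset).mp
    (hnear.and (mem_nhdsWithin_of_mem_nhds (Iio_mem_nhds hab)))
  obtain ⟨w, w', hw, hw_mem, hw_nonneg, hw_left, hw_right⟩ := exists_isC11_transition hac
  refine ⟨fun t => P t + w t • (Q - P t), fun t => (1 - w t) • P' t + w' t • (Q - P t),
    ⟨fun i j => ?_, fun t => ?_, fun t => ?_⟩, fun t ht => ?_, ?_⟩
  · convert (hP.isC11 i j).add (hw.mul ((isC11_const (Q i j)).sub (hP.isC11 i j))) using 2 with t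
    · rfl
    · change (1 - w _) * P' _ i j + w' _ * (Q i j - P _ i j) = _
      ring
  · refine ((hP.posSemidef_deriv t).smul (sub_nonneg.mpr (hw_mem t).2)).add ?_
    rcases le_total t a with hta | hat
    · simpa only [(hw_left t hta).2, zero_smul] using Matrix.PosSemidef.zero
    rcases le_total c t with hct | htc
    · simpa only [(hw_right t hct).2, zero_smul] using Matrix.PosSemidef.zero
    · exact (hc ⟨hat, htc⟩).1.posSemidef.smul (hw_nonneg t)
  · exact (hP.isHermitian t).add (isHermitian_smul _ (hQ_herm.sub (hP.isHermitian t)))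
  · simp only [(hw_left t ht).1, (hw_left t ht).2, zero_smul, add_zero, sub_zero, one_smul,
      and_self]
  · simp only [(hw_right b (hc ⟨hac.le, le_rfl⟩).2.le).1, one_smul, add_sub_cancel]

lemma IsMonotonePath.pathDeriv_eq (hm : 1 ≤ m) (hP : IsMonotonePath P P') {t : ℝ}
    (ht : t ∈ Icc (0 : ℝ) m) : pathDeriv P t = P' t := by
  ext i j
  exact ((hP.isC11 i j).hasDerivAt t).hasDerivWithinAt.derivWithin
    (uniqueDiffOn_Icc (by exact_mod_cast hm) t ht)

lemma exists_lipschitzOnWith_of_finite {ι : Type*} [Finite ι] {f : ι → ℝ → ℝ}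
    (hf : ∀ i, LocallyLipschitz (f i)) {s : Set ℝ} (hs : IsCompact s) :
    ∃ K, ∀ i, LipschitzOnWith K (f i) s := by
  have := Fintype.ofFinite ι
  choose K hK using fun i => (hf i).locallyLipschitzOn.exists_lipschitzOnWith_of_compact hs
  exact ⟨∑ i, K i, fun i => (hK i).weaken
    (Finset.single_le_sum (fun _ _ => zero_le) (Finset.mem_univ i))⟩

lemma IsMonotonePath.isRegularPath (hm : 1 ≤ m) {ν : Measure ℝ} (hP : IsMonotonePath P P')
    (h0 : P 0 = 0) (htr : ∀ t ∈ ν.support, (P t).trace = t) : IsRegularPath (P m) ν P where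
  posSemidef t ht := by simpa [h0] using hP.posSemidef_sub ht.1
  monotone _ _ _ _ hst := hP.posSemidef_sub hst
  start := h0
  finish := rfl
  differentiable i j t _ :=
    ((hP.isC11 i j).hasDerivAt t).differentiableAt.differentiableWithinAt
  lipschitz := by
    obtain ⟨K, hK⟩ := exists_lipschitzOnWith_of_finite
      (fun p : Fin m × Fin m => (hP.isC11 p.1 p.2).locallyLipschitz_self)
      (isCompact_Icc (a := (0 : ℝ)) (b := m))
    exact ⟨K, fun i j => hK (i, j)⟩
  lipschitz_deriv := by
    obtain ⟨K, hK⟩ := exists_lipschitzOnWith_of_finite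
      (fun p : Fin m × Fin m => (hP.isC11 p.1 p.2).locallyLipschitz)
      (isCompact_Icc (a := (0 : ℝ)) (b := m))
    refine ⟨K, fun i j s hs t ht => ?_⟩
    simpa only [hP.pathDeriv_eq hm hs, hP.pathDeriv_eq hm ht] using hK (i, j) hs ht
  trace_eq := htr

lemma IsRegularPath.exists_isMonotonePath (hm : 1 ≤ m) {Q : Matrix (Fin m) (Fin m) ℝ}
    {μ : Measure ℝ} {Φ : ℝ → Matrix (Fin m) (Fin m) ℝ} (hp : IsRegularPath Q μ Φ) :
    ∃ P P', IsMonotonePath P P' ∧ ∀ t ∈ Icc (0 : ℝ) m, P t = Φ t ∧ P' t = pathDeriv Φ t := by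
  have hm0 : (0 : ℝ) ≤ m := Nat.cast_nonneg m
  let P' : ℝ → Matrix (Fin m) (Fin m) ℝ := fun t => pathDeriv Φ (projIcc 0 (m : ℝ) hm0 t)
  have hpos : ∀ t, (P' t).PosSemidef := fun t => hp.posSemidef_pathDeriv hm (Subtype.prop _)
  have hP' : ∀ t ∈ Icc (0 : ℝ) m, P' t = pathDeriv Φ t := fun t ht => by
    simp only [P', projIcc_of_mem hm0 ht]
  obtain ⟨K, hK⟩ := hp.lipschitz_deriv
  have hlip : ∀ i j, LipschitzWith K fun t => P' t i j := fun i j => by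
    have hcomp := (hK i j).to_restrict.comp (LipschitzWith.projIcc hm0)
    rw [mul_one] at hcomp
    exact hcomp
  refine ⟨fun t => Matrix.of fun i j => ∫ s in (0 : ℝ)..t, P' s i j, P',
    ⟨fun i j => ⟨fun t => ?_, (hlip i j).locallyLipschitz⟩, hpos, fun t => ?_⟩,
    fun t ht => ⟨?_, hP' t ht⟩⟩
  · exact ((hlip i j).continuous.integral_hasStrictDerivAt 0 t).hasDerivAt
  · exact Matrix.IsHermitian.ext fun i j => by
      simp only [Matrix.of_apply, star_trivial, apply_comm_of_isHermitian (hpos _).1 i j]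
  · ext i j
    have hderiv : ∀ s ∈ Ioo 0 t, HasDerivWithinAt (fun s => Φ s i j) (P' s i j) (Ioi s) s :=
      fun s hs => by
        have hsm : s ∈ Ioo (0 : ℝ) m := ⟨hs.1, hs.2.trans_le ht.2⟩
        rw [hP' s (Ioo_subset_Icc_self hsm)]
        exact ((hp.hasDerivWithinAt (Ioo_subset_Icc_self hsm) i j).hasDerivAt
          (Icc_mem_nhds hsm.1 hsm.2)).hasDerivWithinAt
    simpa [hp.start] using intervalIntegral.integral_eq_sub_of_hasDeriv_right_of_le ht.1
      ((hp.differentiable i j).continuousOn.mono (Icc_subset_Icc_right ht.2)) hderiv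
      ((hlip i j).continuous.intervalIntegrable 0 t)

end MonotonePath

section Perturbation

variable {m : ℕ} {β : ℕ → Fin m → ℝ} {h : Fin m → ℝ} {Q : Matrix (Fin m) (Fin m) ℝ}
  {μ : Measure ℝ} {Φ P P' R R' : ℝ → Matrix (Fin m) (Fin m) ℝ}

lemma distFun_natCast_eq_one [IsProbabilityMeasure μ] (hc : μ (Icc (0 : ℝ) m)ᶜ = 0) :
    distFun μ m = 1 := by
  simp [distFun, Measure.real, (prob_compl_eq_zero_iff measurableSet_Icc).mp hc]

lemma exists_lt_distFun_eq_one [IsProbabilityMeasure μ] (hc : μ (Icc (0 : ℝ) m)ᶜ = 0) {s : ℝ}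
    (hs : topPoint m μ < s) : ∃ t ∈ Icc (0 : ℝ) m, t < s ∧ distFun μ t = 1 := by
  obtain ⟨t, ⟨ht, ht_one⟩, hts⟩ := exists_lt_of_csInf_lt
    (s := {t | t ∈ Icc (0 : ℝ) m ∧ distFun μ t = 1})
    ⟨m, ⟨Nat.cast_nonneg m, le_rfl⟩, distFun_natCast_eq_one hc⟩ hs
  exact ⟨t, ht, hts, ht_one⟩

lemma topPoint_le {t : ℝ} (ht : t ∈ Icc (0 : ℝ) m) (h1 : distFun μ t = 1) : topPoint m μ ≤ t :=
  csInf_le ⟨0, fun _ hx => hx.1.1⟩ ⟨ht, h1⟩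

lemma topPoint_nonneg : 0 ≤ topPoint m μ := Real.sInf_nonneg fun _ hx => hx.1.1

lemma ae_mem_Icc_of_distFun_eq_one [IsProbabilityMeasure μ] {t : ℝ} (ht : distFun μ t = 1) :
    ∀ᵐ r ∂μ, r ∈ Icc 0 t :=
  (mem_ae_iff_prob_eq_one measurableSet_Icc).mpr
    ((ENNReal.toReal_eq_one_iff _).mp ht)

lemma measurableEmbedding_orderIso (e : ℝ ≃o ℝ) : MeasurableEmbedding e :=
  e.toHomeomorph.measurableEmbedding

lemma symm_apply_mem_support_of_mem_support_map (e : ℝ ≃o ℝ) {t : ℝ}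
    (ht : t ∈ (μ.map e).support) : e.symm t ∈ μ.support := by
  rw [Measure.mem_support_iff_forall] at ht ⊢
  intro U hU
  have hpos := ht (e.symm ⁻¹' U) (e.symm.continuous.continuousAt hU)
  rwa [(measurableEmbedding_orderIso e).map_apply, ← preimage_comp,
    show ⇑e.symm ∘ ⇑e = id from funext e.symm_apply_apply, preimage_id] at hpos

lemma distFun_map_orderIso {e : ℝ ≃o ℝ} (he0 : e 0 = 0) (t : ℝ) :
    distFun (μ.map e) (e t) = distFun μ t := by
  rw [distFun, distFun, Measure.real, (measurableEmbedding_orderIso e).map_apply,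
    OrderIso.preimage_Icc, e.symm_apply_apply, (e.symm_apply_eq).mpr he0.symm, Measure.real]

lemma reduced_congr {s : ℝ} (hs : 0 ≤ s) (hμ : ∀ᵐ r ∂μ, r ∈ Icc 0 s)
    (heq : ∀ t ∈ Icc 0 s, P t = R t ∧ P' t = R' t) :
    reduced β h Q μ P P' s = reduced β h Q μ R R' s := by
  have hpot : ∫ r, potential β h (P r) ∂μ = ∫ r, potential β h (R r) ∂μ := by
    refine integral_congr_ae ?_
    filter_upwards [hμ] with r hr
    rw [(heq r hr).1]
  have hhat : ∀ t ∈ Icc 0 s, hatMean Q μ P t = hatMean Q μ R t := fun t ht => by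
    ext i j
    refine congrArg (Q i j - ·) (integral_congr_ae ?_)
    filter_upwards [hμ] with r hr
    rw [(heq _ ⟨hr.1.trans (le_max_left _ _), max_le hr.2 ht.2⟩).1]
  have hint : ∫ t in (0 : ℝ)..s, frob (hatMean Q μ P t)⁻¹ (P' t) =
      ∫ t in (0 : ℝ)..s, frob (hatMean Q μ R t)⁻¹ (R' t) :=
    intervalIntegral.integral_congr fun t ht => by
      rw [uIcc_of_le hs] at ht
      simp only [hhat t ht, (heq t ht).2]
  rw [reduced, reduced, hpot, hint, (heq s ⟨hs, le_rfl⟩).1]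

lemma reduced_map_orderIso {e : ℝ ≃o ℝ} {e' : ℝ → ℝ} (he : ∀ t, HasDerivAt e (e' t) t)
    (he0 : e 0 = 0) {s : ℝ} (hs : 0 ≤ s) :
    reduced β h Q (μ.map e) R R' (e s) =
      reduced β h Q μ (fun t => R (e t)) (fun t => e' t • R' (e t)) s := by
  have hmap : ∀ f : ℝ → ℝ, ∫ r, f r ∂(μ.map e) = ∫ r, f (e r) ∂μ := fun f =>
    (measurableEmbedding_orderIso e).integral_map f
  have hhat : ∀ t, hatMean Q (μ.map e) R (e t) = hatMean Q μ (fun t => R (e t)) t := fun t => by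
    ext i j
    simp only [hatMean, Matrix.of_apply, hmap, e.monotone.map_max]
  have hes : 0 ≤ e s := he0 ▸ e.monotone hs
  rw [reduced, reduced, hmap, intervalIntegral.integral_of_le hes,
    intervalIntegral.integral_of_le hs, ← integral_Icc_eq_integral_Ioc,
    ← integral_Icc_eq_integral_Ioc, ← he0, ← e.image_Icc,
    integral_image_eq_integral_deriv_smul_of_monotoneOn measurableSet_Icc
      (fun t _ => (he t).hasDerivWithinAt) (e.monotone.monotoneOn _), he0]
  simp only [hhat, frob_smul_right, smul_eq_mul]

lemma isAdmissible_and_isCutoff [IsProbabilityMeasure μ] {t T : ℝ} (ht : 0 ≤ t) (htT : t < T)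
    (hT : T < m) (hμ : distFun μ t = 1) (hp : IsRegularPath Q μ Φ) (hQ : (Q - Φ T).PosDef) :
    IsAdmissible Q μ Φ ∧ IsCutoff Q μ Φ T := by
  have htop : topPoint m μ < T := (topPoint_le ⟨ht, (htT.trans hT).le⟩ hμ).trans_lt htT
  refine ⟨⟨inferInstance, ?_, hp, htop.trans hT, ?_⟩, htop, hT, hQ.det_pos⟩
  · exact (ae_mem_Icc_of_distFun_eq_one hμ).mono fun r hr => ⟨hr.1, hr.2.trans (htT.trans hT).le⟩
  · have hdiff := hp.monotone _ ⟨topPoint_nonneg, (htop.trans hT).le⟩ T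
      ⟨(ht.trans_lt htT).le, hT.le⟩ htop.le
    rw [← sub_add_sub_cancel Q (Φ T)]
    exact (hQ.add_posSemidef hdiff).det_pos

lemma exists_admissible_of_timeChange (hm : 1 ≤ m) [IsProbabilityMeasure μ] {s t : ℝ}
    (ht : 0 ≤ t) (hts : t < s) (hμ : distFun μ t = 1) (hP : IsMonotonePath P P') (hP0 : P 0 = 0)
    (hQ : (Q - P s).PosDef) {e : ℝ ≃o ℝ} {e' : ℝ → ℝ} (he : IsC11 e e') (he' : ∀ t, 0 < e' t)
    (he0 : e 0 = 0) (hes : e s < m) (htr : ∀ r ∈ μ.support, (P r).trace = e r) :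
    ∃ ν Ψ, IsAdmissible Q ν Ψ ∧ IsCutoff Q ν Ψ (e s) ∧
      reduced β h Q ν Ψ (pathDeriv Ψ) (e s) = reduced β h Q μ P P' s := by
  have hprob : IsProbabilityMeasure (μ.map e) :=
    Measure.isProbabilityMeasure_map (measurableEmbedding_orderIso e).measurable.aemeasurable
  have he_symm : e.symm 0 = 0 := (e.symm_apply_eq).mpr he0.symm
  have hets : e t < e s := e.strictMono hts
  have het : 0 ≤ e t := he0 ▸ e.monotone ht
  have hes0 : 0 ≤ e s := het.trans hets.le
  have hμ_map : distFun (μ.map e) (e t) = 1 := (distFun_map_orderIso he0 t).trans hμ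
  have hae : ∀ᵐ r ∂(μ.map e), r ∈ Icc 0 (e s) :=
    (ae_mem_Icc_of_distFun_eq_one hμ_map).mono fun r hr => ⟨hr.1, hr.2.trans hets.le⟩
  obtain ⟨Ψ, Ψ', hΨ, hΨ_left, hΨ_end⟩ := (hP.comp (isC11_orderIso_symm he fun t => (he' t).ne')
    fun t => (inv_pos.mpr (he' _)).le).exists_extension_to (Q := Q) hes
    (by simpa only [e.symm_apply_apply] using hQ)
  have hreg : IsRegularPath Q (μ.map e) Ψ := hΨ_end ▸ hΨ.isRegularPath hm
    (by rw [(hΨ_left 0 hes0).1, he_symm, hP0]) fun r hr => by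
      have hrs := Measure.support_subset_of_isClosed isClosed_Icc hae hr
      rw [(hΨ_left r hrs.2).1, htr _ (symm_apply_mem_support_of_mem_support_map e hr),
        e.apply_symm_apply]
  obtain ⟨hadm, hcut⟩ := isAdmissible_and_isCutoff het hets hes hμ_map hreg
    (by simpa only [(hΨ_left _ le_rfl).1, e.symm_apply_apply] using hQ)
  refine ⟨μ.map e, Ψ, hadm, hcut, ?_⟩
  rw [reduced_congr hes0 hae fun r hr => ⟨(hΨ_left r hr.2).1,
      (hΨ.pathDeriv_eq hm ⟨hr.1, hr.2.trans hes.le⟩).trans (hΨ_left r hr.2).2⟩,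
    reduced_map_orderIso he.hasDerivAt he0 (ht.trans hts.le)]
  simp only [e.symm_apply_apply, smul_smul, mul_inv_cancel₀ (he' _).ne', one_smul]

lemma IsCutoff.posDef (hp : IsRegularPath Q μ Φ) {s : ℝ} (hs : IsCutoff Q μ Φ s) :
    (Q - Φ s).PosDef := by
  refine posDef_of_det_pos ?_ hs.2.2
  rw [← hp.finish]
  exact hp.monotone s ⟨topPoint_nonneg.trans hs.1.le, hs.2.1.le⟩ m
    ⟨Nat.cast_nonneg m, le_rfl⟩ hs.2.1.le

lemma exists_orderIso_lineMap {ρ ρ' : ℝ → ℝ} (hρ : IsC11 ρ ρ') (hρ' : ∀ t, 0 ≤ ρ' t) {ε : ℝ}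
    (hε : ε ∈ Ico 0 1) :
    ∃ e : ℝ ≃o ℝ, (∀ t, e t = t + ε * (ρ t - t)) ∧
      IsC11 e (fun t => 1 + ε * (ρ' t - 1)) ∧ ∀ t, 0 < 1 + ε * (ρ' t - 1) := by
  have hC11 : IsC11 (fun t => t + ε * (ρ t - t)) (fun t => 1 + ε * (ρ' t - 1)) :=
    isC11_id.add ((hρ.sub isC11_id).const_mul ε)
  have hle : ∀ t, 1 - ε ≤ 1 + ε * (ρ' t - 1) := fun t => by
    linarith [mul_nonneg hε.1 (hρ' t)]
  have hpos : 0 < 1 - ε := sub_pos.mpr hε.2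
  obtain ⟨e, he⟩ := exists_orderIso_of_le_deriv hpos hC11.hasDerivAt hle
  exact ⟨e, congrFun he, he ▸ hC11, fun t => hpos.trans_le (hle t)⟩

lemma IsCSMinimizer.reduced_le
    (hβ : ∀ j, Summable fun p : ℕ => (2 : ℝ) ^ p * β p j ^ 2) (hQ : IsConstraint Q)
    (hmin : IsCSMinimizer β h Q μ Φ) (hP : ∀ t ∈ Icc (0 : ℝ) m, P t = Φ t ∧ P' t = pathDeriv Φ t)
    {s S : ℝ} (hs : IsCutoff Q μ Φ s) {ν : Measure ℝ} {Ψ : ℝ → Matrix (Fin m) (Fin m) ℝ}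
    (hadm : IsAdmissible Q ν Ψ) (hS : IsCutoff Q ν Ψ S) :
    reduced β h Q μ P P' s ≤ reduced β h Q ν Ψ (pathDeriv Ψ) S := by
  have hprob := hmin.1.prob
  have hprobν := hadm.prob
  have hle := hmin.2 ν Ψ hadm s S hs hS
  obtain ⟨t, ht, hts, hμt⟩ := exists_lt_distFun_eq_one hmin.1.concentrated hs.1
  have hsm : s ∈ Icc (0 : ℝ) m := ⟨topPoint_nonneg.trans hs.1.le, hs.2.1.le⟩
  rw [crisantiSommers_eq_reduced hβ h hQ hmin.1.concentrated hmin.1.path hsm,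
    crisantiSommers_eq_reduced hβ h hQ hadm.concentrated hadm.path
      ⟨topPoint_nonneg.trans hS.1.le, hS.2.1.le⟩] at hle
  rw [reduced_congr hsm.1 ((ae_mem_Icc_of_distFun_eq_one hμt).mono fun r hr =>
    ⟨hr.1, hr.2.trans hts.le⟩) fun t ht => hP t ⟨ht.1, ht.2.trans hsm.2⟩]
  linarith

lemma tendsto_add_smul_nhdsGT {E : Type*} [AddCommGroup E] [Module ℝ E] [TopologicalSpace E]
    [ContinuousAdd E] [ContinuousSMul ℝ E] (a b : E) :
    Tendsto (fun ε : ℝ => a + ε • b) (𝓝[>] 0) (𝓝 a) := by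
  have hcont : Continuous fun ε : ℝ => a + ε • b := by fun_prop
  have hlim := hcont.tendsto 0
  rw [zero_smul, add_zero] at hlim
  exact hlim.mono_left nhdsWithin_le_nhds

/- The competitor `R` need not satisfy the trace constraint: it is restored by the time change
`t ↦ (1 - ε) t + ε ρ(t)`, which does not affect the reduced functional. -/
theorem IsCSMinimizer.eventually_reduced_le (hm : 1 ≤ m)
    (hβ : ∀ j, Summable fun p : ℕ => (2 : ℝ) ^ p * β p j ^ 2) (hQ : IsConstraint Q)
    (hmin : IsCSMinimizer β h Q μ Φ) (hP : IsMonotonePath P P')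
    (hPΦ : ∀ t ∈ Icc (0 : ℝ) m, P t = Φ t ∧ P' t = pathDeriv Φ t) {s : ℝ}
    (hs : IsCutoff Q μ Φ s) (hR : IsMonotonePath R R') (hR0 : R 0 = 0) {ρ ρ' : ℝ → ℝ}
    (hρ : IsC11 ρ ρ') (hρ' : ∀ t, 0 ≤ ρ' t) (hρ0 : ρ 0 = 0)
    (htr : ∀ t ∈ μ.support, (R t).trace = ρ t) :
    ∀ᶠ ε in 𝓝[>] (0 : ℝ), reduced β h Q μ P P' s ≤
      reduced β h Q μ (fun t => P t + ε • (R t - P t)) (fun t => P' t + ε • (R' t - P' t)) s := by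
  have hprob := hmin.1.prob
  obtain ⟨t₀, ht₀, ht₀s, hμt₀⟩ := exists_lt_distFun_eq_one hmin.1.concentrated hs.1
  have hQP : (Q - P s).PosDef := by
    rw [(hPΦ s ⟨ht₀.1.trans ht₀s.le, hs.2.1.le⟩).1]
    exact hs.posDef hmin.1.path
  have hP0 : P 0 = 0 := by rw [(hPΦ 0 ⟨le_rfl, Nat.cast_nonneg m⟩).1, hmin.1.path.start]
  have hposDef : ∀ᶠ ε in 𝓝[>] (0 : ℝ), (Q - (P s + ε • (R s - P s))).PosDef :=
    eventually_posDef ((tendsto_add_smul_nhdsGT _ _).const_sub Q) (Eventually.of_forall fun ε =>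
      hQ.posSemidef.1.sub ((hP.isHermitian s).add (isHermitian_smul ε
        ((hR.isHermitian s).sub (hP.isHermitian s))))) hQP
  have hcut : ∀ᶠ ε in 𝓝[>] (0 : ℝ), s + ε • (ρ s - s) < m :=
    (tendsto_add_smul_nhdsGT _ _).eventually_lt_const hs.2.1
  filter_upwards [hposDef, hcut, Ioo_mem_nhdsGT one_pos] with ε hε_posDef hε_cut hε
  obtain ⟨e, he, he_C11, he_pos⟩ := exists_orderIso_lineMap hρ hρ' ⟨hε.1.le, hε.2⟩
  obtain ⟨ν, Ψ, hadm, hcutΨ, hred⟩ := exists_admissible_of_timeChange (β := β) (h := h) hm ht₀.1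
    ht₀s hμt₀ (hP.convexCombination hR ⟨hε.1.le, hε.2.le⟩) (by simp [hP0, hR0]) hε_posDef he_C11
    he_pos (by simp [he, hρ0]) (by rwa [he]) fun t ht => by
      have htm : t ∈ Icc (0 : ℝ) m :=
        Measure.support_subset_of_isClosed isClosed_Icc hmin.1.concentrated ht
      rw [Matrix.trace_add, Matrix.trace_smul, Matrix.trace_sub, htr t ht, (hPΦ t htm).1,
        hmin.1.path.trace_eq t ht, he, smul_eq_mul]
  exact (hmin.reduced_le hβ hQ hPΦ hs hadm hcutΨ).trans_eq hred

end Perturbation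

section ParametricIntegral

lemma hasDerivAt_integral_of_continuousAt {ν : Measure ℝ} [IsFiniteMeasure ν] {a b : ℝ}
    (ha : ∀ᵐ t ∂ν, a ≤ t) (hb : ∀ᵐ t ∂ν, t ≤ b) {F F' : ℝ → ℝ → ℝ} {x₀ : ℝ}
    (hF : ∀ t ∈ Icc a b, ∀ᶠ p in 𝓝 (x₀, t), ContinuousAt (F p.1) p.2)
    (hF' : ∀ t ∈ Icc a b, ContinuousAt (Function.uncurry F') (x₀, t))
    (hderiv : ∀ t ∈ Icc a b, ∀ᶠ p in 𝓝 (x₀, t),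
      HasDerivAt (fun x => F x p.2) (F' p.1 p.2) p.1) :
    HasDerivAt (fun x => ∫ t, F x t ∂ν) (∫ t, F' x₀ t ∂ν) x₀ := by
  have hmem : ∀ᵐ t ∂ν, t ∈ Icc a b := ha.and hb
  have hF'_cont : ContinuousOn (F' x₀) (Icc a b) := fun t ht =>
    ((hF' t ht).comp (Continuous.prodMk_right x₀).continuousAt).continuousWithinAt
  obtain ⟨C, hC⟩ := isCompact_Icc.exists_bound_of_continuousOn hF'_cont
  have hF_near : ∀ᶠ x in 𝓝 x₀, ∀ t ∈ Icc a b, ContinuousAt (F x) t :=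
    isCompact_Icc.eventually_forall_of_forall_eventually hF
  have hF_meas : ∀ᶠ x in 𝓝 x₀, Integrable (F x) ν := hF_near.mono fun x hx =>
    integrable_of_continuousOn_Icc (fun t ht => (hx t ht).continuousWithinAt) ha hb
  have hF'_near : ∀ᶠ x in 𝓝 x₀, ∀ t ∈ Icc a b,
      HasDerivAt (fun x => F x t) (F' x t) x ∧ ‖F' x t‖ ≤ C + 1 := by
    refine isCompact_Icc.eventually_forall_of_forall_eventually fun t ht => (hderiv t ht).and ?_
    refine ((hF' t ht).norm.eventually_lt_const (u := C + 1) ?_).mono fun _ hp => hp.le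
    exact (hC t ht).trans_lt (lt_add_one C)
  refine (hasDerivAt_integral_of_dominated_loc_of_deriv_le hF'_near
    (hF_meas.mono fun x hx => hx.aestronglyMeasurable) hF_meas.self_of_nhds
    (integrable_of_continuousOn_Icc hF'_cont ha hb).aestronglyMeasurable
    (hmem.mono fun t ht x hx => (hx t ht).2) (integrable_const (C + 1))
    (hmem.mono fun t ht x hx => (hx t ht).1)).2

variable {m : ℕ}

lemma frob_integral {ν : Measure ℝ} {A : ℝ → Matrix (Fin m) (Fin m) ℝ}
    (hA : ∀ i j, Integrable (fun r => A r i j) ν) (B : Matrix (Fin m) (Fin m) ℝ) :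
    frob (Matrix.of fun i j => ∫ r, A r i j ∂ν) B = ∫ r, frob (A r) B ∂ν := by
  have hint : ∀ i j, Integrable (fun r => A r i j * B i j) ν := fun i j => (hA i j).mul_const _
  simp only [frob, Matrix.of_apply]
  rw [integral_finsetSum _ fun i _ => integrable_finsetSum _ fun j _ => hint i j]
  refine Finset.sum_congr rfl fun i _ => ?_
  rw [integral_finsetSum _ fun j _ => hint i j]
  simp only [integral_mul_const]

lemma isHermitian_integral {ν : Measure ℝ} {A : ℝ → Matrix (Fin m) (Fin m) ℝ}
    (hA : ∀ r, (A r).IsHermitian) : (Matrix.of fun i j => ∫ r, A r i j ∂ν).IsHermitian :=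
  Matrix.IsHermitian.ext fun i j => by
    simp only [Matrix.of_apply, star_trivial, apply_comm_of_isHermitian (hA _) i j]

lemma posSemidef_integral {ν : Measure ℝ} {A : ℝ → Matrix (Fin m) (Fin m) ℝ}
    (hA : ∀ i j, Integrable (fun r => A r i j) ν) (hpos : ∀ r, (A r).PosSemidef) :
    (Matrix.of fun i j => ∫ r, A r i j ∂ν).PosSemidef := by
  refine posSemidef_iff_isHermitian_and_nonneg.mpr
    ⟨isHermitian_integral fun r => (hpos r).1, fun v => ?_⟩
  rw [← frob_vecMulVec, frob_integral hA]
  refine integral_nonneg fun r => ?_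
  rw [frob_vecMulVec]
  exact (posSemidef_iff_isHermitian_and_nonneg.mp (hpos r)).2 v

end ParametricIntegral

section TailPath

variable {m : ℕ} {μ : Measure ℝ} {C C' : Matrix (Fin m) (Fin m) ℝ}
  {D D' : ℝ → Matrix (Fin m) (Fin m) ℝ} {s : ℝ}

/-- The path with value `C` at time `s` and derivative `-x D`, where `x` is the distribution
function of `μ`. For `C = Q - Φ(s)` and `D = Φ'` this is `Φ̂`. -/
noncomputable def tailPath (μ : Measure ℝ) (C : Matrix (Fin m) (Fin m) ℝ)
    (D : ℝ → Matrix (Fin m) (Fin m) ℝ) (s t : ℝ) : Matrix (Fin m) (Fin m) ℝ :=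
  C + Matrix.of fun i j => ∫ u in t..s, distFun μ u * D u i j

lemma tailPath_self : tailPath μ C D s s = C := by
  ext i j
  simp [tailPath]

lemma tailPath_add_smul [IsFiniteMeasure μ] (hD : Continuous D) (hD' : Continuous D')
    (ε t : ℝ) : tailPath μ (C + ε • C') (fun u => D u + ε • D' u) s t =
      tailPath μ C D s t + ε • tailPath μ C' D' s t := by
  ext i j
  have hint : ∀ {B : ℝ → Matrix (Fin m) (Fin m) ℝ}, Continuous B →
      IntervalIntegrable (fun u => distFun μ u * B u i j) volume t s := fun hB =>
    intervalIntegrable_distFun_mul (hB.matrix_elem i j).continuousOn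
  simp only [tailPath, Matrix.add_apply, Matrix.smul_apply, Matrix.of_apply, smul_eq_mul]
  rw [mul_add ε, add_add_add_comm (C i j), ← intervalIntegral.integral_const_mul,
    ← intervalIntegral.integral_add (hint hD) ((hint hD').const_mul ε)]
  simp only [mul_add, mul_left_comm ε]

lemma continuous_tailPath [IsFiniteMeasure μ] (hD : Continuous D) :
    Continuous (tailPath μ C D s) :=
  continuous_pi fun i => continuous_pi fun j =>
    continuous_const.add (continuous_integral_distFun_mul (hD.matrix_elem i j) s)

lemma posDef_tailPath [IsFiniteMeasure μ] (hC : C.PosDef) (hD : Continuous D)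
    (hpos : ∀ t, (D t).PosSemidef) {t : ℝ} (ht : t ≤ s) : (tailPath μ C D s t).PosDef := by
  have hint : ∀ i j, Integrable (fun u => (distFun μ u • D u) i j)
      (volume.restrict (Ioc t s)) := fun i j =>
    (intervalIntegrable_distFun_mul (hD.matrix_elem i j).continuousOn).1
  refine hC.add_posSemidef ?_
  simp only [intervalIntegral.integral_of_le ht]
  exact posSemidef_integral hint fun u => (hpos u).smul measureReal_nonneg

lemma hasDerivWithinAt_tailPath_right [IsProbabilityMeasure μ] (h0 : ∀ᵐ r ∂μ, 0 ≤ r)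
    (hD : Continuous D) (t : ℝ) (i j : Fin m) :
    HasDerivWithinAt (fun t => tailPath μ C D s t i j) ((-(distFun μ t • D t)) i j) (Ici t) t := by
  have hDij : Continuous fun t => D t i j := hD.matrix_elem i j
  have hderiv := intervalIntegral.integral_hasDerivWithinAt_left (s := Ici t) (t := Ioi t)
    (intervalIntegrable_distFun_mul (μ := μ) (b := s) hDij.continuousOn)
    (monotone_distFun.measurable.mul
      hDij.measurable).stronglyMeasurable.stronglyMeasurableAtFilter
    (((continuousWithinAt_distFun h0 t).mul hDij.continuousWithinAt).mono Ioi_subset_Ici_self)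
  exact (hderiv.const_add (C i j)).congr_deriv (by simp)

lemma nhdsWithin_Iic_inf_ae_le (t : ℝ) : 𝓝[≤] t ⊓ ae volume ≤ 𝓝[<] t := by
  have hae : ae (volume : Measure ℝ) ≤ 𝓟 {t}ᶜ := by
    rw [le_principal_iff, mem_ae_iff, compl_compl, Real.volume_singleton]
  refine (inf_le_inf_left _ hae).trans_eq ?_
  rw [nhdsWithin, nhdsWithin, inf_assoc, inf_principal, ← sdiff_eq, Iic_sdiff_right]

lemma hasDerivWithinAt_tailPath_left [IsFiniteMeasure μ] (hD : Continuous D) (t : ℝ)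
    (i j : Fin m) : HasDerivWithinAt (fun t => tailPath μ C D s t i j)
      ((-(Function.leftLim (distFun μ) t • D t)) i j) (Iic t) t := by
  have hDij : Continuous fun t => D t i j := hD.matrix_elem i j
  have hlim : Tendsto (fun u => distFun μ u * D u i j) (𝓝[<] t)
      (𝓝 (Function.leftLim (distFun μ) t * D t i j)) :=
    (monotone_distFun.tendsto_leftLim t).mul ((hDij.tendsto t).mono_left nhdsWithin_le_nhds)
  have hderiv := intervalIntegral.integral_hasDerivWithinAt_of_tendsto_ae_left (s := Iic t)
    (t := Iic t) (intervalIntegrable_distFun_mul (μ := μ) (b := s) hDij.continuousOn)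
    (monotone_distFun.measurable.mul
      hDij.measurable).stronglyMeasurable.stronglyMeasurableAtFilter
    (hlim.mono_left (nhdsWithin_Iic_inf_ae_le t))
  exact (hderiv.const_add (C i j)).congr_deriv (by simp)

lemma hatMean_eq_tailPath [IsProbabilityMeasure μ] (h0 : ∀ᵐ r ∂μ, 0 ≤ r) (hs : ∀ᵐ r ∂μ, r ≤ s)
    {P P' : ℝ → Matrix (Fin m) (Fin m) ℝ}
    (hP : ∀ i j, IsC11 (fun t => P t i j) (fun t => P' t i j)) (Q : Matrix (Fin m) (Fin m) ℝ)
    {t : ℝ} (ht : t ∈ Icc 0 s) : hatMean Q μ P t = tailPath μ (Q - P s) P' s t := by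
  ext i j
  simp only [hatMean, tailPath, Matrix.of_apply, Matrix.add_apply, Matrix.sub_apply]
  rw [integral_distFun_mul_deriv ht.1 ht.2 h0 hs
    (fun u _ => ((hP i j).hasDerivAt u).hasDerivWithinAt)
    (hP i j).locallyLipschitz.continuous.continuousOn]
  ring

/-- The matrix-valued integral `∫₀ᵗ Y`. -/
noncomputable def primitive (Y : ℝ → Matrix (Fin m) (Fin m) ℝ) (t : ℝ) :
    Matrix (Fin m) (Fin m) ℝ :=
  Matrix.of fun i j => ∫ u in (0 : ℝ)..t, Y u i j

lemma hasDerivAt_primitive {Y : ℝ → Matrix (Fin m) (Fin m) ℝ} (hY : Continuous Y) (t : ℝ)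
    (i j : Fin m) : HasDerivAt (fun t => primitive Y t i j) (Y t i j) t :=
  ((hY.matrix_elem i j).integral_hasStrictDerivAt 0 t).hasDerivAt

lemma continuous_primitive {Y : ℝ → Matrix (Fin m) (Fin m) ℝ} (hY : Continuous Y) :
    Continuous (primitive Y) :=
  continuous_pi fun i => continuous_pi fun j =>
    continuous_iff_continuousAt.mpr fun t => (hasDerivAt_primitive hY t i j).continuousAt

/- The right derivative of `⟨Z, η⟩ - ⟨∫ Y, E⟩`, with `E' = -x η'` and `E(s) = -η(s)`, is the
integrand plus `x` times the derivative of `⟨∫ Y, η⟩`. -/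
lemma integral_frob_by_parts [IsProbabilityMeasure μ] (hs0 : 0 ≤ s) (h0 : ∀ᵐ r ∂μ, 0 ≤ r)
    (hs : ∀ᵐ r ∂μ, r ≤ s) {Z Y η η' : ℝ → Matrix (Fin m) (Fin m) ℝ} (hZ : Continuous Z)
    (hY : Continuous Y) (hZY : ∀ t ∈ Ioo 0 s, ∀ i j,
      HasDerivWithinAt (fun t => Z t i j) (distFun μ t * Y t i j) (Ioi t) t)
    (hη : ∀ i j, IsC11 (fun t => η t i j) (fun t => η' t i j)) (hη0 : η 0 = 0) :
    (∫ t in (0 : ℝ)..s, (frob (Z t) (η' t) - frob (Y t) (tailPath μ (-η s) η' s t))) =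
      frob (Z s) (η s) + ∫ r, frob (primitive Y r) (η r) ∂μ := by
  have hηc : Continuous η := continuous_pi fun i => continuous_pi fun j => (hη i j).continuous
  have hηc' : Continuous η' := continuous_pi fun i => continuous_pi fun j =>
    (hη i j).locallyLipschitz.continuous
  have hη_deriv : ∀ S t i j, HasDerivWithinAt (fun t => η t i j) (η' t i j) S t :=
    fun S t i j => ((hη i j).hasDerivAt t).hasDerivWithinAt
  have hG_deriv : ∀ S t i j, HasDerivWithinAt (fun t => primitive Y t i j) (Y t i j) S t :=
    fun S t i j => (hasDerivAt_primitive hY t i j).hasDerivWithinAt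
  have hE : Continuous (tailPath μ (-η s) η' s) := continuous_tailPath hηc'
  have hfrob : ∀ {A B : ℝ → Matrix (Fin m) (Fin m) ℝ}, Continuous A → Continuous B →
      Continuous fun t => frob (A t) (B t) := fun hA hB =>
    continuous_iff_continuousAt.mpr fun t => tendsto_frob hA.continuousAt hB.continuousAt
  have hG := continuous_primitive hY
  have hK : Continuous fun t => frob (Y t) (η t) + frob (primitive Y t) (η' t) :=
    (hfrob hY hηc).add (hfrob hG hηc')
  have hK_integral := integral_zero_distFun_mul_deriv hs0 h0 hs
    (fun t _ => hasDerivWithinAt_frob (hG_deriv _ t) (hη_deriv _ t)) hK.continuousOn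
  have hint_K := intervalIntegrable_distFun_mul (μ := μ) (a := 0) (b := s) hK.continuousOn
  have hint : IntervalIntegrable
      (fun t => frob (Z t) (η' t) - frob (Y t) (tailPath μ (-η s) η' s t)) volume 0 s :=
    ((hfrob hZ hηc').sub (hfrob hY hE)).intervalIntegrable 0 s
  have hsum := intervalIntegral.integral_eq_sub_of_hasDeriv_right_of_le hs0
    ((hfrob hZ hηc).sub (hfrob hG hE)).continuousOn (fun t ht =>
      ((hasDerivWithinAt_frob (A' := distFun μ t • Y t) (hZY t ht) (hη_deriv _ t)).sub
        (hasDerivWithinAt_frob (hG_deriv _ t) fun i j => (hasDerivWithinAt_tailPath_right h0 hηc'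
          t i j).mono Ioi_subset_Ici_self)).congr_deriv
      (by simp only [frob_smul_left, frob_neg_right, frob_smul_right]; ring)) (hint.add hint_K)
  have hG0 : primitive Y 0 = 0 := by ext i j; simp [primitive]
  have hW0 : frob (Z 0) 0 - frob 0 (tailPath μ (-η s) η' s 0) = 0 := by simp [frob]
  rw [intervalIntegral.integral_add hint hint_K, hK_integral] at hsum
  simp only [Pi.sub_apply, tailPath_self, hη0, hG0, hW0, frob_neg_right] at hsum
  linarith

end TailPath

section FirstVariation

variable {m : ℕ} {β : ℕ → Fin m → ℝ} {h : Fin m → ℝ} {Q : Matrix (Fin m) (Fin m) ℝ}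
  {μ : Measure ℝ} {P P' η η' : ℝ → Matrix (Fin m) (Fin m) ℝ} {s : ℝ}

lemma frob_mul_mul_left {Z E D : Matrix (Fin m) (Fin m) ℝ} (hZ : Z.IsHermitian) :
    frob (Z * E * Z) D = frob E (Z * D * Z) := by
  rw [frob_eq_trace, frob_eq_trace, Matrix.transpose_mul, Matrix.transpose_mul,
    transpose_eq_of_isHermitian hZ, Matrix.mul_assoc, Matrix.trace_mul_comm]
  simp only [Matrix.mul_assoc]

lemma hasDerivWithinAt_add_smul_apply (A E : Matrix (Fin m) (Fin m) ℝ) (ε : ℝ) (i j : Fin m) :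
    HasDerivWithinAt (fun ε : ℝ => (A + ε • E) i j) (E i j) univ ε :=
  ((((hasDerivAt_id ε).mul_const (E i j)).const_add (A i j)).hasDerivWithinAt).congr_deriv
    (one_mul _)

lemma hasDerivAt_frob_inv_add_smul {A E D D' : Matrix (Fin m) (Fin m) ℝ} {ε : ℝ}
    (hdet : (A + ε • E).det ≠ 0) :
    HasDerivAt (fun ε : ℝ => frob (A + ε • E)⁻¹ (D + ε • D'))
      (frob (A + ε • E)⁻¹ D' - frob ((A + ε • E)⁻¹ * E * (A + ε • E)⁻¹) (D + ε • D')) ε := by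
  refine hasDerivWithinAt_univ.mp ((hasDerivWithinAt_frob
    (A := fun ε : ℝ => (A + ε • E)⁻¹) (B := fun ε : ℝ => D + ε • D')
    (hasDerivWithinAt_matrix_inv_apply hdet (hasDerivWithinAt_add_smul_apply A E ε))
    (hasDerivWithinAt_add_smul_apply D D' ε)).congr_deriv ?_)
  rw [frob_neg_left, neg_add_eq_sub]

lemma hasDerivAt_integral_frob_inv {A E D D' : ℝ → Matrix (Fin m) (Fin m) ℝ}
    (hA : Continuous A) (hE : Continuous E) (hD : Continuous D) (hD' : Continuous D')
    (hs : 0 ≤ s) (hdet : ∀ t ∈ Icc 0 s, (A t).det ≠ 0) :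
    HasDerivAt (fun ε : ℝ => ∫ t in (0 : ℝ)..s, frob (A t + ε • E t)⁻¹ (D t + ε • D' t))
      (∫ t in (0 : ℝ)..s,
        (frob (A t)⁻¹ (D' t) - frob ((A t)⁻¹ * E t * (A t)⁻¹) (D t))) 0 := by
  have hM : Continuous fun p : ℝ × ℝ => A p.2 + p.1 • E p.2 := by fun_prop
  have hN : Continuous fun p : ℝ × ℝ => D p.2 + p.1 • D' p.2 := by fun_prop
  have hdet_near : ∀ t ∈ Icc 0 s, ∀ᶠ p in 𝓝 ((0 : ℝ), t), (A p.2 + p.1 • E p.2).det ≠ 0 :=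
    fun t ht => hM.matrix_det.continuousAt.eventually_ne (by simpa using hdet t ht)
  have hinv : ∀ p : ℝ × ℝ, (A p.2 + p.1 • E p.2).det ≠ 0 →
      ContinuousAt (fun p : ℝ × ℝ => (A p.2 + p.1 • E p.2)⁻¹) p := fun p hp =>
    ContinuousAt.comp (f := fun p : ℝ × ℝ => A p.2 + p.1 • E p.2) (continuousAt_matrix_inv hp)
      hM.continuousAt
  have hmem := ae_restrict_mem (μ := volume) (measurableSet_Ioc (a := (0 : ℝ)) (b := s))
  have key := hasDerivAt_integral_of_continuousAt (ν := volume.restrict (Ioc 0 s)) (x₀ := 0)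
    (F := fun ε t => frob (A t + ε • E t)⁻¹ (D t + ε • D' t))
    (F' := fun ε t => frob (A t + ε • E t)⁻¹ (D' t) -
      frob ((A t + ε • E t)⁻¹ * E t * (A t + ε • E t)⁻¹) (D t + ε • D' t))
    (hmem.mono fun t ht => ht.1.le) (hmem.mono fun t ht => ht.2) ?_ ?_ ?_
  · simpa only [intervalIntegral.integral_of_le hs, zero_smul, add_zero] using key
  · intro t ht
    filter_upwards [hdet_near t ht] with p hp
    exact tendsto_frob ((hinv p hp).comp (f := fun t => (p.1, t))
      (Continuous.prodMk_right p.1).continuousAt)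
      (hN.comp (Continuous.prodMk_right p.1)).continuousAt
  · intro t ht
    have hinv_t := hinv _ (hdet_near t ht).self_of_nhds
    exact (tendsto_frob hinv_t (hD'.comp continuous_snd).continuousAt).sub
      (tendsto_frob ((hinv_t.mul (hE.comp continuous_snd).continuousAt).mul hinv_t)
        hN.continuousAt)
  · intro t ht
    filter_upwards [hdet_near t ht] with p hp
    exact hasDerivAt_frob_inv_add_smul hp

/-- A monotone path `P` together with a probability measure on `[0, s]`, such that `Q - P(s)` is
positive definite: the part of an admissible pair below a cutoff `s`. -/
structure IsTruncatedPair (Q : Matrix (Fin m) (Fin m) ℝ) (μ : Measure ℝ)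
    (P P' : ℝ → Matrix (Fin m) (Fin m) ℝ) (s : ℝ) : Prop where
  prob : IsProbabilityMeasure μ
  nonneg : ∀ᵐ r ∂μ, 0 ≤ r
  le : ∀ᵐ r ∂μ, r ≤ s
  pos : 0 < s
  path : IsMonotonePath P P'
  start : P 0 = 0
  posDef : (Q - P s).PosDef
  abs_le : ∀ t ∈ Icc 0 s, ∀ i j, |P t i j| ≤ 1

/-- The inverse of `P̂`, frozen after time `s`. -/
noncomputable def invHat (Q : Matrix (Fin m) (Fin m) ℝ) (μ : Measure ℝ)
    (P P' : ℝ → Matrix (Fin m) (Fin m) ℝ) (s t : ℝ) : Matrix (Fin m) (Fin m) ℝ :=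
  (tailPath μ (Q - P s) P' s (min t s))⁻¹

/-- The matrix `P̂⁻¹ P' P̂⁻¹`; the derivative of `P̂⁻¹` is the distribution function times it. -/
noncomputable def conjDeriv (Q : Matrix (Fin m) (Fin m) ℝ) (μ : Measure ℝ)
    (P P' : ℝ → Matrix (Fin m) (Fin m) ℝ) (s t : ℝ) : Matrix (Fin m) (Fin m) ℝ :=
  invHat Q μ P P' s t * P' t * invHat Q μ P P' s t

/-- The matrix `ξ'(P(t)) + h hᵀ - ∫₀ᵗ P̂⁻¹ P' P̂⁻¹`: minus the derivative of the reduced functional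
when the mass at time `t` is moved. -/
noncomputable def force (β : ℕ → Fin m → ℝ) (h : Fin m → ℝ) (Q : Matrix (Fin m) (Fin m) ℝ)
    (μ : Measure ℝ) (P P' : ℝ → Matrix (Fin m) (Fin m) ℝ) (s t : ℝ) :
    Matrix (Fin m) (Fin m) ℝ :=
  xiDeriv β (P t) + Matrix.vecMulVec h h - primitive (conjDeriv Q μ P P' s) t

lemma IsTruncatedPair.posDef_invHat (hd : IsTruncatedPair Q μ P P' s) (t : ℝ) :
    (invHat Q μ P P' s t).PosDef :=
  have := hd.prob
  (posDef_tailPath hd.posDef hd.path.continuous_deriv hd.path.posSemidef_deriv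
    (min_le_right t s)).inv

lemma IsTruncatedPair.det_tailPath_ne_zero (hd : IsTruncatedPair Q μ P P' s) {t : ℝ}
    (ht : t ≤ s) : (tailPath μ (Q - P s) P' s t).det ≠ 0 :=
  have := hd.prob
  (posDef_tailPath hd.posDef hd.path.continuous_deriv hd.path.posSemidef_deriv ht).det_pos.ne'

lemma IsTruncatedPair.continuous_invHat (hd : IsTruncatedPair Q μ P P' s) :
    Continuous (invHat Q μ P P' s) := by
  have := hd.prob
  refine continuous_iff_continuousAt.mpr fun t => ContinuousAt.comp
    (f := fun t => tailPath μ (Q - P s) P' s (min t s))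
    (continuousAt_matrix_inv (hd.det_tailPath_ne_zero (min_le_right t s)))
    ((continuous_tailPath hd.path.continuous_deriv).comp
      (continuous_id.min continuous_const)).continuousAt

lemma IsTruncatedPair.continuous_conjDeriv (hd : IsTruncatedPair Q μ P P' s) :
    Continuous (conjDeriv Q μ P P' s) :=
  (hd.continuous_invHat.mul hd.path.continuous_deriv).mul hd.continuous_invHat

lemma invHat_eq_inv_tailPath {t : ℝ} (ht : t ≤ s) :
    invHat Q μ P P' s t = (tailPath μ (Q - P s) P' s t)⁻¹ := by
  rw [invHat, min_eq_left ht]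

lemma IsTruncatedPair.hasDerivWithinAt_invHat (hd : IsTruncatedPair Q μ P P' s) {t c : ℝ}
    {S : Set ℝ} (ht : t < s) (hderiv : ∀ i j, HasDerivWithinAt
      (fun t => tailPath μ (Q - P s) P' s t i j) ((-(c • P' t)) i j) S t) (i j : Fin m) :
    HasDerivWithinAt (fun t => invHat Q μ P P' s t i j) (c * conjDeriv Q μ P P' s t i j) S t := by
  have hev : ∀ᶠ u in 𝓝[S] t,
      invHat Q μ P P' s u i j = (tailPath μ (Q - P s) P' s u)⁻¹ i j := by
    filter_upwards [nhdsWithin_le_nhds (Iio_mem_nhds ht)] with u hu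
    rw [invHat_eq_inv_tailPath hu.le]
  refine ((hasDerivWithinAt_matrix_inv_apply (hd.det_tailPath_ne_zero ht.le) hderiv i
    j).congr_of_eventuallyEq hev (by rw [invHat_eq_inv_tailPath ht.le])).congr_deriv ?_
  rw [conjDeriv, invHat_eq_inv_tailPath ht.le]
  simp

lemma IsTruncatedPair.hasDerivWithinAt_invHat_right (hd : IsTruncatedPair Q μ P P' s) {t : ℝ}
    (ht : t < s) (i j : Fin m) : HasDerivWithinAt (fun t => invHat Q μ P P' s t i j)
      (distFun μ t * conjDeriv Q μ P P' s t i j) (Ici t) t :=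
  have := hd.prob
  hd.hasDerivWithinAt_invHat ht
    (hasDerivWithinAt_tailPath_right hd.nonneg hd.path.continuous_deriv t) i j

lemma IsTruncatedPair.hasDerivWithinAt_invHat_left (hd : IsTruncatedPair Q μ P P' s) {t : ℝ}
    (ht : t < s) (i j : Fin m) : HasDerivWithinAt (fun t => invHat Q μ P P' s t i j)
      (Function.leftLim (distFun μ) t * conjDeriv Q μ P P' s t i j) (Iic t) t :=
  have := hd.prob
  hd.hasDerivWithinAt_invHat ht (hasDerivWithinAt_tailPath_left hd.path.continuous_deriv t) i j

lemma IsTruncatedPair.apply_mem (hd : IsTruncatedPair Q μ P P' s) {t : ℝ} (ht : t ∈ Icc 0 s)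
    (i j : Fin m) : P t i j ∈ Ioo (-3 / 2 : ℝ) (3 / 2) :=
  mem_Ioo_of_abs_le_one (hd.abs_le t ht i j)

lemma IsTruncatedPair.continuousOn_xiDeriv (hd : IsTruncatedPair Q μ P P' s)
    (hβ : ∀ j, Summable fun p : ℕ => (2 : ℝ) ^ p * β p j ^ 2) :
    ContinuousOn (fun t => xiDeriv β (P t)) (Icc 0 s) := fun _ ht =>
  (continuousAt_xiDeriv hβ (hd.apply_mem ht)).comp_continuousWithinAt
    hd.path.continuous.continuousWithinAt

lemma IsTruncatedPair.continuousOn_force (hd : IsTruncatedPair Q μ P P' s)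
    (hβ : ∀ j, Summable fun p : ℕ => (2 : ℝ) ^ p * β p j ^ 2) :
    ContinuousOn (force β h Q μ P P' s) (Icc 0 s) :=
  ((hd.continuousOn_xiDeriv hβ).add continuousOn_const).sub
    (continuous_primitive hd.continuous_conjDeriv).continuousOn

lemma IsTruncatedPair.hasDerivAt_integral_potential (hd : IsTruncatedPair Q μ P P' s)
    (hβ : ∀ j, Summable fun p : ℕ => (2 : ℝ) ^ p * β p j ^ 2)
    (hη : ∀ i j, IsC11 (fun t => η t i j) (fun t => η' t i j)) :
    HasDerivAt (fun ε : ℝ => ∫ r, potential β h (P r + ε • η r) ∂μ)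
      (∫ r, frob (xiDeriv β (P r) + Matrix.vecMulVec h h) (η r) ∂μ) 0 := by
  have := hd.prob
  have hPc := hd.path.continuous
  have hηc : Continuous η := continuous_pi fun i => continuous_pi fun j => (hη i j).continuous
  have hA : Continuous fun p : ℝ × ℝ => P p.2 + p.1 • η p.2 := by fun_prop
  have hmem : ∀ t ∈ Icc 0 s, ∀ᶠ p in 𝓝 ((0 : ℝ), t), ∀ i j,
      (P p.2 + p.1 • η p.2) i j ∈ Ioo (-3 / 2 : ℝ) (3 / 2) := fun t ht => by
    simp only [eventually_all]
    exact fun i j => (hA.matrix_elem i j).continuousAt.eventually_mem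
      (isOpen_Ioo.mem_nhds (by simpa using hd.apply_mem ht i j))
  have key := hasDerivAt_integral_of_continuousAt hd.nonneg hd.le (x₀ := 0)
    (F := fun ε r => potential β h (P r + ε • η r))
    (F' := fun ε r => frob (xiDeriv β (P r + ε • η r) + Matrix.vecMulVec h h) (η r)) ?_ ?_ ?_
  · simpa only [zero_smul, add_zero] using key
  · intro t ht
    filter_upwards [hmem t ht] with p hp
    exact (hasDerivWithinAt_univ.mp (hasDerivWithinAt_potential (A := fun t => P t + p.1 • η t)
      (A' := P' p.2 + p.1 • η' p.2) hβ h (fun i j => ((hd.path.isC11 i j).hasDerivAt p.2 |>.add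
        (((hη i j).hasDerivAt p.2).const_mul p.1)).hasDerivWithinAt) hp)).continuousAt
  · intro t ht
    have hxi := ContinuousAt.comp (f := fun p : ℝ × ℝ => P p.2 + p.1 • η p.2)
      (continuousAt_xiDeriv hβ (hmem t ht).self_of_nhds) hA.continuousAt
    exact tendsto_frob (hxi.add continuousAt_const) (hηc.comp continuous_snd).continuousAt
  · intro t ht
    filter_upwards [hmem t ht] with p hp
    exact hasDerivWithinAt_univ.mp (hasDerivWithinAt_potential (A := fun ε => P p.2 + ε • η p.2)
      hβ h (hasDerivWithinAt_add_smul_apply (P p.2) (η p.2) p.1) hp)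

lemma IsTruncatedPair.reduced_add_smul (hd : IsTruncatedPair Q μ P P' s)
    (hη : ∀ i j, IsC11 (fun t => η t i j) (fun t => η' t i j)) (ε : ℝ) :
    reduced β h Q μ (fun t => P t + ε • η t) (fun t => P' t + ε • η' t) s =
      -(∫ r, potential β h (P r + ε • η r) ∂μ) + Real.log ((Q - P s) + ε • (-η s)).det +
        ∫ t in (0 : ℝ)..s, frob (tailPath μ (Q - P s) P' s t +
          ε • tailPath μ (-η s) η' s t)⁻¹ (P' t + ε • η' t) := by
  have := hd.prob
  have hend : Q - (P s + ε • η s) = (Q - P s) + ε • (-η s) := by rw [smul_neg]; abel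
  have hη'c : Continuous η' := continuous_pi fun i => continuous_pi fun j =>
    (hη i j).locallyLipschitz.continuous
  have hhat : ∀ t ∈ Icc 0 s, hatMean Q μ (fun t => P t + ε • η t) t =
      tailPath μ (Q - P s) P' s t + ε • tailPath μ (-η s) η' s t := fun t ht => by
    rw [hatMean_eq_tailPath (P := fun t => P t + ε • η t)
      (P' := fun t => P' t + ε • η' t) hd.nonneg hd.le (fun i j =>
      (hd.path.isC11 i j).add ((hη i j).const_mul ε)) Q ht, hend,
      tailPath_add_smul hd.path.continuous_deriv hη'c]
  rw [reduced, hend]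
  congr 1
  refine intervalIntegral.integral_congr fun t ht => ?_
  rw [uIcc_of_le hd.pos.le] at ht
  simp only [hhat t ht]

theorem IsTruncatedPair.hasDerivAt_reduced (hd : IsTruncatedPair Q μ P P' s)
    (hβ : ∀ j, Summable fun p : ℕ => (2 : ℝ) ^ p * β p j ^ 2)
    (hη : ∀ i j, IsC11 (fun t => η t i j) (fun t => η' t i j)) (hη0 : η 0 = 0) :
    HasDerivAt (fun ε : ℝ =>
        reduced β h Q μ (fun t => P t + ε • η t) (fun t => P' t + ε • η' t) s)
      (-∫ r, frob (force β h Q μ P P' s r) (η r) ∂μ) 0 := by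
  have := hd.prob
  have hηc : Continuous η := continuous_pi fun i => continuous_pi fun j => (hη i j).continuous
  have hη'c : Continuous η' := continuous_pi fun i => continuous_pi fun j =>
    (hη i j).locallyLipschitz.continuous
  have hint : ∀ {A : ℝ → Matrix (Fin m) (Fin m) ℝ}, ContinuousOn A (Icc 0 s) →
      Integrable (fun r => frob (A r) (η r)) μ := fun hA => integrable_of_continuousOn_Icc
    (fun r hr => tendsto_frob (hA r hr) hηc.continuousWithinAt) hd.nonneg hd.le
  have hforce : ∫ r, frob (force β h Q μ P P' s r) (η r) ∂μ =
      (∫ r, frob (xiDeriv β (P r) + Matrix.vecMulVec h h) (η r) ∂μ) -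
        ∫ r, frob (primitive (conjDeriv Q μ P P' s) r) (η r) ∂μ := by
    simp only [force, frob_sub_left]
    exact integral_sub (hint ((hd.continuousOn_xiDeriv hβ).add continuousOn_const))
      (hint (continuous_primitive hd.continuous_conjDeriv).continuousOn)
  have hlog : ((Q - P s)⁻¹ * -η s).trace = -frob (invHat Q μ P P' s s) (η s) := by
    rw [invHat_eq_inv_tailPath le_rfl, tailPath_self, frob_eq_trace,
      transpose_eq_of_isHermitian hd.posDef.inv.1, Matrix.mul_neg, Matrix.trace_neg]
  have hparts := integral_frob_by_parts hd.pos.le hd.nonneg hd.le hd.continuous_invHat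
    hd.continuous_conjDeriv (fun t ht i j => (hd.hasDerivWithinAt_invHat_right ht.2 i j).mono
      Ioi_subset_Ici_self) hη hη0
  have hintegrand : ∀ t ∈ uIcc 0 s, frob (tailPath μ (Q - P s) P' s t)⁻¹ (η' t) -
      frob ((tailPath μ (Q - P s) P' s t)⁻¹ * tailPath μ (-η s) η' s t *
        (tailPath μ (Q - P s) P' s t)⁻¹) (P' t) = frob (invHat Q μ P P' s t) (η' t) -
      frob (conjDeriv Q μ P P' s t) (tailPath μ (-η s) η' s t) := fun t ht => by
    rw [uIcc_of_le hd.pos.le] at ht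
    rw [← invHat_eq_inv_tailPath ht.2, frob_mul_mul_left (hd.posDef_invHat t).1, conjDeriv,
      frob_comm (tailPath μ (-η s) η' s t)]
  simp only [hd.reduced_add_smul hη]
  refine (((hd.hasDerivAt_integral_potential hβ hη).neg.add
    (hasDerivAt_log_det_add_smul hd.posDef.det_pos)).add (hasDerivAt_integral_frob_inv
      (continuous_tailPath hd.path.continuous_deriv) (continuous_tailPath hη'c)
      hd.path.continuous_deriv hη'c hd.pos.le
      fun t ht => hd.det_tailPath_ne_zero ht.2)).congr_deriv ?_
  rw [intervalIntegral.integral_congr hintegrand, hparts, hlog, hforce]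
  ring

end FirstVariation

section Stationarity

variable {m : ℕ} {β : ℕ → Fin m → ℝ} {h : Fin m → ℝ} {Q : Matrix (Fin m) (Fin m) ℝ}
  {μ : Measure ℝ} {F Φ P P' R R' : ℝ → Matrix (Fin m) (Fin m) ℝ} {s t : ℝ}

lemma eq_zero_of_intervalIntegral_nonpos {f : ℝ → ℝ} {a b t : ℝ}
    (hf : IntervalIntegrable f volume a b) (hf0 : ∀ t ∈ Ioc a b, 0 ≤ f t)
    (hint : ∫ t in a..b, f t ≤ 0) (ht : t ∈ Ico a b) (hft0 : 0 ≤ f t)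
    (hright : Tendsto f (𝓝[>] t) (𝓝 (f t))) : f t = 0 := by
  by_contra hne
  obtain ⟨c, hc, hpos⟩ := (mem_nhdsGT_iff_exists_Ioo_subset' ht.2).mp
    (hright.eventually_const_lt (hft0.lt_of_ne' hne))
  have hcb : t < min c b := lt_min hc ht.2
  have hab : a ≤ b := ht.1.trans ht.2.le
  have hpos_int : 0 < ∫ t in t..(min c b), f t := intervalIntegral.intervalIntegral_pos_of_pos_on
    (hf.mono_set (by
      rw [uIcc_of_le hcb.le, uIcc_of_le hab]
      exact Icc_subset_Icc ht.1 (min_le_right c b)))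
    (fun u hu => hpos ⟨hu.1, hu.2.trans_le (min_le_left c b)⟩) hcb
  have hmono := intervalIntegral.integral_mono_interval ht.1 hcb.le (min_le_right c b)
    ((ae_restrict_mem measurableSet_Ioc).mono hf0) hf
  linarith

lemma setIntegral_Ioi_nonpos {μ : Measure ℝ} {f : ℝ → ℝ} (hf : Integrable f μ)
    (hint : ∀ w w' : ℝ → ℝ, IsC11 w w' → (∀ r, 0 ≤ w' r) → (∀ r ≤ t, w r = 0) →
      ∫ r, w r * f r ∂μ ≤ 0) : ∫ r in Ioi t, f r ∂μ ≤ 0 := by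
  choose w w' hw hw01 hw' hw0 hw1 using fun n : ℕ =>
    exists_isC11_transition (lt_add_of_pos_right t (Nat.one_div_pos_of_nat (α := ℝ) (n := n)))
  refine le_of_tendsto (f := fun n : ℕ => ∫ r, w n r * f r ∂μ) (x := atTop) ?_
    (Eventually.of_forall fun n => hint _ _ (hw n) (hw' n) fun r hr => (hw0 n r hr).1)
  rw [← integral_indicator measurableSet_Ioi]
  refine tendsto_integral_of_dominated_convergence (fun r => ‖f r‖)
    (fun n => (hw n).continuous.aestronglyMeasurable.mul hf.aestronglyMeasurable) hf.norm
    (fun n => Eventually.of_forall fun r => ?_) (Eventually.of_forall fun r => ?_)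
  · rw [norm_mul, Real.norm_of_nonneg (hw01 n r).1]
    exact mul_le_of_le_one_left (norm_nonneg _) (hw01 n r).2
  · refine tendsto_const_nhds.congr' ?_
    rcases le_or_gt r t with hr | hr
    · exact Eventually.of_forall fun n => by simp [hr, (hw0 n r hr).1]
    · have hlim := tendsto_one_div_add_atTop_nhds_zero_nat (𝕜 := ℝ)
      filter_upwards [hlim.eventually_lt_const (sub_pos.mpr hr)] with n hn
      rw [indicator_of_mem (mem_Ioi.mpr hr), (hw1 n r (by linarith)).1, one_mul]

/-- The multiplier `Λ(t) = -∫_{(t, ∞)} F dμ` of the constraint that the path is monotone. -/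
noncomputable def multiplier (μ : Measure ℝ) (F : ℝ → Matrix (Fin m) (Fin m) ℝ) (t : ℝ) :
    Matrix (Fin m) (Fin m) ℝ :=
  -Matrix.of fun i j => ∫ r in Ioi t, F r i j ∂μ

lemma frob_multiplier (hF : ∀ i j, Integrable (fun r => F r i j) μ)
    (B : Matrix (Fin m) (Fin m) ℝ) :
    frob (multiplier μ F t) B = -∫ r in Ioi t, frob (F r) B ∂μ := by
  rw [multiplier, frob_neg_left, frob_integral fun i j => (hF i j).integrableOn]

lemma frob_multiplier_eq_sum (t : ℝ) (B : Matrix (Fin m) (Fin m) ℝ) :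
    frob (multiplier μ F t) B = -∑ i, ∑ j, (∫ r in Ioi t, F r i j ∂μ) * B i j := by
  rw [multiplier, frob_neg_left]
  rfl

lemma intervalIntegrable_frob_multiplier [SFinite μ] (hs : 0 ≤ s)
    (hF : ∀ i j, Integrable (fun r => F r i j) μ) (hP : Continuous P') :
    IntervalIntegrable (fun t => frob (multiplier μ F t) (P' t)) volume 0 s := by
  have hrow : ∀ i, IntervalIntegrable
      (fun t => ∑ j, (∫ r in Ioi t, F r i j ∂μ) * P' t i j) volume 0 s := fun i => by
    simpa only [Finset.sum_fn] using IntervalIntegrable.sum Finset.univ fun j _ =>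
      intervalIntegrable_setIntegral_Ioi_mul hs (hF i j)
        ((hP.matrix_elem i j).intervalIntegrable 0 s)
  simp only [frob_multiplier_eq_sum]
  have hsum := (IntervalIntegrable.sum Finset.univ fun i _ => hrow i).neg
  rwa [Finset.sum_fn] at hsum

lemma integral_frob_multiplier [IsFiniteMeasure μ] (hs : 0 ≤ s) (h0 : ∀ᵐ r ∂μ, 0 ≤ r)
    (hs' : ∀ᵐ r ∂μ, r ≤ s) (hF : ContinuousOn F (Icc 0 s)) (hP : IsMonotonePath P P')
    (hP0 : P 0 = 0) :
    ∫ t in (0 : ℝ)..s, frob (multiplier μ F t) (P' t) = -∫ r, frob (F r) (P r) ∂μ := by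
  have hF_entry : ∀ i j, ContinuousOn (fun r => F r i j) (Icc 0 s) := fun i j =>
    continuousOn_pi.mp (continuousOn_pi.mp hF i) j
  have hF_int : ∀ i j, Integrable (fun r => F r i j) μ := fun i j =>
    integrable_of_continuousOn_Icc (hF_entry i j) h0 hs'
  have hP' : ∀ i j, IntervalIntegrable (fun t => P' t i j) volume 0 s := fun i j =>
    (hP.continuous_deriv.matrix_elem i j).intervalIntegrable 0 s
  have hFP : ∀ i j, Integrable (fun r => F r i j * P r i j) μ := fun i j =>
    integrable_of_continuousOn_Icc
      ((hF_entry i j).mul (hP.isC11 i j).continuous.continuousOn) h0 hs'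
  have hprimitive : ∀ i j r, ∫ t in (0 : ℝ)..r, P' t i j = P r i j := fun i j r => by
    rw [intervalIntegral.integral_eq_sub_of_hasDerivAt
      (fun t _ => (hP.isC11 i j).hasDerivAt t)
      ((hP.continuous_deriv.matrix_elem i j).intervalIntegrable 0 r), hP0, Matrix.zero_apply,
      sub_zero]
  have hswap : ∀ i j, ∫ t in (0 : ℝ)..s, (∫ r in Ioi t, F r i j ∂μ) * P' t i j =
      ∫ r, F r i j * P r i j ∂μ := fun i j => by
    rw [integral_setIntegral_Ioi_mul hs h0 hs' (hF_int i j) (hP' i j)]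
    simp only [hprimitive]
  have hint := fun i j => intervalIntegrable_setIntegral_Ioi_mul hs (hF_int i j) (hP' i j)
  simp only [frob_multiplier_eq_sum, intervalIntegral.integral_neg]
  rw [intervalIntegral.integral_finsetSum fun i _ => by
    simpa only [Finset.sum_fn] using IntervalIntegrable.sum Finset.univ fun j _ => hint i j]
  simp only [intervalIntegral.integral_finsetSum fun j _ => hint _ j, hswap, frob]
  rw [integral_finsetSum _ fun i _ => integrable_finsetSum _ fun j _ => hFP i j]
  simp only [integral_finsetSum _ fun j _ => hFP _ j]

lemma tendsto_multiplier_right (hF : ∀ i j, Integrable (fun r => F r i j) μ) (t : ℝ) :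
    Tendsto (multiplier μ F) (𝓝[>] t) (𝓝 (multiplier μ F t)) :=
  tendsto_matrix_iff.mpr fun i j => (tendsto_setIntegral_Ioi_right (hF i j) t).neg

lemma IsAdmissible.exists_isCutoff (hadm : IsAdmissible Q μ Φ) : ∃ s, IsCutoff Q μ Φ s := by
  have hmem : topPoint m μ ∈ Icc (0 : ℝ) m := ⟨topPoint_nonneg, hadm.top_lt.le⟩
  have hdet : ContinuousWithinAt (fun t => (Q - Φ t).det) (Icc (0 : ℝ) m) (topPoint m μ) :=
    (continuous_id.matrix_det.tendsto (Q - Φ (topPoint m μ))).comp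
      (continuousWithinAt_const.sub (hadm.path.continuousOn _ hmem))
  have hle : 𝓝[>] topPoint m μ ≤ 𝓝[Icc (0 : ℝ) m] topPoint m μ := by
    refine nhdsWithin_le_iff.mpr ?_
    filter_upwards [Ioo_mem_nhdsGT hadm.top_lt] with t ht
    exact ⟨hmem.1.trans ht.1.le, ht.2.le⟩
  have hev : ∀ᶠ t in 𝓝[>] topPoint m μ, 0 < (Q - Φ t).det :=
    hle (hdet.eventually_const_lt hadm.det_pos)
  obtain ⟨s, hs_det, hs⟩ := (hev.and (Ioo_mem_nhdsGT hadm.top_lt)).exists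
  exact ⟨s, hs.1, hs.2, hs_det⟩

lemma IsAdmissible.isTruncatedPair (hQ : IsConstraint Q) (hadm : IsAdmissible Q μ Φ)
    (hP : IsMonotonePath P P') (hPΦ : ∀ t ∈ Icc (0 : ℝ) m, P t = Φ t ∧ P' t = pathDeriv Φ t)
    (hs : IsCutoff Q μ Φ s) : IsTruncatedPair Q μ P P' s := by
  have hprob := hadm.prob
  obtain ⟨t₀, ht₀, ht₀s, hμt₀⟩ := exists_lt_distFun_eq_one hadm.concentrated hs.1
  have hs0 : 0 < s := ht₀.1.trans_lt ht₀s
  have hae := ae_mem_Icc_of_distFun_eq_one hμt₀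
  refine ⟨hprob, hae.mono fun r hr => hr.1, hae.mono fun r hr => hr.2.trans ht₀s.le, hs0, hP,
    ?_, ?_, fun t ht i j => ?_⟩
  · rw [(hPΦ 0 ⟨le_rfl, Nat.cast_nonneg m⟩).1, hadm.path.start]
  · rw [(hPΦ s ⟨hs0.le, hs.2.1.le⟩).1]
    exact hs.posDef hadm.path
  · have ht' : t ∈ Icc (0 : ℝ) m := ⟨ht.1, ht.2.trans hs.2.1.le⟩
    rw [(hPΦ t ht').1]
    exact hadm.path.abs_apply_le hQ ht' i j

lemma IsTruncatedPair.integrable_force (hd : IsTruncatedPair Q μ P P' s)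
    (hβ : ∀ j, Summable fun p : ℕ => (2 : ℝ) ^ p * β p j ^ 2) (i j : Fin m) :
    Integrable (fun r => force β h Q μ P P' s r i j) μ :=
  have := hd.prob
  integrable_of_continuousOn_Icc
    (continuousOn_pi.mp (continuousOn_pi.mp (hd.continuousOn_force hβ) i) j) hd.nonneg hd.le

lemma IsTruncatedPair.isHermitian_force (hd : IsTruncatedPair Q μ P P' s) (t : ℝ) :
    (force β h Q μ P P' s t).IsHermitian := by
  have hconj : ∀ u, (conjDeriv Q μ P P' s u).IsHermitian := fun u => by
    have hpos := (hd.path.posSemidef_deriv u).mul_mul_conjTranspose_same (invHat Q μ P P' s u)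
    rw [(hd.posDef_invHat u).1.eq] at hpos
    exact hpos.1
  refine Matrix.IsHermitian.ext fun i j => ?_
  simp only [force, Matrix.sub_apply, Matrix.add_apply, xiDeriv_apply, Matrix.vecMulVec_apply,
    primitive, Matrix.of_apply, star_trivial, apply_comm_of_isHermitian (hd.path.isHermitian t) i j,
    apply_comm_of_isHermitian (hconj _) i j, xiEntry_comm β j i, mul_comm (h j)]

theorem IsCSMinimizer.integral_frob_force_nonpos (hm : 1 ≤ m)
    (hβ : ∀ j, Summable fun p : ℕ => (2 : ℝ) ^ p * β p j ^ 2) (hQ : IsConstraint Q)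
    (hmin : IsCSMinimizer β h Q μ Φ) (hP : IsMonotonePath P P')
    (hPΦ : ∀ t ∈ Icc (0 : ℝ) m, P t = Φ t ∧ P' t = pathDeriv Φ t) (hs : IsCutoff Q μ Φ s)
    (hR : IsMonotonePath R R') (hR0 : R 0 = 0) {ρ ρ' : ℝ → ℝ} (hρ : IsC11 ρ ρ')
    (hρ' : ∀ t, 0 ≤ ρ' t) (hρ0 : ρ 0 = 0) (htr : ∀ t ∈ μ.support, (R t).trace = ρ t) :
    ∫ r, frob (force β h Q μ P P' s r) (R r - P r) ∂μ ≤ 0 := by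
  have hd := hmin.1.isTruncatedPair hQ hP hPΦ hs
  have hslope := ((hd.hasDerivAt_reduced (h := h) (η := fun t => R t - P t)
    (η' := fun t => R' t - P' t) hβ (fun i j => (hR.isC11 i j).sub (hP.isC11 i j))
    (by simp only [hR0, hd.start, sub_zero])).tendsto_slope_zero_right)
  refine neg_nonneg.mp (ge_of_tendsto hslope ?_)
  filter_upwards [hmin.eventually_reduced_le hm hβ hQ hP hPΦ hs hR hR0 hρ hρ' hρ0 htr,
    self_mem_nhdsWithin] with ε hε hε0
  refine mul_nonneg (inv_nonneg.mpr (le_of_lt hε0)) (sub_nonneg.mpr ?_)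
  simpa only [zero_add, zero_smul, add_zero] using hε

theorem IsCSMinimizer.posSemidef_multiplier (hm : 1 ≤ m)
    (hβ : ∀ j, Summable fun p : ℕ => (2 : ℝ) ^ p * β p j ^ 2) (hQ : IsConstraint Q)
    (hmin : IsCSMinimizer β h Q μ Φ) (hP : IsMonotonePath P P')
    (hPΦ : ∀ t ∈ Icc (0 : ℝ) m, P t = Φ t ∧ P' t = pathDeriv Φ t) (hs : IsCutoff Q μ Φ s)
    (ht : 0 ≤ t) : (multiplier μ (force β h Q μ P P' s) t).PosSemidef := by
  have hd := hmin.1.isTruncatedPair hQ hP hPΦ hs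
  have hF := hd.integrable_force (h := h) hβ
  refine posSemidef_iff_isHermitian_and_nonneg.mpr
    ⟨(isHermitian_integral hd.isHermitian_force).neg, fun v => ?_⟩
  set B := Matrix.vecMulVec v v
  have hB : B.PosSemidef := by simpa using Matrix.posSemidef_vecMulVec_self_star v
  have hFB : Integrable (fun r => frob (force β h Q μ P P' s r) B) μ :=
    integrable_finsetSum _ fun i _ => integrable_finsetSum _ fun j _ => (hF i j).mul_const _
  rw [← frob_vecMulVec, frob_multiplier hF, neg_nonneg]
  refine setIntegral_Ioi_nonpos hFB fun w w' hw hw' hw0 => ?_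
  have hvar := hmin.integral_frob_force_nonpos hm hβ hQ hP hPΦ hs
    (hP.add (isMonotonePath_smul_const hw hw' hB)) (by simp only [hd.start, hw0 0 ht]; simp)
    (isC11_id.add (hw.const_mul B.trace))
    (fun t => add_nonneg zero_le_one (mul_nonneg hB.trace_nonneg (hw' t)))
    (by simp only [hw0 0 ht, mul_zero, add_zero]) fun r hr => ?_
  · simpa only [add_sub_cancel_left, frob_smul_right] using hvar
  · rw [Matrix.trace_add, Matrix.trace_smul, smul_eq_mul, mul_comm, (hPΦ r
      (Measure.support_subset_of_isClosed isClosed_Icc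
        (mem_ae_iff.mpr hmin.1.concentrated) hr)).1, hmin.1.path.trace_eq r hr]

theorem IsCSMinimizer.frob_multiplier_eq_zero (hm : 1 ≤ m)
    (hβ : ∀ j, Summable fun p : ℕ => (2 : ℝ) ^ p * β p j ^ 2) (hQ : IsConstraint Q)
    (hmin : IsCSMinimizer β h Q μ Φ) (hP : IsMonotonePath P P')
    (hPΦ : ∀ t ∈ Icc (0 : ℝ) m, P t = Φ t ∧ P' t = pathDeriv Φ t) (hs : IsCutoff Q μ Φ s)
    (ht : t ∈ Ico 0 s) : frob (multiplier μ (force β h Q μ P P' s) t) (P' t) = 0 := by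
  have hd := hmin.1.isTruncatedPair hQ hP hPΦ hs
  have := hd.prob
  have hF := hd.integrable_force (h := h) hβ
  have hnonneg : ∀ u, 0 ≤ u → 0 ≤ frob (multiplier μ (force β h Q μ P P' s) u) (P' u) :=
    fun u hu => frob_nonneg (hmin.posSemidef_multiplier hm hβ hQ hP hPΦ hs hu)
      (hP.posSemidef_deriv u)
  have hvar := hmin.integral_frob_force_nonpos hm hβ hQ hP hPΦ hs isMonotonePath_zero rfl
    (isC11_const 0) (fun _ => le_rfl) rfl fun _ _ => Matrix.trace_zero _ _
  simp only [zero_sub, frob_neg_right, integral_neg] at hvar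
  refine eq_zero_of_intervalIntegral_nonpos
    (f := fun t => frob (multiplier μ (force β h Q μ P P' s) t) (P' t))
    (intervalIntegrable_frob_multiplier hd.pos.le hF hP.continuous_deriv)
    (fun u hu => hnonneg u hu.1.le) ?_ ht (hnonneg t ht.1)
    (tendsto_frob (tendsto_multiplier_right hF t)
      hP.continuous_deriv.continuousAt.continuousWithinAt)
  rw [integral_frob_multiplier hd.pos.le hd.nonneg hd.le (hd.continuousOn_force hβ) hP hd.start]
  exact hvar

end Stationarity

section Expansion

open Asymptotics

variable {m : ℕ} {l : Filter ℝ} {M f F₁ D : Matrix (Fin m) (Fin m) ℝ}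
  {N X : ℝ → Matrix (Fin m) (Fin m) ℝ} {ε ε' ρ : ℝ → ℝ}

lemma isLittleO_frob {α : Type*} {l : Filter α} {A B : α → Matrix (Fin m) (Fin m) ℝ}
    {f g : α → ℝ} (hA : ∀ i j, (fun t => A t i j) =o[l] f)
    (hB : ∀ i j, (fun t => B t i j) =O[l] g) :
    (fun t => frob (A t) (B t)) =o[l] fun t => f t * g t :=
  IsLittleO.fun_sum fun i _ => IsLittleO.fun_sum fun j _ => (hA i j).mul_isBigO (hB i j)

/-- The expansion `N = M + ε f + ε' F₁ + o(ε')` along `l`, where `ε → 0` and `ε'` is smaller than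
`ε` by a factor `ρ → 0`. -/
structure HasTwoTermExpansion (l : Filter ℝ) (N : ℝ → Matrix (Fin m) (Fin m) ℝ)
    (M f F₁ : Matrix (Fin m) (Fin m) ℝ) (ε ε' ρ : ℝ → ℝ) : Prop where
  isLittleO : ∀ i j, (fun t => (N t - (M + ε t • f + ε' t • F₁)) i j) =o[l] ε'
  pos : ∀ᶠ t in l, 0 < ε t
  pos' : ∀ᶠ t in l, 0 < ε' t
  le : ∀ᶠ t in l, ε' t ≤ ρ t * ε t
  tendsto : Tendsto ε l (𝓝 0)
  tendsto_ratio : Tendsto ρ l (𝓝 0)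

lemma HasTwoTermExpansion.isLittleO_frob_const (hN : HasTwoTermExpansion l N M f F₁ ε ε' ρ)
    (B : Matrix (Fin m) (Fin m) ℝ) :
    (fun t => frob (N t - (M + ε t • f + ε' t • F₁)) B) =o[l] ε' := by
  simpa only [mul_one] using isLittleO_frob hN.isLittleO fun i j =>
    isBigO_const_const (B i j) (one_ne_zero (α := ℝ)) l

lemma HasTwoTermExpansion.isLittleO_right (hN : HasTwoTermExpansion l N M f F₁ ε ε' ρ) :
    ε' =o[l] ε := by
  have hO : ε' =O[l] fun t => ρ t * ε t := by
    refine IsBigO.of_bound 1 ?_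
    filter_upwards [hN.pos', hN.le] with t hpos hle
    rw [one_mul, Real.norm_of_nonneg hpos.le]
    exact hle.trans (le_abs_self _)
  simpa only [one_mul] using
    hO.trans_isLittleO (((isLittleO_one_iff ℝ).mpr hN.tendsto_ratio).mul_isBigO (isBigO_refl ε l))

lemma HasTwoTermExpansion.tendsto_zeroth (hN : HasTwoTermExpansion l N M f F₁ ε ε' ρ) :
    Tendsto N l (𝓝 M) := by
  refine tendsto_matrix_iff.mpr fun i j => ?_
  have hε' : Tendsto ε' l (𝓝 0) := hN.isLittleO_right.isBigO.trans_tendsto hN.tendsto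
  have hR := (hN.isLittleO i j).isBigO.trans_tendsto hε'
  have hlim := ((hN.tendsto.mul_const (f i j)).add (hε'.mul_const (F₁ i j))).add hR
  rw [zero_mul, zero_mul, add_zero, add_zero] at hlim
  refine tendsto_sub_nhds_zero_iff.mp (hlim.congr fun t => ?_)
  simp only [Matrix.sub_apply, Matrix.add_apply, Matrix.smul_apply, smul_eq_mul]
  ring

lemma HasTwoTermExpansion.frob_nonneg [l.NeBot] (hN : HasTwoTermExpansion l N M f F₁ ε ε' ρ)
    (hNpos : ∀ᶠ t in l, (N t).PosSemidef) {B : Matrix (Fin m) (Fin m) ℝ} (hB : B.PosSemidef)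
    (hMB : frob M B = 0) : 0 ≤ frob f B := by
  have ho : (fun t => ε' t * frob F₁ B + frob (N t - (M + ε t • f + ε' t • F₁)) B) =o[l] ε :=
    ((hN.isLittleO_right.const_mul_left _).congr_left fun t => mul_comm _ _).add
      ((hN.isLittleO_frob_const B).trans hN.isLittleO_right)
  refine le_of_forall_pos_le_add fun δ hδ => ?_
  obtain ⟨t, hNt, hε, hle⟩ := (hNpos.and (hN.pos.and (ho.def hδ))).exists
  have hfrob := VectorSpin.frob_nonneg hNt hB
  simp only [frob_sub_left, frob_add_left, frob_smul_left, hMB, Real.norm_eq_abs,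
    abs_of_pos hε] at hle
  have hmul : ε t * 0 ≤ ε t * (frob f B + δ) := by linarith [le_of_abs_le hle]
  exact le_of_mul_le_mul_left hmul hε

lemma HasTwoTermExpansion.mulVec_eq_zero [l.NeBot]
    (hN : HasTwoTermExpansion l N M f F₁ ε ε' ρ) (hNpos : ∀ᶠ t in l, (N t).PosSemidef) {a : ℝ}
    (ha : 0 < a) (hMf : (M - a • f).PosSemidef) {v : Fin m → ℝ} (hv : M *ᵥ v = 0) :
    f *ᵥ v = 0 := by
  have hB : (Matrix.vecMulVec v v).PosSemidef := by
    simpa using Matrix.posSemidef_vecMulVec_self_star v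
  have hMB : frob M (Matrix.vecMulVec v v) = 0 := by rw [frob_vecMulVec, hv, dotProduct_zero]
  have hfB := hN.frob_nonneg hNpos hB hMB
  have hform : v ⬝ᵥ (M - a • f) *ᵥ v = -(a * frob f (Matrix.vecMulVec v v)) := by
    rw [← frob_vecMulVec, frob_sub_left, frob_smul_left, hMB, zero_sub]
  have hzero : (M - a • f) *ᵥ v = 0 := by
    refine mulVec_eq_zero_of_dotProduct_mulVec_eq_zero hMf (le_antisymm ?_
      ((posSemidef_iff_isHermitian_and_nonneg.mp hMf).2 v))
    rw [hform]
    exact neg_nonpos.mpr (mul_nonneg ha.le hfB)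
  rw [Matrix.sub_mulVec, hv, Matrix.smul_mulVec, zero_sub, neg_eq_zero, smul_eq_zero] at hzero
  exact hzero.resolve_left ha.ne'

/-- The first two terms `M + ε f` are positive semidefinite, so they cannot help the remaining
terms to cancel in `⟨N, X⟩ = 0`. -/
lemma HasTwoTermExpansion.eventually_add_nonpos [l.NeBot]
    (hN : HasTwoTermExpansion l N M f F₁ ε ε' ρ) (hNpos : ∀ᶠ t in l, (N t).PosSemidef) {a : ℝ}
    (ha : 0 < a) (hM : M.PosSemidef) (hf : f.IsHermitian) (hMf : (M - a • f).PosSemidef)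
    (hX : ∀ᶠ t in l, (X t).PosSemidef) (hNX : ∀ᶠ t in l, frob (N t) (X t) = 0) :
    ∀ᶠ t in l, ε' t * frob F₁ (X t) + frob (N t - (M + ε t • f + ε' t • F₁)) (X t) ≤ 0 := by
  obtain ⟨δ₀, hδ₀, hpos⟩ :=
    exists_posSemidef_add_smul hM hf fun v hv => hN.mulVec_eq_zero hNpos ha hMf hv
  filter_upwards [hX, hNX, hN.pos, hN.tendsto.eventually_lt_const hδ₀] with t hXt hNXt hε hε₀
  have hle := VectorSpin.frob_nonneg (hpos (ε t) hε.le hε₀.le) hXt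
  rw [frob_sub_left, frob_add_left _ (ε' t • F₁), frob_smul_left _ F₁, hNXt]
  linarith

lemma HasTwoTermExpansion.frob_nonpos [l.NeBot] (hN : HasTwoTermExpansion l N M f F₁ ε ε' ρ)
    (hle : ∀ᶠ t in l, ε' t * frob F₁ (X t) + frob (N t - (M + ε t • f + ε' t • F₁)) (X t) ≤ 0)
    (hXD : Tendsto X l (𝓝 D)) : frob F₁ D ≤ 0 := by
  have hXO : ∀ i j, (fun t => X t i j) =O[l] fun _ => (1 : ℝ) := fun i j =>
    (tendsto_matrix_iff.mp hXD i j).isBigO_one ℝ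
  refine le_of_forall_pos_le_add fun δ hδ => ?_
  rw [zero_add]
  refine le_of_tendsto (tendsto_frob tendsto_const_nhds hXD) ?_
  filter_upwards [hle, (isLittleO_frob hN.isLittleO hXO).def hδ, hN.pos'] with t hle hR hε'
  rw [mul_one, Real.norm_eq_abs, Real.norm_of_nonneg hε'.le] at hR
  have hmul : ε' t * frob F₁ (X t) ≤ ε' t * δ := by linarith [neg_le_of_abs_le hR]
  exact le_of_mul_le_mul_left hmul hε'

/-- Second-order consequence of the complementarity `⟨N, X⟩ = 0`. Pairing the expansion of `N` with
the limit `D` of `X` controls the remainder up to `⟨F₁, D⟩ ≤ 0`. -/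
lemma HasTwoTermExpansion.eventually_frob_le [l.NeBot]
    (hN : HasTwoTermExpansion l N M f F₁ ε ε' ρ) (hNpos : ∀ᶠ t in l, (N t).PosSemidef) {a : ℝ}
    (ha : 0 < a) (hM : M.PosSemidef) (hf : f.IsHermitian) (hMf : (M - a • f).PosSemidef)
    (hX : ∀ᶠ t in l, (X t).PosSemidef) (hNX : ∀ᶠ t in l, frob (N t) (X t) = 0)
    (hD : D.PosSemidef) (hMD : frob M D = 0) (hfD : frob f D = 0)
    (hXD : ∀ i j, (fun t => (X t - D) i j) =O[l] ρ) {δ : ℝ} (hδ : 0 < δ) :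
    ∀ᶠ t in l, frob F₁ (X t) ≤ δ * ρ t := by
  have hle := hN.eventually_add_nonpos hNpos ha hM hf hMf hX hNX
  have hXlim : Tendsto X l (𝓝 D) := tendsto_matrix_iff.mpr fun i j =>
    tendsto_sub_nhds_zero_iff.mp ((hXD i j).trans_tendsto hN.tendsto_ratio)
  have hF₁D := hN.frob_nonpos hle hXlim
  filter_upwards [hle, (isLittleO_frob hN.isLittleO hXD).def hδ, hNpos, hN.pos, hN.pos', hN.le]
    with t hle hR hNt hε hε' hρε
  have hρ : 0 < ρ t := pos_of_mul_pos_left (hε'.trans_le hρε) hε.le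
  rw [Real.norm_eq_abs, Real.norm_of_nonneg (mul_pos hε' hρ).le, frob_sub_right] at hR
  have hND := VectorSpin.frob_nonneg hNt hD
  have hRD : frob (N t - (M + ε t • f + ε' t • F₁)) D = frob (N t) D - ε' t * frob F₁ D := by
    rw [frob_sub_left, frob_add_left, frob_add_left, frob_smul_left, frob_smul_left, hMD, hfD]
    ring
  have hmul : ε' t * frob F₁ (X t) ≤ ε' t * (δ * ρ t) := by
    linarith [neg_le_of_abs_le hR, mul_nonpos_of_nonneg_of_nonpos hε'.le hF₁D]
  exact le_of_mul_le_mul_left hmul hε'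

end Expansion

section AccumulationSide

open Asymptotics

variable {m : ℕ} {μ : Measure ℝ} {u σ : ℝ} {I : ℝ → Set ℝ}

lemma tendsto_measureReal_Ioc [IsFiniteMeasure μ] (u : ℝ) :
    Tendsto (fun t => μ.real (Ioc u t)) (𝓝[>] u) (𝓝 0) := by
  have hlim := (tendsto_setIntegral_Ioi_right (integrable_const (μ := μ) (1 : ℝ)) u).const_sub
    (μ.real (Ioi u))
  simp only [setIntegral_const, smul_eq_mul, mul_one, sub_self] at hlim
  refine hlim.congr' ?_
  filter_upwards [self_mem_nhdsWithin] with t ht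
  rw [← Ioc_union_Ioi_eq_Ioi (le_of_lt (mem_Ioi.mp ht)), measureReal_union
    (Ioc_disjoint_Ioi le_rfl) measurableSet_Ioi, add_sub_cancel_right]

lemma tendsto_measureReal_Ioo [IsFiniteMeasure μ] (u : ℝ) :
    Tendsto (fun t => μ.real (Ioo t u)) (𝓝[<] u) (𝓝 0) := by
  have hlim := (tendsto_setIntegral_Ioi_left (integrable_const (μ := μ) (1 : ℝ)) u).sub_const
    (μ.real (Ici u))
  simp only [setIntegral_const, smul_eq_mul, mul_one, sub_self] at hlim
  refine hlim.congr' ?_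
  filter_upwards [self_mem_nhdsWithin] with t ht
  rw [← Ioo_union_Ici_eq_Ioi ht, measureReal_union
    ((Iio_disjoint_Ici le_rfl).mono_left Ioo_subset_Iio_self) measurableSet_Ici,
    add_sub_cancel_right]

lemma measureReal_pos_of_mem_support [IsFiniteMeasure μ] {U : Set ℝ} {r : ℝ}
    (hr : r ∈ μ.support) (hU : U ∈ 𝓝 r) : 0 < μ.real U :=
  ENNReal.toReal_pos ((Measure.mem_support_iff_forall r).mp hr U hU).ne' (measure_ne_top _ _)

/-- The open half-line on the right (`σ = 1`) or on the left (`σ = -1`) of `u`. -/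
def side (u σ : ℝ) : Set ℝ := {t | 0 < σ * (t - u)}

lemma side_one (u : ℝ) : side u 1 = Ioi u := by
  ext t
  simp [side]

lemma side_neg_one (u : ℝ) : side u (-1) = Iio u := by
  ext t
  simp [side]

/-- The measure `μ` charges every neighbourhood of `u` on the side `σ = ±1`. The set `I t` is an
interval between `u`, which is excluded, and `t`, which is included or not according to how tails
of `μ` are cut on this side. -/
structure IsAccumulationSide (μ : Measure ℝ) (u σ : ℝ) (I : ℝ → Set ℝ) : Prop where
  mul_self : σ * σ = 1
  measurableSet : ∀ t, MeasurableSet (I t)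
  mem : ∀ t, ∀ r ∈ I t, r ∈ side u σ ∧ σ * (r - u) ≤ σ * (t - u)
  pos : ∀ᶠ t in 𝓝[side u σ] u, 0 < μ.real (I t)
  tendsto : Tendsto (fun t => μ.real (I t)) (𝓝[side u σ] u) (𝓝 0)

lemma isAccumulationSide_right [IsFiniteMeasure μ] {w : ℕ → ℝ} (hw : ∀ n, u < w n)
    (hw_supp : ∀ n, w n ∈ μ.support) (hw_lim : Tendsto w atTop (𝓝 u)) :
    IsAccumulationSide μ u 1 (Ioc u) where
  mul_self := one_mul 1
  measurableSet _ := measurableSet_Ioc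
  mem t r hr := by
    rw [side_one]
    exact ⟨hr.1, by linarith [hr.2]⟩
  pos := by
    rw [side_one]
    filter_upwards [self_mem_nhdsWithin] with t ht
    obtain ⟨n, hn⟩ := (hw_lim.eventually (Iio_mem_nhds ht)).exists
    exact measureReal_pos_of_mem_support (hw_supp n) (Ioc_mem_nhds (hw n) hn)
  tendsto := by
    rw [side_one]
    exact tendsto_measureReal_Ioc u

lemma isAccumulationSide_left [IsFiniteMeasure μ] {v : ℕ → ℝ} (hv : ∀ n, v n < u)
    (hv_supp : ∀ n, v n ∈ μ.support) (hv_lim : Tendsto v atTop (𝓝 u)) :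
    IsAccumulationSide μ u (-1) fun t => Ioo t u where
  mul_self := by norm_num
  measurableSet _ := measurableSet_Ioo
  mem t r hr := by
    rw [side_neg_one]
    exact ⟨hr.2, by linarith [hr.1]⟩
  pos := by
    rw [side_neg_one]
    filter_upwards [self_mem_nhdsWithin] with t ht
    obtain ⟨n, hn⟩ := (hv_lim.eventually (Ioi_mem_nhds ht)).exists
    exact measureReal_pos_of_mem_support (hv_supp n) (Ioo_mem_nhds hn (hv n))
  tendsto := by
    rw [side_neg_one]
    exact tendsto_measureReal_Ioo u

lemma IsAccumulationSide.abs_eq_one (hS : IsAccumulationSide μ u σ I) : |σ| = 1 :=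
  (abs_eq zero_le_one).mpr (mul_self_eq_one_iff.mp hS.mul_self)

lemma IsAccumulationSide.neBot (hS : IsAccumulationSide μ u σ I) : (𝓝[side u σ] u).NeBot := by
  rcases mul_self_eq_one_iff.mp hS.mul_self with rfl | rfl
  · rw [side_one]
    infer_instance
  · rw [side_neg_one]
    infer_instance

lemma IsAccumulationSide.abs_sub_eq (hS : IsAccumulationSide μ u σ I) {t : ℝ}
    (ht : t ∈ side u σ) : |t - u| = σ * (t - u) := by
  rw [← abs_of_pos (show 0 < σ * (t - u) from ht), abs_mul, hS.abs_eq_one, one_mul]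

lemma IsAccumulationSide.abs_sub_le (hS : IsAccumulationSide μ u σ I) {t r : ℝ} (hr : r ∈ I t) :
    |r - u| ≤ |t - u| := by
  obtain ⟨hr_side, hrt⟩ := hS.mem t r hr
  rw [hS.abs_sub_eq hr_side, hS.abs_sub_eq (lt_of_lt_of_le hr_side hrt)]
  exact hrt

lemma IsAccumulationSide.eventually_forall_mem (hS : IsAccumulationSide μ u σ I) {q : ℝ → Prop}
    (hq : ∀ᶠ t in 𝓝[side u σ] u, q t) : ∀ᶠ t in 𝓝[side u σ] u, ∀ r ∈ I t, q r := by
  obtain ⟨γ, hγ, hball⟩ := Metric.mem_nhdsWithin_iff.mp hq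
  filter_upwards [nhdsWithin_le_nhds (Metric.ball_mem_nhds u hγ)] with t ht r hr
  exact hball ⟨(hS.abs_sub_le hr).trans_lt ht, (hS.mem t r hr).1⟩

lemma IsAccumulationSide.eventually_mul_neg (hS : IsAccumulationSide μ u σ I) {p p' : ℝ → ℝ}
    (hp : ∀ᶠ t in 𝓝 u, HasDerivAt p (p' t) t) (hpu : p u = 0)
    (hp' : ∀ᶠ t in 𝓝[side u σ] u, p' t < 0) : ∀ᶠ t in 𝓝[side u σ] u, σ * p t < 0 := by
  obtain ⟨γ, hγ, hball⟩ := Metric.eventually_nhds_iff.mp hp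
  obtain ⟨γ', hγ', hball'⟩ := Metric.mem_nhdsWithin_iff.mp hp'
  filter_upwards [self_mem_nhdsWithin, nhdsWithin_le_nhds
    (Metric.ball_mem_nhds u (lt_min hγ hγ'))] with t ht htγ
  have hτ : 0 < σ * (t - u) := ht
  have hdist : ∀ x ∈ Icc 0 (σ * (t - u)), dist (u + σ * x) u < min γ γ' := fun x hx => by
    rw [Real.dist_eq, add_sub_cancel_left, abs_mul, hS.abs_eq_one, one_mul, abs_of_nonneg hx.1]
    exact (hx.2.trans_eq (hS.abs_sub_eq ht).symm).trans_lt htγ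
  have hderiv : ∀ x ∈ Icc 0 (σ * (t - u)),
      HasDerivAt (fun x => σ * p (u + σ * x)) (p' (u + σ * x)) x := fun x hx => by
    have hcomp := ((hball ((hdist x hx).trans_le (min_le_left _ _))).comp x
      (((hasDerivAt_id x).const_mul σ).const_add u)).const_mul σ
    exact hcomp.congr_deriv (by rw [mul_one, mul_comm, mul_assoc, hS.mul_self, mul_one])
  obtain ⟨x, hx, hslope⟩ := exists_hasDerivAt_eq_slope (fun x => σ * p (u + σ * x)) _ hτ
    (fun x hx => (hderiv x hx).continuousAt.continuousWithinAt)
    fun x hx => hderiv x (Ioo_subset_Icc_self hx)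
  have hx_side : u + σ * x ∈ side u σ := by
    rw [side, mem_ofPred_eq, add_sub_cancel_left, ← mul_assoc, hS.mul_self, one_mul]
    exact hx.1
  have hneg : p' (u + σ * x) < 0 :=
    hball' ⟨(hdist x (Ioo_subset_Icc_self hx)).trans_le (min_le_right _ _), hx_side⟩
  rw [hslope, mul_zero, add_zero, hpu, mul_zero, sub_zero, sub_zero, ← mul_assoc, hS.mul_self,
    one_mul, add_sub_cancel] at hneg
  exact (div_neg_iff.mp hneg).elim (fun h => absurd h.2 hτ.not_gt) fun h => h.1

lemma IsAccumulationSide.integrableOn_sub [IsFiniteMeasure μ] (hS : IsAccumulationSide μ u σ I)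
    (t : ℝ) : IntegrableOn (fun r => r - u) (I t) μ := by
  refine Integrable.mono' (g := fun _ => |t - u|) (integrable_const _)
    (continuous_id.sub continuous_const).aestronglyMeasurable ?_
  filter_upwards [ae_restrict_mem (hS.measurableSet t)] with r hr using hS.abs_sub_le hr

lemma IsAccumulationSide.setIntegral_pos (hS : IsAccumulationSide μ u σ I) {t : ℝ} {p : ℝ → ℝ}
    (ht : 0 < μ.real (I t)) (hp : IntegrableOn p (I t) μ) (hpos : ∀ r ∈ I t, 0 < p r) :
    0 < ∫ r in I t, p r ∂μ := by
  rw [setIntegral_pos_iff_support_of_nonneg_ae _ hp]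
  · rw [show Function.support p ∩ I t = I t from inter_eq_right.mpr fun r hr => (hpos r hr).ne']
    exact (ENNReal.toReal_pos_iff.mp ht).1
  · filter_upwards [ae_restrict_mem (hS.measurableSet t)] with r hr using (hpos r hr).le

lemma IsAccumulationSide.isLittleO_setIntegral [IsFiniteMeasure μ]
    (hS : IsAccumulationSide μ u σ I) {p : ℝ → ℝ} {p' : ℝ} (hp : HasDerivAt p p' u) :
    (fun t => ∫ r in I t, (p r - p u - (r - u) * p') ∂μ) =o[𝓝[side u σ] u]
      fun t => ∫ r in I t, σ * (r - u) ∂μ := by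
  refine IsLittleO.of_bound fun δ hδ => ?_
  have hev : ∀ᶠ r in 𝓝[side u σ] u, ‖p r - p u - (r - u) * p'‖ ≤ δ * (σ * (r - u)) := by
    filter_upwards [nhdsWithin_le_nhds (hp.isLittleO.def hδ), self_mem_nhdsWithin] with r hr hr_side
    rwa [Real.norm_eq_abs (r - u), hS.abs_sub_eq hr_side, smul_eq_mul] at hr
  filter_upwards [hS.eventually_forall_mem hev] with t ht
  have hnonneg : 0 ≤ ∫ r in I t, σ * (r - u) ∂μ :=
    setIntegral_nonneg (hS.measurableSet t) fun r hr => le_of_lt (hS.mem t r hr).1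
  rw [Real.norm_of_nonneg hnonneg, ← integral_const_mul]
  refine norm_integral_le_of_norm_le (((hS.integrableOn_sub t).const_mul σ).const_mul δ) ?_
  filter_upwards [ae_restrict_mem (hS.measurableSet t)] with r hr using ht r hr

lemma IsAccumulationSide.setIntegral_sub_le [IsFiniteMeasure μ] (hS : IsAccumulationSide μ u σ I)
    (t : ℝ) : ∫ r in I t, σ * (r - u) ∂μ ≤ σ * (t - u) * μ.real (I t) := by
  have hle := setIntegral_mono_on ((hS.integrableOn_sub t).const_mul σ)
    (integrableOn_const (measure_ne_top μ (I t))) (hS.measurableSet t)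
    fun r hr => (hS.mem t r hr).2
  rwa [setIntegral_const, smul_eq_mul, mul_comm] at hle

lemma IsAccumulationSide.setIntegral_sub_sub [IsFiniteMeasure μ] (hS : IsAccumulationSide μ u σ I)
    {p : ℝ → ℝ} (hp : Integrable p μ) (p' t : ℝ) :
    ∫ r in I t, (p r - p u - (r - u) * p') ∂μ =
      (∫ r in I t, p r ∂μ) - μ.real (I t) * p u - (∫ r in I t, (r - u) ∂μ) * p' := by
  have hconst : Integrable (fun _ => p u) (μ.restrict (I t)) := integrable_const _
  rw [integral_sub (f := fun r => p r - p u) (hp.restrict.sub hconst)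
    ((hS.integrableOn_sub t).mul_const p'), integral_sub hp.restrict hconst, setIntegral_const,
    smul_eq_mul, integral_mul_const]

lemma IsAccumulationSide.hasTwoTermExpansion [IsFiniteMeasure μ]
    (hS : IsAccumulationSide μ u σ I) {F N : ℝ → Matrix (Fin m) (Fin m) ℝ}
    {M F₁ : Matrix (Fin m) (Fin m) ℝ} (hF : ∀ i j, Integrable (fun r => F r i j) μ)
    (hF₁ : ∀ i j, HasDerivAt (fun r => F r i j) (F₁ i j) u)
    (hN : ∀ᶠ t in 𝓝[side u σ] u, ∀ i j, N t i j = M i j + σ * ∫ r in I t, F r i j ∂μ) :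
    HasTwoTermExpansion (𝓝[side u σ] u) N M (σ • F u) F₁ (fun t => μ.real (I t))
      (fun t => ∫ r in I t, σ * (r - u) ∂μ) fun t => σ * (t - u) where
  isLittleO i j := by
    refine ((hS.isLittleO_setIntegral (hF₁ i j)).const_mul_left σ).congr' ?_ .rfl
    filter_upwards [hN] with t ht
    simp only [hS.setIntegral_sub_sub (hF i j), Matrix.sub_apply, Matrix.add_apply,
      Matrix.smul_apply, smul_eq_mul, ht i j, integral_const_mul]
    ring
  pos := hS.pos
  pos' := by
    filter_upwards [hS.pos] with t ht
    exact hS.setIntegral_pos ht ((hS.integrableOn_sub t).const_mul σ) fun r hr => (hS.mem t r hr).1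
  le := Eventually.of_forall hS.setIntegral_sub_le
  tendsto := hS.tendsto
  tendsto_ratio := by
    have hcont : Continuous fun t => σ * (t - u) := by fun_prop
    simpa only [sub_self, mul_zero] using (hcont.tendsto u).mono_left nhdsWithin_le_nhds

end AccumulationSide

section SecondOrder

open Asymptotics

variable {m : ℕ} {β : ℕ → Fin m → ℝ} {h : Fin m → ℝ} {Q M : Matrix (Fin m) (Fin m) ℝ}
  {μ : Measure ℝ} {P P' : ℝ → Matrix (Fin m) (Fin m) ℝ} {s t u σ a c : ℝ} {S : Set ℝ}
  {I : ℝ → Set ℝ}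

/-- The linear map `B ↦ ξ''(P(t)) ⊙ B - P̂(t)⁻¹ B P̂(t)⁻¹`, whose value at `P'(t)` is the
derivative of the force. -/
noncomputable def forceLin (β : ℕ → Fin m → ℝ) (Q : Matrix (Fin m) (Fin m) ℝ) (μ : Measure ℝ)
    (P P' : ℝ → Matrix (Fin m) (Fin m) ℝ) (s t : ℝ) (B : Matrix (Fin m) (Fin m) ℝ) :
    Matrix (Fin m) (Fin m) ℝ :=
  (Matrix.of fun i j => deriv (xiEntry β i j) (P t i j) * B i j) -
    invHat Q μ P P' s t * B * invHat Q μ P P' s t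

/-- The diagonal part `ξ'''(P(t)) ⊙ P'(t) ⊙ B` of the derivative of `forceLin`. -/
noncomputable def xiThird (β : ℕ → Fin m → ℝ) (P P' : ℝ → Matrix (Fin m) (Fin m) ℝ) (t : ℝ)
    (B : Matrix (Fin m) (Fin m) ℝ) : Matrix (Fin m) (Fin m) ℝ :=
  Matrix.of fun i j => deriv (deriv (xiEntry β i j)) (P t i j) * P' t i j * B i j

/-- The derivative of `forceLin` in time, where `c` is the one-sided value at `t` of the
distribution function. -/
noncomputable def forceLinDeriv (β : ℕ → Fin m → ℝ) (Q : Matrix (Fin m) (Fin m) ℝ) (μ : Measure ℝ)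
    (P P' : ℝ → Matrix (Fin m) (Fin m) ℝ) (s c t : ℝ) (B : Matrix (Fin m) (Fin m) ℝ) :
    Matrix (Fin m) (Fin m) ℝ :=
  xiThird β P P' t B - c • (conjDeriv Q μ P P' s t * B * invHat Q μ P P' s t +
    invHat Q μ P P' s t * B * conjDeriv Q μ P P' s t)

lemma frob_forceLinDeriv_self (c t : ℝ) :
    frob (forceLinDeriv β Q μ P P' s c t (P' t)) (P' t) =
      frob (xiThird β P P' t (P' t)) (P' t) - 2 * c * frob (invHat Q μ P P' s t * P' t *
        invHat Q μ P P' s t * P' t * invHat Q μ P P' s t) (P' t) := by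
  rw [forceLinDeriv, frob_sub_left, frob_smul_left, frob_add_left]
  simp only [conjDeriv, Matrix.mul_assoc]
  ring

lemma IsTruncatedPair.hasDerivAt_force (hd : IsTruncatedPair Q μ P P' s)
    (hβ : ∀ j, Summable fun p : ℕ => (2 : ℝ) ^ p * β p j ^ 2) (ht : t ∈ Icc 0 s) (i j : Fin m) :
    HasDerivAt (fun r => force β h Q μ P P' s r i j) (forceLin β Q μ P P' s t (P' t) i j) t := by
  have hxi := (analyticOnNhd_xiEntry hβ i j _
    (hd.apply_mem ht i j)).differentiableAt.hasDerivAt.comp t ((hd.path.isC11 i j).hasDerivAt t)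
  have hP : HasDerivAt (fun r => xiDeriv β (P r) i j)
      (deriv (xiEntry β i j) (P t i j) * P' t i j) t :=
    hxi.congr_of_eventuallyEq (.of_eq (funext fun r => xiDeriv_apply β (P r) i j))
  exact (hP.add_const _).sub (hasDerivAt_primitive hd.continuous_conjDeriv t i j)

lemma IsTruncatedPair.frob_forceLin_comm (hd : IsTruncatedPair Q μ P P' s) (t : ℝ)
    (B C : Matrix (Fin m) (Fin m) ℝ) :
    frob (forceLin β Q μ P P' s t B) C = frob (forceLin β Q μ P P' s t C) B := by
  rw [forceLin, forceLin, frob_sub_left, frob_sub_left, frob_mul_mul_left (hd.posDef_invHat t).1,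
    frob_comm B]
  congr 1
  refine Finset.sum_congr rfl fun i _ => Finset.sum_congr rfl fun j _ => ?_
  simp only [Matrix.of_apply]
  ring

lemma hasDerivWithinAt_mul_mul_apply {A : ℝ → Matrix (Fin m) (Fin m) ℝ}
    {A' : Matrix (Fin m) (Fin m) ℝ}
    (hA : ∀ i j, HasDerivWithinAt (fun r => A r i j) (A' i j) S t)
    (B : Matrix (Fin m) (Fin m) ℝ) (i j : Fin m) :
    HasDerivWithinAt (fun r => (A r * B * A r) i j) ((A' * B * A t + A t * B * A') i j) S t := by
  simp only [Matrix.mul_apply, Matrix.add_apply, ← Finset.sum_add_distrib]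
  refine HasDerivWithinAt.fun_sum fun k _ => HasDerivWithinAt.mul ?_ (hA k j)
  exact HasDerivWithinAt.fun_sum fun l _ => (hA i l).mul_const _

lemma IsTruncatedPair.hasDerivWithinAt_forceLin (hd : IsTruncatedPair Q μ P P' s)
    (hβ : ∀ j, Summable fun p : ℕ => (2 : ℝ) ^ p * β p j ^ 2) (ht : t ∈ Icc 0 s)
    (hZ : ∀ i j, HasDerivWithinAt (fun r => invHat Q μ P P' s r i j)
      (c * conjDeriv Q μ P P' s t i j) S t) (B : Matrix (Fin m) (Fin m) ℝ) (i j : Fin m) :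
    HasDerivWithinAt (fun r => forceLin β Q μ P P' s r B i j)
      (forceLinDeriv β Q μ P P' s c t B i j) S t := by
  have hxi := ((analyticOnNhd_xiEntry hβ i j _
    (hd.apply_mem ht i j)).deriv.differentiableAt.hasDerivAt.comp t
      ((hd.path.isC11 i j).hasDerivAt t)).mul_const (B i j)
  have hconj := hasDerivWithinAt_mul_mul_apply (A' := c • conjDeriv Q μ P P' s t) hZ B i j
  refine (hxi.hasDerivWithinAt.sub hconj).congr_deriv ?_
  simp [forceLinDeriv, xiThird]

/-- The complementarity condition on `S`: there the multiplier `Λ` is positive semidefinite and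
orthogonal to `X`. -/
structure IsComplementary (Λ X : ℝ → Matrix (Fin m) (Fin m) ℝ) (S : Set ℝ) : Prop where
  posSemidef : ∀ t ∈ S, (Λ t).PosSemidef
  frob_eq_zero : ∀ t ∈ S, frob (Λ t) (X t) = 0

lemma IsComplementary.posSemidef_of_tendsto {Λ X : ℝ → Matrix (Fin m) (Fin m) ℝ} {l : Filter ℝ}
    [l.NeBot] (hc : IsComplementary Λ X S) (hl : ∀ᶠ t in l, t ∈ S) (hM : Tendsto Λ l (𝓝 M)) :
    M.PosSemidef := by
  refine posSemidef_iff_isHermitian_and_nonneg.mpr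
    ⟨Matrix.IsHermitian.ext fun i j => ?_, fun v => ?_⟩
  · rw [star_trivial]
    refine tendsto_nhds_unique ((tendsto_matrix_iff.mp hM j i).congr' ?_)
      (tendsto_matrix_iff.mp hM i j)
    filter_upwards [hl] with t ht using apply_comm_of_isHermitian (hc.posSemidef t ht).1 i j
  · rw [← frob_vecMulVec]
    refine ge_of_tendsto (tendsto_frob hM tendsto_const_nhds) ?_
    filter_upwards [hl] with t ht
    rw [frob_vecMulVec]
    exact (posSemidef_iff_isHermitian_and_nonneg.mp (hc.posSemidef t ht)).2 v

lemma IsComplementary.frob_eq_zero_of_tendsto {Λ X : ℝ → Matrix (Fin m) (Fin m) ℝ}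
    {D : Matrix (Fin m) (Fin m) ℝ} {l : Filter ℝ} [l.NeBot] (hc : IsComplementary Λ X S)
    (hl : ∀ᶠ t in l, t ∈ S) (hM : Tendsto Λ l (𝓝 M)) (hD : Tendsto X l (𝓝 D)) :
    frob M D = 0 := by
  refine tendsto_nhds_unique (tendsto_frob hM hD) (tendsto_const_nhds.congr' ?_)
  filter_upwards [hl] with t ht using (hc.frob_eq_zero t ht).symm

lemma IsMonotonePath.isBigO_deriv_sub (hP : IsMonotonePath P P') (u : ℝ) (i j : Fin m) :
    (fun t => (P' t - P' u) i j) =O[𝓝 u] fun t => t - u := by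
  obtain ⟨K, U, hU, hK⟩ := (hP.isC11 i j).locallyLipschitz u
  refine IsBigO.of_bound K ?_
  filter_upwards [hU] with t ht
  exact hK.dist_le_mul t ht u (mem_of_mem_nhds hU)

lemma IsTruncatedPair.eventually_frob_forceLin_le (hd : IsTruncatedPair Q μ P P' s)
    (hβ : ∀ j, Summable fun p : ℕ => (2 : ℝ) ^ p * β p j ^ 2)
    (hc : IsComplementary (multiplier μ (force β h Q μ P P' s)) P' (Ico 0 s))
    (hS : IsAccumulationSide μ u σ I) (hu : u ∈ Ioo 0 s) (ha : 0 < a)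
    (hMF : (M - a • (σ • force β h Q μ P P' s u)).PosSemidef)
    (hFD : frob (force β h Q μ P P' s u) (P' u) = 0)
    (hN : ∀ᶠ t in 𝓝[side u σ] u, ∀ i j, multiplier μ (force β h Q μ P P' s) t i j =
      M i j + σ * ∫ r in I t, force β h Q μ P P' s r i j ∂μ) {δ : ℝ} (hδ : 0 < δ) :
    ∀ᶠ t in 𝓝[side u σ] u,
      frob (forceLin β Q μ P P' s u (P' u)) (P' t) ≤ δ * (σ * (t - u)) := by
  have := hd.prob
  have := hS.neBot
  have hexp := hS.hasTwoTermExpansion (F := force β h Q μ P P' s)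
    (fun i j => hd.integrable_force hβ i j)
    (fun i j => hd.hasDerivAt_force hβ (Ioo_subset_Icc_self hu) i j) hN
  have hl : ∀ᶠ t in 𝓝[side u σ] u, t ∈ Ico 0 s := nhdsWithin_le_nhds (Ico_mem_nhds hu.1 hu.2)
  have hM := hc.posSemidef_of_tendsto hl hexp.tendsto_zeroth
  have hMD := hc.frob_eq_zero_of_tendsto hl hexp.tendsto_zeroth
    ((hd.path.continuous_deriv.tendsto u).mono_left nhdsWithin_le_nhds)
  have hσ : σ ≠ 0 := left_ne_zero_of_mul_eq_one hS.mul_self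
  exact hexp.eventually_frob_le (hl.mono hc.posSemidef) ha hM
    (isHermitian_smul σ (hd.isHermitian_force u)) hMF
    (Eventually.of_forall hd.path.posSemidef_deriv) (hl.mono hc.frob_eq_zero)
    (hd.path.posSemidef_deriv u) hMD (by rw [frob_smul_left, hFD, mul_zero])
    (fun i j => ((hd.path.isBigO_deriv_sub u i j).mono nhdsWithin_le_nhds).trans
      (isBigO_self_const_mul hσ _ _)) hδ

/-- By symmetry, `⟨F'(t), P'(u)⟩ = ⟨forceLin t (P' u), P' t⟩`, which is at most
`⟨forceLinDeriv u (P' u), P' u⟩ (t - u) + o(t - u)`. -/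
lemma IsTruncatedPair.eventually_frob_forceLin_neg (hd : IsTruncatedPair Q μ P P' s)
    (hβ : ∀ j, Summable fun p : ℕ => (2 : ℝ) ^ p * β p j ^ 2) (hS : IsAccumulationSide μ u σ I)
    (hu : u ∈ Icc 0 s) (hZ : ∀ i j, HasDerivWithinAt (fun r => invHat Q μ P P' s r i j)
      (c * conjDeriv Q μ P P' s u i j) (side u σ) u)
    (hle : ∀ δ > 0, ∀ᶠ t in 𝓝[side u σ] u,
      frob (forceLin β Q μ P P' s u (P' u)) (P' t) ≤ δ * (σ * (t - u)))
    (hneg : σ * frob (forceLinDeriv β Q μ P P' s c u (P' u)) (P' u) < 0) :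
    ∀ᶠ t in 𝓝[side u σ] u, frob (forceLin β Q μ P P' s t (P' t)) (P' u) < 0 := by
  set ℓ := frob (forceLinDeriv β Q μ P P' s c u (P' u)) (P' u)
  have hu_side : u ∉ side u σ := by simp [side]
  have hslope := hasDerivWithinAt_apply_iff.mp (hd.hasDerivWithinAt_forceLin hβ hu hZ (P' u))
  rw [sdiff_singleton_eq_self hu_side] at hslope
  have hlim := (tendsto_frob hslope ((hd.path.continuous_deriv.tendsto u).mono_left
    nhdsWithin_le_nhds)).const_mul σ
  filter_upwards [hlim.eventually_lt_const (show σ * ℓ < σ * ℓ / 2 by linarith),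
    hle (-(σ * ℓ) / 2) (by linarith), self_mem_nhdsWithin] with t hquot hforce ht
  have ht_pos : 0 < σ * (t - u) := ht
  have htu : t - u ≠ 0 := right_ne_zero_of_mul ht_pos.ne'
  set g := frob ((t - u)⁻¹ •
    (forceLin β Q μ P P' s t (P' u) - forceLin β Q μ P P' s u (P' u))) (P' t) with hg
  have hsplit : frob (forceLin β Q μ P P' s t (P' t)) (P' u) =
      frob (forceLin β Q μ P P' s u (P' u)) (P' t) + σ * (t - u) * (σ * g) := by
    rw [hd.frob_forceLin_comm, hg, frob_smul_left, frob_sub_left, mul_mul_mul_comm, hS.mul_self,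
      one_mul, mul_inv_cancel_left₀ htu, add_sub_cancel]
  rw [hsplit]
  linarith [mul_lt_mul_of_pos_left hquot ht_pos]

lemma frob_eq_add_setIntegral {F : ℝ → Matrix (Fin m) (Fin m) ℝ}
    (hF : ∀ i j, Integrable (fun r => F r i j) μ) {N : Matrix (Fin m) (Fin m) ℝ}
    (hN : ∀ i j, N i j = M i j + σ * ∫ r in I t, F r i j ∂μ) (B : Matrix (Fin m) (Fin m) ℝ) :
    frob N B = frob M B + ∫ r in I t, σ * frob (F r) B ∂μ := by
  have hNM : N = M + σ • Matrix.of fun i j => ∫ r in I t, F r i j ∂μ := Matrix.ext hN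
  rw [hNM, frob_add_left, frob_smul_left, frob_integral fun i j => (hF i j).restrict,
    integral_const_mul]

theorem IsTruncatedPair.second_order_nonneg (hd : IsTruncatedPair Q μ P P' s)
    (hβ : ∀ j, Summable fun p : ℕ => (2 : ℝ) ^ p * β p j ^ 2)
    (hc : IsComplementary (multiplier μ (force β h Q μ P P' s)) P' (Ico 0 s))
    (hS : IsAccumulationSide μ u σ I) (hu : u ∈ Ioo 0 s)
    (hZ : ∀ i j, HasDerivWithinAt (fun r => invHat Q μ P P' s r i j)
      (c * conjDeriv Q μ P P' s u i j) (side u σ) u) (ha : 0 < a)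
    (hMF : (M - a • (σ • force β h Q μ P P' s u)).PosSemidef) (hMD : frob M (P' u) = 0)
    (hFD : frob (force β h Q μ P P' s u) (P' u) = 0)
    (hN : ∀ᶠ t in 𝓝[side u σ] u, ∀ i j, multiplier μ (force β h Q μ P P' s) t i j =
      M i j + σ * ∫ r in I t, force β h Q μ P P' s r i j ∂μ) :
    0 ≤ σ * frob (forceLinDeriv β Q μ P P' s c u (P' u)) (P' u) := by
  have := hS.neBot
  have hF := fun i j => hd.integrable_force (h := h) hβ i j
  by_contra! hneg
  have hderiv : ∀ᶠ t in 𝓝 u, HasDerivAt (fun t => frob (force β h Q μ P P' s t) (P' u))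
      (frob (forceLin β Q μ P P' s t (P' t)) (P' u)) t := by
    filter_upwards [Icc_mem_nhds hu.1 hu.2] with t ht
    exact HasDerivAt.fun_sum fun i _ => HasDerivAt.fun_sum fun j _ =>
      (hd.hasDerivAt_force hβ ht i j).mul_const _
  have hforce_neg := hS.eventually_forall_mem (hS.eventually_mul_neg hderiv hFD
    (hd.eventually_frob_forceLin_neg hβ hS (Ioo_subset_Icc_self hu) hZ
      (fun δ hδ => hd.eventually_frob_forceLin_le hβ hc hS hu ha hMF hFD hN hδ) hneg))
  have hl : ∀ᶠ t in 𝓝[side u σ] u, t ∈ Ico 0 s := nhdsWithin_le_nhds (Ico_mem_nhds hu.1 hu.2)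
  obtain ⟨t, ht_neg, ht_pos, ht_N, ht⟩ := (hforce_neg.and (hS.pos.and (hN.and hl))).exists
  have hFB : IntegrableOn (fun r => σ * frob (force β h Q μ P P' s r) (P' u)) (I t) μ :=
    ((integrable_finsetSum _ fun i _ => integrable_finsetSum _ fun j _ =>
      (hF i j).mul_const _).const_mul σ).integrableOn
  have hint := hS.setIntegral_pos ht_pos hFB.neg fun r hr => neg_pos.mpr (ht_neg r hr)
  have hfrob := frob_nonneg (hc.posSemidef t ht) (hd.path.posSemidef_deriv u)
  rw [frob_eq_add_setIntegral hF ht_N, hMD, zero_add] at hfrob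
  simp only [Pi.neg_apply, integral_neg] at hint
  linarith

end SecondOrder

section Atom

variable {m : ℕ} {β : ℕ → Fin m → ℝ} {h : Fin m → ℝ} {Q : Matrix (Fin m) (Fin m) ℝ}
  {μ : Measure ℝ} {F Φ P P' : ℝ → Matrix (Fin m) (Fin m) ℝ} {s t u : ℝ}

lemma measureReal_singleton_eq_sub_leftLim [IsProbabilityMeasure μ] (h0 : ∀ᵐ r ∂μ, 0 ≤ r)
    (u : ℝ) : μ.real {u} = distFun μ u - Function.leftLim (distFun μ) u := by
  have hatom := (ProbabilityTheory.cdf μ).measure_singleton u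
  rw [ProbabilityTheory.measure_cdf, ← distFun_eq_cdf h0] at hatom
  rw [measureReal_def, hatom, ENNReal.toReal_ofReal]
  exact sub_nonneg.mpr (monotone_distFun.leftLim_le le_rfl)

lemma continuousAt_distFun [IsProbabilityMeasure μ] (h0 : ∀ᵐ r ∂μ, 0 ≤ r) (hu : μ {u} = 0) :
    ContinuousAt (distFun μ) u := by
  have hatom := measureReal_singleton_eq_sub_leftLim h0 u
  rw [measureReal_def, hu, ENNReal.toReal_zero, eq_comm, sub_eq_zero] at hatom
  refine continuousAt_iff_continuous_left'_right'.mpr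
    ⟨?_, (continuousWithinAt_distFun h0 u).mono Ioi_subset_Ici_self⟩
  rw [ContinuousWithinAt, hatom]
  exact monotone_distFun.tendsto_leftLim u

lemma multiplier_eq_add_setIntegral_Ioc (hF : ∀ i j, Integrable (fun r => F r i j) μ)
    (hut : u ≤ t) (i j : Fin m) :
    multiplier μ F t i j = multiplier μ F u i j + ∫ r in Ioc u t, F r i j ∂μ := by
  simp only [multiplier, Matrix.neg_apply, Matrix.of_apply]
  rw [← Ioc_union_Ioi_eq_Ioi hut, setIntegral_union (Ioc_disjoint_Ioi le_rfl) measurableSet_Ioi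
    (hF i j).integrableOn (hF i j).integrableOn]
  ring

lemma multiplier_sub_smul_apply (hF : ∀ i j, Integrable (fun r => F r i j) μ) (u : ℝ)
    (i j : Fin m) :
    (multiplier μ F u - μ.real {u} • F u) i j = -∫ r in Ici u, F r i j ∂μ := by
  rw [← Ioi_union_left, setIntegral_union (by simp) (measurableSet_singleton u)
    (hF i j).integrableOn (hF i j).integrableOn, integral_singleton]
  simp only [multiplier, Matrix.sub_apply, Matrix.neg_apply, Matrix.of_apply, Matrix.smul_apply,
    smul_eq_mul]
  ring

lemma tendsto_multiplier_left (hF : ∀ i j, Integrable (fun r => F r i j) μ) (u : ℝ) :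
    Tendsto (multiplier μ F) (𝓝[<] u) (𝓝 (multiplier μ F u - μ.real {u} • F u)) := by
  refine tendsto_matrix_iff.mpr fun i j => ?_
  rw [multiplier_sub_smul_apply hF]
  exact (tendsto_setIntegral_Ioi_left (hF i j) u).neg

lemma multiplier_eq_sub_setIntegral_Ioo (hF : ∀ i j, Integrable (fun r => F r i j) μ)
    (htu : t < u) (i j : Fin m) :
    multiplier μ F t i j =
      (multiplier μ F u - μ.real {u} • F u) i j - ∫ r in Ioo t u, F r i j ∂μ := by
  rw [multiplier_sub_smul_apply hF]
  simp only [multiplier, Matrix.neg_apply, Matrix.of_apply]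
  rw [← Ioo_union_Ici_eq_Ioi htu, setIntegral_union
    ((Iio_disjoint_Ici le_rfl).mono_left Ioo_subset_Iio_self) measurableSet_Ici
    (hF i j).integrableOn (hF i j).integrableOn]
  ring

/-- The derivative of `P̂⁻¹` jumps at an atom of mass `a` by `a P̂⁻¹ P' P̂⁻¹`, so the second-order
inequalities from the right and from the left add up to `a ⟨P̂⁻¹ P' P̂⁻¹ P' P̂⁻¹, P'⟩ ≤ 0`. -/
theorem IsTruncatedPair.measure_singleton_eq_zero (hd : IsTruncatedPair Q μ P P' s)
    (hβ : ∀ j, Summable fun p : ℕ => (2 : ℝ) ^ p * β p j ^ 2)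
    (hc : IsComplementary (multiplier μ (force β h Q μ P P' s)) P' (Ico 0 s))
    (hu : u ∈ Ioo 0 s) (hright : IsAccumulationSide μ u 1 (Ioc u))
    (hleft : IsAccumulationSide μ u (-1) fun t => Ioo t u) (hP'u : P' u ≠ 0) : μ {u} = 0 := by
  have := hd.prob
  have hcubic := frob_mul_mul_mul_mul_pos (hd.posDef_invHat u) (hd.path.posSemidef_deriv u) hP'u
  have hjump := measureReal_singleton_eq_sub_leftLim hd.nonneg u
  by_contra hne
  have ha : 0 < μ.real {u} := ENNReal.toReal_pos hne (measure_ne_top _ _)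
  set F := force β h Q μ P P' s
  have hF : ∀ i j, Integrable (fun r => F r i j) μ := fun i j => hd.integrable_force hβ i j
  have hM := hc.posSemidef u ⟨hu.1.le, hu.2⟩
  have hMD := hc.frob_eq_zero u ⟨hu.1.le, hu.2⟩
  have hl : ∀ᶠ t in 𝓝[<] u, t ∈ Ico 0 s := nhdsWithin_le_nhds (Ico_mem_nhds hu.1 hu.2)
  have hleftMD := hc.frob_eq_zero_of_tendsto hl (tendsto_multiplier_left hF u)
    ((hd.path.continuous_deriv.tendsto u).mono_left nhdsWithin_le_nhds)
  have hFD : frob (F u) (P' u) = 0 := by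
    rw [frob_sub_left, hMD, frob_smul_left, zero_sub, neg_eq_zero] at hleftMD
    exact (mul_eq_zero.mp hleftMD).resolve_left ha.ne'
  have hsecond_right := hd.second_order_nonneg hβ hc hright hu
    (fun i j => (hd.hasDerivWithinAt_invHat_right hu.2 i j).mono
      ((side_one u).trans_subset Ioi_subset_Ici_self)) ha (M := multiplier μ F u)
    (by
      rw [one_smul]
      exact hc.posSemidef_of_tendsto hl (tendsto_multiplier_left hF u)) hMD hFD (by
      rw [side_one]
      filter_upwards [self_mem_nhdsWithin] with t ht i j
      rw [one_mul]
      exact multiplier_eq_add_setIntegral_Ioc hF (le_of_lt ht) i j)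
  have hsecond_left := hd.second_order_nonneg hβ hc hleft hu
    (fun i j => (hd.hasDerivWithinAt_invHat_left hu.2 i j).mono
      ((side_neg_one u).trans_subset Iio_subset_Iic_self)) ha
    (M := multiplier μ F u - μ.real {u} • F u)
    (by rwa [neg_one_smul, smul_neg, sub_neg_eq_add, sub_add_cancel]) hleftMD hFD (by
      rw [side_neg_one]
      filter_upwards [self_mem_nhdsWithin] with t ht i j
      rw [neg_one_mul, ← sub_eq_add_neg]
      exact multiplier_eq_sub_setIntegral_Ioo hF ht i j)
  rw [frob_forceLinDeriv_self] at hsecond_right hsecond_left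
  nlinarith [mul_pos ha hcubic]

lemma eq_one_of_hasDerivAt_of_eq_self {g : ℝ → ℝ} {g' : ℝ} {v : ℕ → ℝ} (hg : HasDerivAt g g' u)
    (hgu : g u = u) (hv : ∀ n, v n ≠ u) (hlim : Tendsto v atTop (𝓝 u))
    (hgv : ∀ n, g (v n) = v n) : g' = 1 := by
  have hslope := hg.tendsto_slope.comp (tendsto_nhdsWithin_iff.mpr
    ⟨hlim, Eventually.of_forall fun n => hv n⟩)
  refine tendsto_nhds_unique hslope (tendsto_const_nhds.congr fun n => ?_)
  simp [slope_def_field, hgu, hgv, div_self (sub_ne_zero.mpr (hv n))]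

lemma IsMonotonePath.deriv_ne_zero_of_trace_eq (hP : IsMonotonePath P P') {v : ℕ → ℝ}
    (hu : (P u).trace = u) (hv : ∀ n, v n ≠ u) (hv_lim : Tendsto v atTop (𝓝 u))
    (hv_trace : ∀ n, (P (v n)).trace = v n) : P' u ≠ 0 := fun hzero => by
  have htrace : (P' u).trace = 1 := eq_one_of_hasDerivAt_of_eq_self (g := fun t => (P t).trace)
    (HasDerivAt.fun_sum fun i _ => (hP.isC11 i i).hasDerivAt u) hu hv hv_lim hv_trace
  simp [hzero] at htrace

theorem IsCSMinimizer.measure_singleton_eq_zero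
    (hβ : ∀ j, Summable fun p : ℕ => (2 : ℝ) ^ p * β p j ^ 2) (hQ : IsConstraint Q)
    (hmin : IsCSMinimizer β h Q μ Φ) {v w : ℕ → ℝ}
    (hv : ∀ n, v n < u) (hv_supp : ∀ n, v n ∈ μ.support) (hv_lim : Tendsto v atTop (𝓝 u))
    (hw : ∀ n, u < w n) (hw_supp : ∀ n, w n ∈ μ.support) (hw_lim : Tendsto w atTop (𝓝 u)) :
    μ {u} = 0 := by
  have hm : 1 ≤ m := Nat.cast_pos.mp (topPoint_nonneg.trans_lt hmin.1.top_lt)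
  obtain ⟨s, hs⟩ := hmin.1.exists_isCutoff
  obtain ⟨P, P', hP, hPΦ⟩ := hmin.1.path.exists_isMonotonePath hm
  have hd := hmin.1.isTruncatedPair hQ hP hPΦ hs
  have := hd.prob
  have hsupp : μ.support ⊆ Icc 0 s := Measure.support_subset_of_isClosed isClosed_Icc (by
    filter_upwards [hd.nonneg, hd.le] with r h1 h2 using ⟨h1, h2⟩)
  have htrace : ∀ r ∈ μ.support, (P r).trace = r := fun r hr => by
    rw [(hPΦ r ⟨(hsupp hr).1, (hsupp hr).2.trans hs.2.1.le⟩).1, hmin.1.path.trace_eq r hr]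
  have hu_supp : u ∈ μ.support :=
    Measure.isClosed_support.mem_of_tendsto hw_lim (Eventually.of_forall hw_supp)
  have hc : IsComplementary (multiplier μ (force β h Q μ P P' s)) P' (Ico 0 s) :=
    ⟨fun t ht => hmin.posSemidef_multiplier hm hβ hQ hP hPΦ hs ht.1,
      fun t ht => hmin.frob_multiplier_eq_zero hm hβ hQ hP hPΦ hs ht⟩
  exact hd.measure_singleton_eq_zero hβ hc
    ⟨(hsupp (hv_supp 0)).1.trans_lt (hv 0), (hw 0).trans_le (hsupp (hw_supp 0)).2⟩
    (isAccumulationSide_right hw hw_supp hw_lim) (isAccumulationSide_left hv hv_supp hv_lim)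
    (hP.deriv_ne_zero_of_trace_eq (htrace u hu_supp) (fun n => (hw n).ne') hw_lim
      fun n => htrace _ (hw_supp n))

end Atom

end VectorSpin

theorem mainTheorem11_general (m : ℕ) (β : ℕ → Fin m → ℝ)
    (hβ : ∀ j, Summable fun p : ℕ => (2 : ℝ) ^ p * β p j ^ 2) (h : Fin m → ℝ)
    (Q : Matrix (Fin m) (Fin m) ℝ) (hQ : VectorSpin.IsConstraint Q)
    (μ : Measure ℝ) (Φ : ℝ → Matrix (Fin m) (Fin m) ℝ)
    (hmin : VectorSpin.IsCSMinimizer β h Q μ Φ)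
    (u₀ : ℝ) (um up : ℕ → ℝ)
    (hum : StrictMono um) (hum_supp : ∀ l, um l ∈ μ.support)
    (hum_lim : Tendsto um atTop (𝓝 u₀))
    (hup : StrictAnti up) (hup_supp : ∀ l, up l ∈ μ.support)
    (hup_lim : Tendsto up atTop (𝓝 u₀)) :
    ContinuousAt (VectorSpin.distFun μ) u₀ ∧ μ {u₀} = 0 := by
  have := hmin.1.prob
  have hum_lt : ∀ n, um n < u₀ := fun n =>
    (hum n.lt_succ_self).trans_le (hum.monotone.ge_of_tendsto hum_lim _)
  have hlt_up : ∀ n, u₀ < up n := fun n =>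
    (hup.antitone.le_of_tendsto hup_lim _).trans_lt (hup n.lt_succ_self)
  have hatom : μ {u₀} = 0 := hmin.measure_singleton_eq_zero hβ hQ hum_lt hum_supp hum_lim
    hlt_up hup_supp hup_lim
  have hnonneg := (VectorSpin.ae_mem_of_concentrated hmin.1.concentrated).1
  exact ⟨VectorSpin.continuousAt_distFun hnonneg hatom, hatom⟩

theorem mainTheorem11 (m : ℕ) (hm : 1 ≤ m) (β : ℕ → Fin m → ℝ)
    (hβ : VectorSpin.IsEvenMixture β) (h : Fin m → ℝ)
    (Q : Matrix (Fin m) (Fin m) ℝ) (hQ : VectorSpin.IsConstraint Q)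
    (μ : Measure ℝ) (Φ : ℝ → Matrix (Fin m) (Fin m) ℝ)
    (hmin : VectorSpin.IsCSMinimizer β h Q μ Φ)
    (u₀ : ℝ) (um up : ℕ → ℝ)
    (hum : StrictMono um) (hum_supp : ∀ l, um l ∈ μ.support)
    (hum_lim : Tendsto um atTop (𝓝 u₀))
    (hup : StrictAnti up) (hup_supp : ∀ l, up l ∈ μ.support)
    (hup_lim : Tendsto up atTop (𝓝 u₀)) :
    ContinuousAt (VectorSpin.distFun μ) u₀ ∧ μ {u₀} = 0 :=
  mainTheorem11_general m β hβ.summable h Q hQ μ Φ hmin u₀ um up hum hum_supp hum_lim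
    hup hup_supp hup_lim
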